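/- Let $n\ge 1$ and let $\mathbb H=\{Z=(z,z_{n+1})\in\mathbb C^n\times\mathbb C:\operatorname{Im}z_{n+1}>\sum_{j\le n}|z_j|^2\}$. Put $\beta(Z)=\sum_{j\le n}|z_j|^2$, $\rho(Z)=\operatorname{Im}z_{n+1}-\beta(Z)$, $t(Z)=\operatorname{Re}z_{n+1}$. Let $G(\mathbb Z)$ be the group of matrices $\gamma=\operatorname{diag}(\sigma,\begin{pmatrix}a&b\\c&d\end{pmatrix})$, $\sigma\in S_n$ a permutation matrix, $\begin{pmatrix}a&b\\c&d\end{pmatrix}\in SL(2,\mathbb Z)$, acting by $\gamma(Z)=\left(\frac{\sigma(z)}{cz_{n+1}+d},\frac{az_{n+1}+b}{cz_{n+1}+d}\right)$, let $G(\mathbb Z)_\infty$ be the subgroup $c=0$, and let $$L=\rho\Big[\sum_{j=1}^{n+1}2i\Big(\overline{z_j}\frac{\partial^2}{\partial z_{n+1}\partial\overline{z_j}}-z_j\frac{\partial^2}{\partial\overline{z_{n+1}}\partial z_j}\Big)+\sum_{j=1}^n\frac{\partial^2}{\partial z_j\partial\overline{z_j}}\Big]$$ be the Laplace–Beltrami operator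 of $U(n+1,1)$. For an open, dense, $G(\mathbb Z)$-invariant $\Omega\subseteq\mathbb H$ let $\mathcal N_\Omega(\lambda)$ be the space of $C^2$ functions $f:\Omega\to\mathbb C$ with (1) $Lf=\lambda f$; (2) $f(\gamma(Z))=f(Z)$ for $\gamma\in G(\mathbb Z)$; (3) polynomial growth: there are $C>0$ and $k$ such that for every $\beta_0$ there is $R$ with $|f(Z)|\le C\rho(Z)^k$ for all $Z\in\Omega$ with $\beta(Z)=\beta_0$, $\rho(Z)\ge R$. Put $$x(Z,Z')=\frac{(t(Z)-t(Z'))^2+(\rho(Z)+\beta(Z)-\rho(Z')-\beta(Z'))^2}{4\rho(Z)(\rho(Z')+\beta(Z'))},\qquad y(Z)=\frac{\beta(Z)}{\rho(Z)}.$$ Then $G(\mathbb Z)$ preserves $\mathbb H$, and $x(\gamma Z,\gamma Z')=x(Z,Z')$, $y(\gamma Z)=y(Z)$ for all $\gamma\in G(\mathbb Z)$, $Z,Z'\in\mathbb H$. Let $F_3(\alpha,\alpha';\beta,\beta';\gamma;x,y)$ and ${}_2F_1$ denote the Appell and Gauss functions, holomorphically continued to arguments in $\mathbb C\setminus[1,\infty)$.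 (A) Let $a+b=s$, $\operatorname{Re}s>n$, $\operatorname{Re}a>1$, $\operatorname{Re}b>n-1$, and $g_s(x,y)=x^{-a}y^{-b}F_3(a,b;a,b-n+1;2s-n;-x^{-1},-y^{-1})$. For every $Z'\in\mathbb H$ the Poincaré series $r(Z,Z';s)=\sum_{\gamma\in G(\mathbb Z)}g_s(x(Z,\gamma Z'),y(Z))$ converges absolutely on $\Omega_{Z'}=\{Z\in\mathbb H:z\ne0,\ z_{n+1}\notin SL(2,\mathbb Z)z'_{n+1}\}$ and lies in $\mathcal N_{\Omega_{Z'}}(s(s-n-1))$. If $z'_{n+1}\notin SL(2,\mathbb Z)z''_{n+1}$, then $r(\cdot,Z';s)$ and $r(\cdot,Z'';s)$ do not coincide on $\Omega_{Z'}\cap\Omega_{Z''}$; in particular there are infinitely many such series. (B) Let $\operatorname{Re}s>n$. The same convergence and membership hold for $g_s=x^{-s}{}_2F_1(s,s;2s-n;-x^{-1})$ on $\{Z\in\mathbb H:z_{n+1}\notin SL(2,\mathbb Z)z'_{n+1}\}$, and for $g_s=(x+y)^{-s}{}_2F_1(s,s-n;2s-n;-(x+y)^{-1})$ on $\{Z\in\mathbb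 H:z\neq0\text{ or }z_{n+1}\notin SL(2,\mathbb Z)z'_{n+1}\}$. The space $\mathcal N_{\mathbb H}(s(s-n-1))$ has infinitely many elements. (C) Let $\operatorname{Re}s>n$ and $E(Z;\lambda,\mu)=\sum_{\gamma\in G(\mathbb Z)_\infty\backslash G(\mathbb Z)}\rho(\gamma Z)^\lambda\beta(\gamma Z)^\mu$. Then $E(Z;s,0)$ converges absolutely on $\mathbb H$ and lies in $\mathcal N_{\mathbb H}(s(s-n-1))$, and $E(Z;s,1-n)$ converges absolutely on $\Omega=\{Z\in\mathbb H:z\ne0\}$ and lies in $\mathcal N_\Omega(s(s-n-1))$. (D) Write $q(z)=z_1^2+\dots+z_n^2$. For $k\in\mathbb Z$, $m\in\mathbb R$ let $M_{k,m}$ be the set of $\phi:\mathbb H\to\mathbb C$ with $\phi\big(\frac{z}{cz_{n+1}+d},\frac{az_{n+1}+b}{cz_{n+1}+d}\big)=(cz_{n+1}+d)^ke^{2\pi imc\,q(z)/(cz_{n+1}+d)}\phi(z,z_{n+1})$ for all $\begin{pmatrix}a&b\\c&d\end{pmatrix}\in SL(2,\mathbb Z)$, $\phi(wz,z_{n+1})=\phi(z,z_{n+1})$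 for $w\in S_n$, and $\phi$ bounded for $z$ in a compact set and $\operatorname{Im}z_{n+1}$ large. For $k\in\{4,6\}$ put $$E_{k,m}(z,z_{n+1})=\sum_{\gamma\in G(\mathbb Z)_\infty\backslash G(\mathbb Z)}(cz_{n+1}+d)^{-k}e^{-2\pi imc\,q(z)/(cz_{n+1}+d)},$$ $g_{2,m}=\frac43\pi^4E_{4,m}$, $g_{3,m}=\frac8{27}\pi^6E_{6,m}$, $\Delta_m=g_{2,m}^3-27g_{3,\frac32m}^2$, $j_m=1728g_{2,m}^3/\Delta_m$. For every $m\in\mathbb N$ the series $E_{4,m}$ and $E_{6,\frac32m}$ converge absolutely on $\mathbb H$ and lie in $M_{4,m}$ and $M_{6,\frac32m}$; $g_{2,m}^3$ and $\Delta_m$ are holomorphic on $\mathbb H$ and lie in $M_{12,3m}$; $\Delta_m$ is not identically zero; and $\{\Delta_m\neq0\}$ is $G(\mathbb Z)$-invariant with $j_m(\gamma Z)=j_m(Z)$ there for all $\gamma\in G(\mathbb Z)$. Thus $j_m$ is a $G(\mathbb Z)$-invariant modular (meromorphic) function. -/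

import Mathlib

open scoped BigOperators MatrixGroups ComplexConjugate

noncomputable section

namespace UnitaryForms

/-! ### The Siegel domain and its coordinates -/

/-- Points `Z = (z, z_{n+1})` of `ℂⁿ × ℂ = ℂⁿ⁺¹`. -/
abbrev Pt (n : ℕ) : Type := (Fin n → ℂ) × ℂ

/-- `β(Z) = ∑_{j ≤ n} |z_j|²`. -/
def beta {n : ℕ} (Z : Pt n) : ℝ := ∑ j, ‖Z.1 j‖ ^ 2

/-- `ρ(Z) = Im z_{n+1} - ∑_{j ≤ n} |z_j|²`. -/
def rho {n : ℕ} (Z : Pt n) : ℝ := Z.2.im - beta Z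

/-- `t(Z) = Re z_{n+1}`. -/
def tt {n : ℕ} (Z : Pt n) : ℝ := Z.2.re

/-- Complex hyperbolic space as the Siegel domain `Im z_{n+1} > ∑_{j ≤ n} |z_j|²`. -/
def HH (n : ℕ) : Set (Pt n) := {Z | ∑ j, ‖Z.1 j‖ ^ 2 < Z.2.im}

/-! ### The modular group -/

/-- `G(ℤ)`: the block diagonal matrices `diag(σ, A)`, `σ` an `n × n` permutation matrix and
`A ∈ SL(2, ℤ)`. -/
abbrev GZ (n : ℕ) : Type := Equiv.Perm (Fin n) × SL(2, ℤ)

/-- The denominator `c z_{n+1} + d`. -/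
def den {n : ℕ} (A : SL(2, ℤ)) (Z : Pt n) : ℂ := (A 1 0 : ℂ) * Z.2 + (A 1 1 : ℂ)

/-- The action of `G(ℤ)`:
`γ(Z) = (σ(z) / (c z_{n+1} + d), (a z_{n+1} + b) / (c z_{n+1} + d))`; the permutation
matrix of `σ` sends `z` to `z ∘ σ⁻¹`. -/
def act {n : ℕ} (γ : GZ n) (Z : Pt n) : Pt n :=
  (fun j => Z.1 (γ.1⁻¹ j) / den γ.2 Z,
    ((γ.2 0 0 : ℂ) * Z.2 + (γ.2 0 1 : ℂ)) / den γ.2 Z)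

/-- The parabolic subgroup `G(ℤ)_∞`, given by `c = 0` (so `a = d = ±1`). -/
def GZinf (n : ℕ) : Subgroup (GZ n) where
  carrier := {γ | γ.2 1 0 = 0}
  mul_mem' := by
    intro x y hx hy
    simp only [Set.mem_ofPred_eq] at hx hy ⊢
    simp [Matrix.SpecialLinearGroup.coe_mul, Matrix.mul_apply, Fin.sum_univ_two, hx, hy]
  one_mem' := by simp
  inv_mem' := by
    intro x hx
    simp only [Set.mem_ofPred_eq] at hx ⊢
    simp [Matrix.SpecialLinearGroup.coe_inv, Matrix.adjugate_fin_two, hx]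

/-- The set `G(ℤ)_∞ \ G(ℤ)` of cosets `G(ℤ)_∞ γ`. -/
abbrev Cosets (n : ℕ) : Type := Quotient (QuotientGroup.rightRel (GZinf n))

/-! ### The Laplace–Beltrami operator -/

/-- The Wirtinger derivative `∂/∂ζ` in the complex direction `v`. -/
def dW {n : ℕ} (v : Pt n) (f : Pt n → ℂ) (Z : Pt n) : ℂ :=
  (fderiv ℝ f Z v - Complex.I * fderiv ℝ f Z (Complex.I • v)) / 2

/-- The Wirtinger derivative `∂/∂ζ̄` in the complex direction `v`. -/
def dWbar {n : ℕ} (v : Pt n) (f : Pt n → ℂ) (Z : Pt n) : ℂ :=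
  (fderiv ℝ f Z v + Complex.I * fderiv ℝ f Z (Complex.I • v)) / 2

/-- The coordinate direction of `z_j`, `j ≤ n`. -/
def ez {n : ℕ} (j : Fin n) : Pt n := (Pi.single j 1, 0)

/-- The coordinate direction of `z_{n+1}`. -/
def ew {n : ℕ} : Pt n := (0, 1)

/-- The Laplace–Beltrami operator of `U(n+1,1)` on the Siegel domain,
`L = ρ [ ∑_{j=1}^{n+1} 2i ( z̄_j ∂²/∂z_{n+1}∂z̄_j - z_j ∂²/∂z̄_{n+1}∂z_j )
  + ∑_{j=1}^{n} ∂²/∂z_j∂z̄_j ]`. -/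
def lap {n : ℕ} (f : Pt n → ℂ) (Z : Pt n) : ℂ :=
  (rho Z : ℂ) *
    ((∑ j : Fin n, 2 * Complex.I *
        (conj (Z.1 j) * dW ew (dWbar (ez j) f) Z - Z.1 j * dWbar ew (dW (ez j) f) Z))
      + 2 * Complex.I * (conj Z.2 * dW ew (dWbar ew f) Z - Z.2 * dWbar ew (dW ew f) Z)
      + ∑ j : Fin n, dW (ez j) (dWbar (ez j) f) Z)

/-! ### Nonholomorphic automorphic forms -/

/-- `F` restricts to a nonholomorphic automorphic form with eigenvalue `lam` that is regular on
the open dense `G(ℤ)`-invariant subset `Ω` of the Siegel domain. Only the values of `F` on `Ω`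
matter. -/
structure IsAutForm (n : ℕ) (Ω : Set (Pt n)) (lam : ℂ) (F : Pt n → ℂ) : Prop where
  isOpen : IsOpen Ω
  subset : Ω ⊆ HH n
  dense : HH n ⊆ closure Ω
  act_mem : ∀ γ : GZ n, ∀ Z ∈ Ω, act γ Z ∈ Ω
  contDiffOn : ContDiffOn ℝ 2 F Ω
  eigen : ∀ Z ∈ Ω, lap F Z = lam * F Z
  invariant : ∀ γ : GZ n, ∀ Z ∈ Ω, F (act γ Z) = F Z
  growth : ∃ C > (0 : ℝ), ∃ k : ℝ, ∀ β₀ : ℝ, ∃ R > (0 : ℝ), ∀ Z ∈ Ω,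
    beta Z = β₀ → R ≤ rho Z → ‖F Z‖ ≤ C * rho Z ^ k

/-- The space `𝒩_Ω(G(ℤ), lam)` of functions on `Ω`; for `Ω = HH n` these are the forms that are
regular on the whole Siegel domain. -/
def autForms (n : ℕ) (Ω : Set (Pt n)) (lam : ℂ) : Set (Ω → ℂ) :=
  {f | ∃ F : Pt n → ℂ, IsAutForm n Ω lam F ∧ Ω.domRestrict F = f}

/-! ### Hypergeometric functions -/

/-- The plane cut along `[1, ∞)`. -/
def cutPlane : Set ℂ := {z | 1 - z ∈ Complex.slitPlane}

/-- The Gauss function `₂F₁(a, b; c; z)` on the plane cut along `[1, ∞)`: the (unique)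
holomorphic continuation of the hypergeometric series in the unit disc. -/
def gaussF (a b c : ℂ) : ℂ → ℂ :=
  Classical.epsilon fun F : ℂ → ℂ =>
    DifferentiableOn ℂ F cutPlane ∧ ∀ z : ℂ, ‖z‖ < 1 → F z = ordinaryHypergeometric a b c z

/-- The Pochhammer symbol `(a)_m = a (a+1) ⋯ (a+m-1)`. -/
def poch (a : ℂ) (m : ℕ) : ℂ := (ascPochhammer ℂ m).eval a

/-- The double series of Appell's function `F₃(α, α'; β, β'; γ; x, y)` for `|x|, |y| < 1`. -/
def appellSeries (α α' β β' γ : ℂ) (p : ℂ × ℂ) : ℂ :=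
  ∑' mk : ℕ × ℕ, poch α mk.1 * poch α' mk.2 * poch β mk.1 * poch β' mk.2 /
    (poch γ (mk.1 + mk.2) * (mk.1.factorial : ℂ) * (mk.2.factorial : ℂ)) *
      p.1 ^ mk.1 * p.2 ^ mk.2

/-- Appell's function `F₃(α, α'; β, β'; γ; x, y)` for `x, y` in the plane cut along `[1, ∞)`: the
(unique) holomorphic continuation of the double series in the unit polydisc. -/
def appellF3 (α α' β β' γ : ℂ) : ℂ × ℂ → ℂ :=
  Classical.epsilon fun F : ℂ × ℂ → ℂ =>
    DifferentiableOn ℂ F (cutPlane ×ˢ cutPlane) ∧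
      ∀ p : ℂ × ℂ, ‖p.1‖ < 1 → ‖p.2‖ < 1 → F p = appellSeries α α' β β' γ p

/-! ### Poincaré series -/

/-- `x(Z, Z')`. -/
def xinv {n : ℕ} (Z Z' : Pt n) : ℝ :=
  ((tt Z - tt Z') ^ 2 + (rho Z + beta Z - rho Z' - beta Z') ^ 2) /
    (4 * rho Z * (rho Z' + beta Z'))

/-- `y(Z) = β(Z) / ρ(Z)`. -/
def yinv {n : ℕ} (Z : Pt n) : ℝ := beta Z / rho Z

/-- The nondegenerate kernel
`x^{-a} y^{-b} F₃(a, b; a, b-n+1; 2s-n; -x⁻¹, -y⁻¹)` with `s = a + b`. -/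
def kerF3 (n : ℕ) (a b : ℂ) (x y : ℝ) : ℂ :=
  (x : ℂ) ^ (-a) * (y : ℂ) ^ (-b) *
    appellF3 a b a (b - n + 1) (2 * (a + b) - n) (-(x : ℂ)⁻¹, -(y : ℂ)⁻¹)

/-- The degenerate kernel `x^{-s} ₂F₁(s, s; 2s-n; -x⁻¹)`. -/
def kerX (n : ℕ) (s : ℂ) (x _y : ℝ) : ℂ :=
  (x : ℂ) ^ (-s) * gaussF s s (2 * s - n) (-(x : ℂ)⁻¹)

/-- The degenerate kernel `(x+y)^{-s} ₂F₁(s, s-n; 2s-n; -(x+y)⁻¹)`. -/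
def kerXY (n : ℕ) (s : ℂ) (x y : ℝ) : ℂ :=
  ((x + y : ℝ) : ℂ) ^ (-s) * gaussF s (s - n) (2 * s - n) (-((x + y : ℝ) : ℂ)⁻¹)

/-- The terms `g(x(Z, γ Z'), y(Z))`, `γ ∈ G(ℤ)`, of the Poincaré series of a kernel `g`. -/
def poincareTerm {n : ℕ} (g : ℝ → ℝ → ℂ) (Z Z' : Pt n) (γ : GZ n) : ℂ :=
  g (xinv Z (act γ Z')) (yinv Z)

/-- The Poincaré series `∑_{γ ∈ G(ℤ)} g(x(Z, γ Z'), y(Z))`. -/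
def poincare {n : ℕ} (g : ℝ → ℝ → ℂ) (Z Z' : Pt n) : ℂ := ∑' γ : GZ n, poincareTerm g Z Z' γ

/-- `z_{n+1}` lies in the `SL(2, ℤ)`-orbit of `z'_{n+1}`. -/
def SameOrbit {n : ℕ} (Z Z' : Pt n) : Prop := ∃ γ : GZ n, Z.2 = (act γ Z').2

/-- The regular set of the nondegenerate series: `z ≠ 0` and `z_{n+1} ∉ SL(2, ℤ) z'_{n+1}`. -/
def regF3 {n : ℕ} (Z' : Pt n) : Set (Pt n) := {Z | Z ∈ HH n ∧ Z.1 ≠ 0 ∧ ¬ SameOrbit Z Z'}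

/-- The regular set of the first degenerate series: `z_{n+1} ∉ SL(2, ℤ) z'_{n+1}`. -/
def regX {n : ℕ} (Z' : Pt n) : Set (Pt n) := {Z | Z ∈ HH n ∧ ¬ SameOrbit Z Z'}

/-- The regular set of the second degenerate series: `z ≠ 0` or
`z_{n+1} ∉ SL(2, ℤ) z'_{n+1}`. -/
def regXY {n : ℕ} (Z' : Pt n) : Set (Pt n) := {Z | Z ∈ HH n ∧ (Z.1 ≠ 0 ∨ ¬ SameOrbit Z Z')}

/-! ### Eisenstein series -/

/-- The terms `ρ(γ Z)^lam β(γ Z)^mu`; for `Z` in the Siegel domain they do not depend on the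
representative `γ` of the coset. -/
def eisTerm {n : ℕ} (lam mu : ℂ) (Z : Pt n) (q : Cosets n) : ℂ :=
  (rho (act q.out Z) : ℂ) ^ lam * (beta (act q.out Z) : ℂ) ^ mu

/-- `E(Z; lam, mu) = ∑_{γ ∈ G(ℤ)_∞ \ G(ℤ)} ρ(γ Z)^lam β(γ Z)^mu`. -/
def eis {n : ℕ} (lam mu : ℂ) (Z : Pt n) : ℂ := ∑' q : Cosets n, eisTerm lam mu Z q

/-- The set `z ≠ 0` in the Siegel domain. -/
def offAxis (n : ℕ) : Set (Pt n) := {Z | Z ∈ HH n ∧ Z.1 ≠ 0}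

/-! ### Modular forms and the functions `j_m` -/

/-- `z_1² + ⋯ + z_n²`. -/
def sq {n : ℕ} (Z : Pt n) : ℂ := ∑ j, Z.1 j ^ 2

/-- Modular forms of weight `k` and index `m`: elements of `M_{k,m}(G(ℤ))`. -/
structure IsModForm (n : ℕ) (k : ℤ) (m : ℝ) (φ : Pt n → ℂ) : Prop where
  transform : ∀ A : SL(2, ℤ), ∀ Z ∈ HH n,
    φ (act (1, A) Z) = den A Z ^ k *
      Complex.exp (2 * Real.pi * Complex.I * m * (A 1 0 : ℂ) * sq Z / den A Z) * φ Z
  perm : ∀ w : Equiv.Perm (Fin n), ∀ Z ∈ HH n, φ (fun j => Z.1 (w j), Z.2) = φ Z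
  bounded : ∀ K : Set (Fin n → ℂ), IsCompact K → ∃ C R : ℝ, ∀ Z ∈ HH n,
    Z.1 ∈ K → R ≤ Z.2.im → ‖φ Z‖ ≤ C

/-- The terms `(1|_{k,m} γ)(Z) = (c z_{n+1} + d)^{-k} exp(-2πi m c (z_1² + ⋯ + z_n²) /
(c z_{n+1} + d))`; for even `k` they do not depend on the representative `γ` of the coset. -/
def jacTerm {n : ℕ} (k : ℕ) (m : ℝ) (Z : Pt n) (q : Cosets n) : ℂ :=
  den q.out.2 Z ^ (-(k : ℤ)) *
    Complex.exp (2 * Real.pi * Complex.I * m * (-(q.out.2 1 0 : ℂ) * sq Z / den q.out.2 Z))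

/-- The Eisenstein series `E_{k,m}` of (even) weight `k` and index `m`. -/
def jacEis {n : ℕ} (k : ℕ) (m : ℝ) (Z : Pt n) : ℂ := ∑' q : Cosets n, jacTerm k m Z q

/-- `g_{2,m} = (4/3) π⁴ E_{4,m}`. -/
def g2 {n : ℕ} (m : ℝ) (Z : Pt n) : ℂ := 4 / 3 * (Real.pi : ℂ) ^ 4 * jacEis 4 m Z

/-- `g_{3,m} = (8/27) π⁶ E_{6,m}`. -/
def g3 {n : ℕ} (m : ℝ) (Z : Pt n) : ℂ := 8 / 27 * (Real.pi : ℂ) ^ 6 * jacEis 6 m Z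

/-- `Δ_m = g_{2,m}³ - 27 g_{3,3m/2}²`. -/
def disc {n : ℕ} (m : ℝ) (Z : Pt n) : ℂ := g2 m Z ^ 3 - 27 * g3 (3 / 2 * m) Z ^ 2

/-- `j_m = 1728 g_{2,m}³ / Δ_m`, meaningful where `Δ_m ≠ 0`. -/
def jm {n : ℕ} (m : ℝ) (Z : Pt n) : ℂ := 1728 * g2 m Z ^ 3 / disc m Z

end UnitaryForms

end

open UnitaryForms

noncomputable section
namespace UnitaryForms

/-! ### The action of the modular group -/

/-! Everything rests on the shape of L in the coordinates t, ρ, β. On functions of these alone it is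
ρ[(ρ+β)∂_t² + ρ∂_ρ² + β∂_β² + n(∂_β − ∂_ρ)] (`lap_comp_coords`). On functions of the invariants x, y
it closes up: with θ_x = x∂_x and θ_y = y∂_y it equals (θ_x+θ_y)² + (n+1)(θ_x+θ_y) + x⁻¹θ_x² +
y⁻¹(θ_y² + (n−1)θ_y) (`lap_xy`). Solving Lg = s(s−n−1)g by a series in x^{-a-m} y^{-b-k} gives the
recursion of Appell's F₃; functions of x alone or of x+y give ₂F₁ (`lap_x_add`).

The kernels are written as Euler-type integrals x^{-a} y^{-b} ∫₀¹ w(τ) f₁(−τ/x) f₂(−(1−τ)/y) dτ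
(`gaussF_eq`, `appellF3_eq`). The integral yields the continuation to the cut plane, smoothness and
a bound by x^{-Re a} y^{-Re b}, and it reduces the differential equation to a comparison of power
series coefficients (`betaTransform_pde`).

Write w = z_{n+1}, w' = z'_{n+1}, v' = Im w'. Then x(Z, γZ') = |Pw+Q|²/(4ρ(Z)v') with P = cw'+d and
Q = −(aw'+b). The size |P|²+|Q|² is at least a multiple of the sum of the squares of the entries of
γ, whose −σ-th powers are summable over SL(2,ℤ) for σ > 1 (`summable_entrySq_rpow`), and off the
orbit |Pw+Q|² is at least a multiple of that size. Dividing by the size turns the terms into c_γ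
Ψ(p_γ, Z) with c_γ summable and p_γ in a compact set, so the series may be differentiated twice term
by term (`tsum_pair_lap`). The nonholomorphic Eisenstein series are treated the same way with (c, d)
in place of (P, Q); ρ^λ β^μ is an eigenfunction because μ(μ+n−1) = 0. Growth is read off after a
translation into the strip |Re w| ≤ 1/2.

Series of inequivalent points differ because the kernel has a logarithmic singularity as x → 0 with
y fixed (`tendsto_norm_integral_atTop`), whereas the other series stays continuous there. Infinitude
of the everywhere regular forms comes from the multiples of E(Z;s,0), which is not identically zero.
For j_m the factors of automorphy form a cocycle, numerator and denominator carry the same one, and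
on z = 0 the function Δ_m is a constant times the classical discriminant (`exists_disc_ne_zero`). -/

lemma beta_nonneg {n : ℕ} (Z : Pt n) : 0 ≤ beta Z := Finset.sum_nonneg fun _ _ => by positivity

lemma mem_HH_iff {n : ℕ} {Z : Pt n} : Z ∈ HH n ↔ 0 < rho Z := by
  simp [HH, rho, beta]

lemma rho_pos {n : ℕ} {Z : Pt n} (hZ : Z ∈ HH n) : 0 < rho Z := mem_HH_iff.1 hZ

lemma im_eq {n : ℕ} (Z : Pt n) : Z.2.im = rho Z + beta Z := by simp [rho]

lemma im_pos {n : ℕ} {Z : Pt n} (hZ : Z ∈ HH n) : 0 < Z.2.im := by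
  have := rho_pos hZ; have := beta_nonneg Z; rw [im_eq]; linarith

lemma beta_pos {n : ℕ} {Z : Pt n} (hZ : Z.1 ≠ 0) : 0 < beta Z := by
  refine lt_of_le_of_ne (beta_nonneg Z) fun h => hZ ?_
  ext j
  have := (Finset.sum_eq_zero_iff_of_nonneg (fun j _ => by positivity)).1 h.symm j (Finset.mem_univ j)
  simpa using this

lemma ne_zero_of_beta_ne {n : ℕ} {Z : Pt n} (h : beta Z ≠ 0) : Z.1 ≠ 0 := by
  intro h0; apply h; simp [beta, h0]

lemma det_eq (A : SL(2, ℤ)) : A 0 0 * A 1 1 - A 0 1 * A 1 0 = 1 := by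
  have := A.det_coe; rwa [Matrix.det_fin_two] at this

lemma detC (A : SL(2, ℤ)) : (A 0 0 : ℂ) * A 1 1 - A 0 1 * A 1 0 = 1 := by
  exact_mod_cast det_eq A

lemma linear_ne_zero {c d : ℤ} (h : c ≠ 0 ∨ d ≠ 0) {w : ℂ} (hw : 0 < w.im) :
    (c : ℂ) * w + d ≠ 0 := by
  intro h0
  have him := congrArg Complex.im h0
  have hre := congrArg Complex.re h0
  simp at him hre
  rcases him with hc | hc
  · simp [hc] at hre; simp [hc, hre] at h
  · exact hw.ne' hc

lemma row_ne_zero (A : SL(2, ℤ)) : A 1 0 ≠ 0 ∨ A 1 1 ≠ 0 := by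
  by_contra! h
  have := det_eq A
  simp [h.1, h.2] at this

lemma den_ne_zero {n : ℕ} (A : SL(2, ℤ)) {Z : Pt n} (hZ : Z ∈ HH n) : den A Z ≠ 0 :=
  linear_ne_zero (row_ne_zero A) (im_pos hZ)

lemma mul_apply_row (A B : SL(2, ℤ)) (i j : Fin 2) :
    (A * B) i j = A i 0 * B 0 j + A i 1 * B 1 j := by
  simp [Matrix.SpecialLinearGroup.coe_mul, Matrix.mul_apply, Fin.sum_univ_two]

lemma act_sub {n : ℕ} (γ δ : GZ n) (h : γ.2 = δ.2) {Z Z' : Pt n} (hZ : Z ∈ HH n) (hZ' : Z' ∈ HH n) :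
    (act γ Z).2 - (act δ Z').2 = (Z.2 - Z'.2) / (den γ.2 Z * den γ.2 Z') := by
  have h1 := den_ne_zero γ.2 hZ
  have h2 := den_ne_zero γ.2 hZ'
  have := detC γ.2
  simp only [act, ← h]
  rw [div_sub_div _ _ h1 h2]
  congr 1
  simp only [den] at *
  linear_combination (Z.2 - Z'.2) * this

lemma act_im {n : ℕ} (γ : GZ n) {Z : Pt n} (hZ : Z ∈ HH n) :
    (act γ Z).2.im = Z.2.im / Complex.normSq (den γ.2 Z) := by
  have h1 := den_ne_zero γ.2 hZ
  have h2 : Complex.normSq (den γ.2 Z) ≠ 0 := by simpa using h1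
  have hd : (γ.2 0 0 : ℝ) * γ.2 1 1 - γ.2 0 1 * γ.2 1 0 = 1 := by exact_mod_cast det_eq γ.2
  simp only [act]
  rw [Complex.div_im]
  field_simp
  simp only [den, Complex.add_im, Complex.mul_im, Complex.add_re, Complex.mul_re, Complex.intCast_re,
    Complex.intCast_im]
  linear_combination Z.2.im * hd

lemma beta_act {n : ℕ} (γ : GZ n) (Z : Pt n) :
    beta (act γ Z) = beta Z / Complex.normSq (den γ.2 Z) := by
  simp only [beta, act, norm_div, div_pow, ← Complex.sq_norm]
  rw [← Finset.sum_div, Equiv.sum_comp γ.1⁻¹ (fun j => ‖Z.1 j‖ ^ 2)]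

lemma rho_act {n : ℕ} (γ : GZ n) {Z : Pt n} (hZ : Z ∈ HH n) :
    rho (act γ Z) = rho Z / Complex.normSq (den γ.2 Z) := by
  rw [rho, act_im γ hZ, beta_act, rho, sub_div]

lemma normSq_den_pos {n : ℕ} (A : SL(2, ℤ)) {Z : Pt n} (hZ : Z ∈ HH n) :
    0 < Complex.normSq (den A Z) := Complex.normSq_pos.2 (den_ne_zero A hZ)

lemma act_mem_HH {n : ℕ} (γ : GZ n) {Z : Pt n} (hZ : Z ∈ HH n) : act γ Z ∈ HH n := by
  rw [mem_HH_iff, rho_act γ hZ]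
  exact div_pos (rho_pos hZ) (normSq_den_pos _ hZ)

lemma den_mul {n : ℕ} (A B : SL(2, ℤ)) (σ : Equiv.Perm (Fin n)) {Z : Pt n} (hZ : Z ∈ HH n) :
    den (A * B) Z = den A (act (σ, B) Z) * den B Z := by
  have h1 := den_ne_zero B hZ
  have : den A (act (σ, B) Z) = (A 1 0 : ℂ) * ((B 0 0 * Z.2 + B 0 1) / den B Z) + A 1 1 := rfl
  rw [this, add_mul, mul_assoc, div_mul_cancel₀ _ h1]
  simp only [den, mul_apply_row]
  push_cast
  ring

lemma act_mul {n : ℕ} (γ δ : GZ n) {Z : Pt n} (hZ : Z ∈ HH n) :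
    act (γ * δ) Z = act γ (act δ Z) := by
  have h1 := den_ne_zero δ.2 hZ
  have h2 := den_ne_zero γ.2 (act_mem_HH δ hZ)
  have h3 := den_mul γ.2 δ.2 δ.1 hZ
  have h3' : den (γ * δ).2 Z = den γ.2 (act δ Z) * den δ.2 Z := h3
  refine Prod.ext ?_ ?_
  · funext j
    change Z.1 ((γ * δ).1⁻¹ j) / den (γ * δ).2 Z = Z.1 (δ.1⁻¹ (γ.1⁻¹ j)) / den δ.2 Z / den γ.2 (act δ Z)
    rw [h3']
    have : (γ * δ).1⁻¹ j = δ.1⁻¹ (γ.1⁻¹ j) := by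
      rw [Prod.fst_mul, mul_inv_rev]; rfl
    rw [this]
    field_simp
  · change (((γ.2 * δ.2) 0 0 : ℤ) * Z.2 + ((γ.2 * δ.2) 0 1 : ℤ)) / den (γ * δ).2 Z =
      (γ.2 0 0 * (act δ Z).2 + γ.2 0 1) / den γ.2 (act δ Z)
    rw [h3', div_eq_div_iff (mul_ne_zero h2 h1) h2]
    have : (act δ Z).2 * den δ.2 Z = δ.2 0 0 * Z.2 + δ.2 0 1 := by
      simp only [act]; field_simp
    simp only [mul_apply_row]
    push_cast
    have h4 : den δ.2 Z = δ.2 1 0 * Z.2 + δ.2 1 1 := rfl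
    linear_combination (-(γ.2 0 0 : ℂ) * den γ.2 (act δ Z)) * this
      - (γ.2 0 1 : ℂ) * den γ.2 (act δ Z) * h4

lemma act_one {n : ℕ} (Z : Pt n) : act (1 : GZ n) Z = Z := by
  refine Prod.ext ?_ ?_
  · funext j; simp [act, den]
  · simp [act, den]

lemma act_inv_act {n : ℕ} (γ : GZ n) {Z : Pt n} (hZ : Z ∈ HH n) : act γ⁻¹ (act γ Z) = Z := by
  rw [← act_mul _ _ hZ, inv_mul_cancel, act_one]

/-- Since ρ+β = Im z_{n+1}, the numerator is a squared Euclidean distance in the upper half plane.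
Under γ it acquires the factor |cw+d|^{-2}|cw'+d|^{-2}, which is exactly what ρ(Z) and Im w'
contribute in the denominator. -/
lemma xinv_eq {n : ℕ} (Z Z' : Pt n) :
    xinv Z Z' = Complex.normSq (Z.2 - Z'.2) / (4 * rho Z * Z'.2.im) := by
  rw [xinv, Complex.normSq_apply, im_eq Z']
  congr 1
  simp only [Complex.sub_re, Complex.sub_im, tt, im_eq]
  ring

lemma xinv_act {n : ℕ} (γ : GZ n) {Z Z' : Pt n} (hZ : Z ∈ HH n) (hZ' : Z' ∈ HH n) :
    xinv (act γ Z) (act γ Z') = xinv Z Z' := by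
  have h1 := (normSq_den_pos γ.2 hZ).ne'
  have h2 := (normSq_den_pos γ.2 hZ').ne'
  have h3 := (rho_pos hZ).ne'
  have h4 := (im_pos hZ').ne'
  rw [xinv_eq, xinv_eq, act_sub γ γ rfl hZ hZ', rho_act γ hZ, act_im γ hZ']
  simp only [Complex.normSq_div, Complex.normSq_mul]
  field_simp

lemma yinv_act {n : ℕ} (γ : GZ n) {Z : Pt n} (hZ : Z ∈ HH n) : yinv (act γ Z) = yinv Z := by
  have h1 := (normSq_den_pos γ.2 hZ).ne'
  have h3 := (rho_pos hZ).ne'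
  rw [yinv, yinv, beta_act, rho_act γ hZ]
  field_simp

lemma act_fst_ne_zero {n : ℕ} (γ : GZ n) {Z : Pt n} (hZ : Z ∈ HH n) (h : Z.1 ≠ 0) :
    (act γ Z).1 ≠ 0 := by
  apply ne_zero_of_beta_ne
  rw [beta_act]
  exact (div_pos (beta_pos h) (normSq_den_pos _ hZ)).ne'

lemma act_snd_congr {n : ℕ} (γ : GZ n) {Z Z' : Pt n} (h : Z.2 = Z'.2) :
    (act γ Z).2 = (act γ Z').2 := by simp [act, den, h]

lemma sameOrbit_act {n : ℕ} (γ : GZ n) {Z Z' : Pt n} (hZ : Z ∈ HH n) (hZ' : Z' ∈ HH n) :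
    SameOrbit (act γ Z) Z' ↔ SameOrbit Z Z' := by
  constructor
  · rintro ⟨δ, hδ⟩
    refine ⟨γ⁻¹ * δ, ?_⟩
    rw [act_mul _ _ hZ', ← act_snd_congr γ⁻¹ hδ, act_inv_act γ hZ]
  · rintro ⟨δ, hδ⟩
    exact ⟨γ * δ, by rw [act_mul _ _ hZ']; exact act_snd_congr γ hδ⟩

end UnitaryForms
end

noncomputable section
namespace UnitaryForms

open MeasureTheory Set

/-! ### Beta-type integral transforms on the cut plane -/

lemma isOpen_cutPlane : IsOpen cutPlane :=
  Complex.isOpen_slitPlane.preimage (continuous_const.sub continuous_id)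

/-- The point 1 − τz is a convex combination of 1 and 1 − z, and the slit plane is star-shaped about
1. This is why integrals over τ ∈ [0,1] define functions on the whole cut plane. -/
lemma smul_mem_cutPlane {z : ℂ} (hz : z ∈ cutPlane) {τ : ℝ} (h0 : 0 ≤ τ) (h1 : τ ≤ 1) :
    (τ : ℂ) * z ∈ cutPlane := by
  have := Complex.starConvex_one_slitPlane (show 1 - z ∈ Complex.slitPlane from hz)
    (sub_nonneg.2 h1) h0 (by ring)
  change 1 - (τ : ℂ) * z ∈ Complex.slitPlane
  convert this using 1
  simp only [Complex.real_smul]; push_cast; ring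

lemma mem_cutPlane_of_norm_lt_one {z : ℂ} (hz : ‖z‖ < 1) : z ∈ cutPlane := by
  have := Complex.mem_slitPlane_of_norm_lt_one (z := -z) (by simpa using hz)
  simpa [cutPlane, sub_eq_add_neg] using this

lemma neg_inv_mem_cutPlane {x : ℂ} (hx : 0 < x.re) : -x⁻¹ ∈ cutPlane := by
  refine Or.inl ?_
  have : 0 < (x⁻¹).re := by
    rw [Complex.inv_re]
    exact div_pos hx (Complex.normSq_pos.2 fun h => by simp [h] at hx)
  simp only [sub_neg_eq_add, Complex.add_re, Complex.one_re]
  linarith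

lemma one_sub_smul_mem {z : ℂ} (hz : z ∈ cutPlane) {τ : ℝ} (hτ : τ ∈ Ioc (0 : ℝ) 1) :
    (1 - τ : ℂ) * z ∈ cutPlane := by
  have := smul_mem_cutPlane hz (τ := 1 - τ) (by linarith [hτ.2]) (by linarith [hτ.1])
  simpa using this

/-- `∫₀¹ w(τ) f₁(τ X) f₂((1 - τ) Y) dτ`. -/
def betaTransform (w : ℝ → ℂ) (f₁ f₂ : ℂ → ℂ) (p : ℂ × ℂ) : ℂ :=
  ∫ τ in Ioc (0 : ℝ) 1, w τ * (f₁ (τ * p.1) * f₂ ((1 - τ) * p.2))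

lemma continuousOn_left {f : ℂ → ℂ} (hf : ContinuousOn f cutPlane) {z : ℂ} (hz : z ∈ cutPlane) :
    ContinuousOn (fun τ : ℝ => f (τ * z)) (Icc 0 1) :=
  hf.comp (by fun_prop) fun _ hτ => smul_mem_cutPlane hz hτ.1 hτ.2

lemma continuousOn_right {f : ℂ → ℂ} (hf : ContinuousOn f cutPlane) {z : ℂ} (hz : z ∈ cutPlane) :
    ContinuousOn (fun τ : ℝ => f ((1 - τ) * z)) (Icc 0 1) :=
  hf.comp (by fun_prop) fun τ hτ => by
    have := smul_mem_cutPlane hz (τ := 1 - τ) (by linarith [hτ.2]) (by linarith [hτ.1])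
    simpa using this

lemma integrable_mul_continuousOn {w : ℝ → ℂ} (hw : IntegrableOn w (Ioc 0 1)) {g : ℝ → ℂ}
    (hg : ContinuousOn g (Icc 0 1)) : IntegrableOn (fun τ => w τ * g τ) (Ioc 0 1) := by
  obtain ⟨C, hC⟩ := isCompact_Icc.exists_bound_of_continuousOn hg
  have hm : AEStronglyMeasurable g (volume.restrict (Ioc 0 1)) :=
    (hg.mono Ioc_subset_Icc_self).aestronglyMeasurable measurableSet_Ioc
  refine Integrable.mul_bdd (c := C) hw hm ?_
  filter_upwards [ae_restrict_mem measurableSet_Ioc] with τ hτ using hC τ (Ioc_subset_Icc_self hτ)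

lemma integrable_betaTransform {w : ℝ → ℂ} (hw : IntegrableOn w (Ioc 0 1)) {f₁ f₂ : ℂ → ℂ}
    (h₁ : ContinuousOn f₁ cutPlane) (h₂ : ContinuousOn f₂ cutPlane) {p : ℂ × ℂ}
    (hp : p ∈ cutPlane ×ˢ cutPlane) :
    IntegrableOn (fun τ : ℝ => w τ * (f₁ (τ * p.1) * f₂ ((1 - τ) * p.2))) (Ioc 0 1) :=
  integrable_mul_continuousOn hw ((continuousOn_left h₁ hp.1).mul (continuousOn_right h₂ hp.2))

lemma deriv_differentiableOn {f : ℂ → ℂ} (hf : DifferentiableOn ℂ f cutPlane) :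
    DifferentiableOn ℂ (deriv f) cutPlane := hf.deriv isOpen_cutPlane

lemma integral_smul_add_smul {g₁ g₂ : ℝ → ℂ} (I₁ : IntegrableOn g₁ (Ioc 0 1))
    (I₂ : IntegrableOn g₂ (Ioc 0 1)) (A B : (ℂ × ℂ) →L[ℂ] ℂ) :
    ∫ τ in Ioc (0 : ℝ) 1, (g₁ τ • A + g₂ τ • B) =
      (∫ τ in Ioc (0 : ℝ) 1, g₁ τ) • A + (∫ τ in Ioc (0 : ℝ) 1, g₂ τ) • B := by
  rw [integral_add, integral_smul_const, integral_smul_const]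
  · exact Integrable.smul_const I₁ A
  · exact Integrable.smul_const I₂ B

lemma aestronglyMeasurable_smul_add_smul {g₁ g₂ : ℝ → ℂ} (I₁ : IntegrableOn g₁ (Ioc 0 1))
    (I₂ : IntegrableOn g₂ (Ioc 0 1)) (A B : (ℂ × ℂ) →L[ℂ] ℂ) :
    AEStronglyMeasurable (fun τ => (g₁ τ • A + g₂ τ • B)) (volume.restrict (Ioc (0 : ℝ) 1)) :=
  (I₁.aestronglyMeasurable.smul_const A).add (I₂.aestronglyMeasurable.smul_const B)

/-- Over [0,1] times a small closed ball the arguments τX and (1−τ)Y stay in the cut plane, so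
compactness bounds the differentiated integrand by a constant times |w(τ)|. Both partial derivatives
are again Beta transforms, with weights τw and (1−τ)w, which lets smoothness be proved by induction.
-/
lemma hasFDerivAt_betaTransform {w : ℝ → ℂ} (hw : IntegrableOn w (Ioc 0 1)) {f₁ f₂ : ℂ → ℂ}
    (h₁ : DifferentiableOn ℂ f₁ cutPlane) (h₂ : DifferentiableOn ℂ f₂ cutPlane) {p : ℂ × ℂ}
    (hp : p ∈ cutPlane ×ˢ cutPlane) :
    HasFDerivAt (betaTransform w f₁ f₂)
      (betaTransform (fun τ => w τ * τ) (deriv f₁) f₂ p • ContinuousLinearMap.fst ℂ ℂ ℂ +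
        betaTransform (fun τ => w τ * (1 - τ)) f₁ (deriv f₂) p • ContinuousLinearMap.snd ℂ ℂ ℂ) p := by
  have d₁ := deriv_differentiableOn h₁
  have d₂ := deriv_differentiableOn h₂
  obtain ⟨ε, ε0, hε⟩ := Metric.nhds_basis_closedBall.mem_iff.1
    ((isOpen_cutPlane.prod isOpen_cutPlane).mem_nhds hp)
  have hK : IsCompact (Icc (0 : ℝ) 1 ×ˢ Metric.closedBall p ε) :=
    isCompact_Icc.prod (isCompact_closedBall p ε)
  have m₁ : ∀ q ∈ Icc (0 : ℝ) 1 ×ˢ Metric.closedBall p ε, (q.1 : ℂ) * q.2.1 ∈ cutPlane :=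
    fun q hq => smul_mem_cutPlane (hε hq.2).1 hq.1.1 hq.1.2
  have m₂ : ∀ q ∈ Icc (0 : ℝ) 1 ×ˢ Metric.closedBall p ε, (1 - q.1 : ℂ) * q.2.2 ∈ cutPlane := by
    intro q hq
    have := smul_mem_cutPlane (hε hq.2).2 (τ := 1 - q.1) (by linarith [hq.1.2]) (by linarith [hq.1.1])
    simpa using this
  have c₁ : ∀ {f : ℂ → ℂ}, DifferentiableOn ℂ f cutPlane →
      ContinuousOn (fun q : ℝ × ℂ × ℂ => f ((q.1 : ℂ) * q.2.1)) (Icc (0 : ℝ) 1 ×ˢ Metric.closedBall p ε) :=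
    fun hf => hf.continuousOn.comp (by fun_prop) m₁
  have c₂ : ∀ {f : ℂ → ℂ}, DifferentiableOn ℂ f cutPlane →
      ContinuousOn (fun q : ℝ × ℂ × ℂ => f ((1 - q.1 : ℂ) * q.2.2)) (Icc (0 : ℝ) 1 ×ˢ Metric.closedBall p ε) :=
    fun hf => hf.continuousOn.comp (by fun_prop) m₂
  have cC : ContinuousOn (fun q : ℝ × ℂ × ℂ => deriv f₁ ((q.1 : ℂ) * q.2.1) *
      f₂ ((1 - q.1 : ℂ) * q.2.2)) (Icc (0 : ℝ) 1 ×ˢ Metric.closedBall p ε) := (c₁ d₁).mul (c₂ h₂)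
  have cD : ContinuousOn (fun q : ℝ × ℂ × ℂ => f₁ ((q.1 : ℂ) * q.2.1) *
      deriv f₂ ((1 - q.1 : ℂ) * q.2.2)) (Icc (0 : ℝ) 1 ×ˢ Metric.closedBall p ε) := (c₁ h₁).mul (c₂ d₂)
  obtain ⟨C, hC⟩ := hK.exists_bound_of_continuousOn cC
  obtain ⟨D, hD⟩ := hK.exists_bound_of_continuousOn cD
  have wτ : IntegrableOn (fun τ : ℝ => w τ * (τ : ℂ)) (Ioc 0 1) :=
    integrable_mul_continuousOn hw (by fun_prop)
  have wτ' : IntegrableOn (fun τ : ℝ => w τ * (1 - τ : ℂ)) (Ioc 0 1) :=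
    integrable_mul_continuousOn hw (by fun_prop)
  have I₁ := integrable_betaTransform wτ d₁.continuousOn h₂.continuousOn hp
  have I₂ := integrable_betaTransform wτ' h₁.continuousOn d₂.continuousOn hp
  set F' : ℂ × ℂ → ℝ → (ℂ × ℂ) →L[ℂ] ℂ := fun q τ =>
    (w τ * τ * (deriv f₁ (τ * q.1) * f₂ ((1 - τ) * q.2))) • ContinuousLinearMap.fst ℂ ℂ ℂ +
      (w τ * (1 - τ) * (f₁ (τ * q.1) * deriv f₂ ((1 - τ) * q.2))) • ContinuousLinearMap.snd ℂ ℂ ℂ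
    with hF'
  have key := hasFDerivAt_integral_of_dominated_of_fderiv_le (𝕜 := ℂ)
    (μ := volume.restrict (Ioc (0 : ℝ) 1))
    (F := fun q τ => w τ * (f₁ (τ * q.1) * f₂ ((1 - τ) * q.2))) (F' := F') (x₀ := p)
    (bound := fun τ => ‖w τ‖ * (C + D)) (Metric.ball_mem_nhds p ε0) ?_
    (integrable_betaTransform hw h₁.continuousOn h₂.continuousOn hp) ?_ ?_ (hw.norm.mul_const _) ?_
  · rw [integral_smul_add_smul I₁ I₂] at key
    exact key
  · filter_upwards [Metric.ball_mem_nhds p ε0] with q hq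
    exact (integrable_betaTransform hw h₁.continuousOn h₂.continuousOn
      (hε (Metric.ball_subset_closedBall hq))).aestronglyMeasurable
  · exact aestronglyMeasurable_smul_add_smul I₁ I₂ _ _
  · filter_upwards [ae_restrict_mem measurableSet_Ioc] with τ hτ q hq
    have hq' : (τ, q) ∈ Icc (0 : ℝ) 1 ×ˢ Metric.closedBall p ε :=
      ⟨Ioc_subset_Icc_self hτ, Metric.ball_subset_closedBall hq⟩
    have e₁ : ‖deriv f₁ (τ * q.1) * f₂ ((1 - τ) * q.2)‖ ≤ C := hC (τ, q) hq'
    have e₂ : ‖f₁ (τ * q.1) * deriv f₂ ((1 - τ) * q.2)‖ ≤ D := hD (τ, q) hq'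
    have t₁ : ‖(τ : ℂ)‖ ≤ 1 := by
      rw [Complex.norm_real, Real.norm_of_nonneg hτ.1.le]; exact hτ.2
    have t₂ : ‖(1 - τ : ℂ)‖ ≤ 1 := by
      rw [← Complex.ofReal_one, ← Complex.ofReal_sub, Complex.norm_real,
        Real.norm_of_nonneg (by linarith [hτ.2])]
      linarith [hτ.1]
    have C0 : 0 ≤ C := (norm_nonneg _).trans e₁
    have D0 : 0 ≤ D := (norm_nonneg _).trans e₂
    rw [hF', mul_add]
    refine (norm_add_le _ _).trans (add_le_add ?_ ?_)
    · rw [norm_smul]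
      calc _ ≤ ‖w τ * τ * (deriv f₁ (τ * q.1) * f₂ ((1 - τ) * q.2))‖ * 1 := by
            gcongr; exact ContinuousLinearMap.norm_fst_le ℂ ℂ ℂ
        _ ≤ ‖w τ‖ * 1 * C := by rw [mul_one, norm_mul, norm_mul]; gcongr
        _ = _ := by ring
    · rw [norm_smul]
      calc _ ≤ ‖w τ * (1 - τ) * (f₁ (τ * q.1) * deriv f₂ ((1 - τ) * q.2))‖ * 1 := by
            gcongr; exact ContinuousLinearMap.norm_snd_le ℂ ℂ ℂ
        _ ≤ ‖w τ‖ * 1 * D := by rw [mul_one, norm_mul, norm_mul]; gcongr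
        _ = _ := by ring
  · filter_upwards [ae_restrict_mem measurableSet_Ioc] with τ hτ q hq
    have hq' := hε (Metric.ball_subset_closedBall hq)
    have g₁ := (h₁.differentiableAt (isOpen_cutPlane.mem_nhds
      (smul_mem_cutPlane hq'.1 hτ.1.le hτ.2))).hasDerivAt
    have g₂ := (h₂.differentiableAt (isOpen_cutPlane.mem_nhds (one_sub_smul_mem hq'.2 hτ))).hasDerivAt
    have k₁ := g₁.comp_hasFDerivAt q ((ContinuousLinearMap.fst ℂ ℂ ℂ).hasFDerivAt.const_mul (τ : ℂ))
    have k₂ := g₂.comp_hasFDerivAt q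
      ((ContinuousLinearMap.snd ℂ ℂ ℂ).hasFDerivAt.const_mul (1 - τ : ℂ))
    refine ((k₁.mul k₂).const_mul (w τ)).congr_fderiv ?_
    ext <;> simp [hF'] <;> ring

lemma differentiableOn_betaTransform {w : ℝ → ℂ} (hw : IntegrableOn w (Ioc 0 1)) {f₁ f₂ : ℂ → ℂ}
    (h₁ : DifferentiableOn ℂ f₁ cutPlane) (h₂ : DifferentiableOn ℂ f₂ cutPlane) :
    DifferentiableOn ℂ (betaTransform w f₁ f₂) (cutPlane ×ˢ cutPlane) := fun _ hp =>
  (hasFDerivAt_betaTransform hw h₁ h₂ hp).differentiableAt.differentiableWithinAt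

lemma contDiffOn_betaTransform (k : ℕ) {w : ℝ → ℂ} (hw : IntegrableOn w (Ioc 0 1)) {f₁ f₂ : ℂ → ℂ}
    (h₁ : DifferentiableOn ℂ f₁ cutPlane) (h₂ : DifferentiableOn ℂ f₂ cutPlane) :
    ContDiffOn ℂ k (betaTransform w f₁ f₂) (cutPlane ×ˢ cutPlane) := by
  induction k generalizing w f₁ f₂ with
  | zero => exact contDiffOn_zero.2 (differentiableOn_betaTransform hw h₁ h₂).continuousOn
  | succ k ih =>
    have ho := isOpen_cutPlane.prod isOpen_cutPlane
    push_cast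
    rw [contDiffOn_succ_iff_fderiv_of_isOpen ho]
    refine ⟨differentiableOn_betaTransform hw h₁ h₂, by simp, ?_⟩
    have wτ : IntegrableOn (fun τ : ℝ => w τ * (τ : ℂ)) (Ioc 0 1) :=
      integrable_mul_continuousOn hw (by fun_prop)
    have wτ' : IntegrableOn (fun τ : ℝ => w τ * (1 - τ : ℂ)) (Ioc 0 1) :=
      integrable_mul_continuousOn hw (by fun_prop)
    refine ContDiffOn.congr (((ih wτ (deriv_differentiableOn h₁) h₂).smul contDiffOn_const).add
      ((ih wτ' h₁ (deriv_differentiableOn h₂)).smul contDiffOn_const)) fun p hp =>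
      (hasFDerivAt_betaTransform hw h₁ h₂ hp).fderiv

/-! ### Power series of Beta transforms and the identity theorem -/

/-- The power series with coefficients `A` represents `f` in the unit disc. -/
def HasCoeffs (f : ℂ → ℂ) (A : ℕ → ℂ) : Prop := ∀ z : ℂ, ‖z‖ < 1 → HasSum (fun m => A m * z ^ m) (f z)

lemma hasSum_of_eq {ι E : Type*} [AddCommMonoid E] [TopologicalSpace E] {f g : ι → E} {a b : E}
    (h : HasSum f a) (hfg : ∀ i, g i = f i) (hab : b = a) : HasSum g b := by
  rw [hab, funext hfg]; exact h

lemma HasCoeffs.mul_deriv {f : ℂ → ℂ} {A : ℕ → ℂ} (h : HasCoeffs f A) :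
    HasCoeffs (fun z => z * deriv f z) (fun m => m * A m) := by
  intro z hz
  -- Absolute convergence at a radius r strictly between |z| and 1 dominates all terms on the disc
  -- of radius r and allows termwise differentiation.
  obtain ⟨r, hzr, hr⟩ := exists_between hz
  have r0 : 0 < r := (norm_nonneg z).trans_lt hzr
  have hs := (h (r : ℂ) (by rwa [Complex.norm_real, Real.norm_of_nonneg r0.le])).summable.norm
  have key := Complex.hasSum_deriv_of_summable_norm (F := fun m z => A m * z ^ m)
    (U := Metric.ball 0 r) hs (fun m => by fun_prop) Metric.isOpen_ball
    (fun m y hy => by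
      rw [norm_mul, norm_mul, norm_pow, norm_pow, Complex.norm_real, Real.norm_of_nonneg r0.le]
      gcongr
      simpa using (mem_ball_zero_iff.1 hy).le) (mem_ball_zero_iff.2 hzr)
  have e : deriv (fun y => ∑' m, A m * y ^ m) z = deriv f z := by
    refine Filter.EventuallyEq.deriv_eq ?_
    filter_upwards [Metric.isOpen_ball.mem_nhds (mem_ball_zero_iff.2 hz : z ∈ Metric.ball 0 1)]
      with y hy using (h y (mem_ball_zero_iff.1 hy)).tsum_eq
  rw [e] at key
  refine hasSum_of_eq (key.mul_left z) (fun m => ?_) rfl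
  rw [deriv_const_mul _ (by fun_prop), deriv_pow_field]
  rcases m with _ | m
  · simp
  · simp; ring

/-- The first order operator `a + z d/dz`. -/
def euler (a : ℂ) (f : ℂ → ℂ) (z : ℂ) : ℂ := a * f z + z * deriv f z

lemma HasCoeffs.euler {f : ℂ → ℂ} {A : ℕ → ℂ} (h : HasCoeffs f A) (a : ℂ) :
    HasCoeffs (euler a f) (fun m => (a + m) * A m) := by
  intro z hz
  refine hasSum_of_eq (((h z hz).mul_left a).add (h.mul_deriv z hz)) (fun m => ?_) rfl
  ring

lemma differentiableOn_euler {f : ℂ → ℂ} (hf : DifferentiableOn ℂ f cutPlane) (a : ℂ) :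
    DifferentiableOn ℂ (euler a f) cutPlane :=
  (hf.const_mul a).add (differentiableOn_id.mul (deriv_differentiableOn hf))

/-- The two series are multiplied under the integral. As |τ| and |1−τ| are at most 1, each term is
bounded by |A_m X^m| |B_k Y^k| |w(τ)|, so summation and integration may be exchanged. -/
lemma hasSum_betaTransform {w : ℝ → ℂ} (hw : IntegrableOn w (Ioc 0 1)) {f₁ f₂ : ℂ → ℂ}
    {A B : ℕ → ℂ} (h₁ : HasCoeffs f₁ A) (h₂ : HasCoeffs f₂ B) {p : ℂ × ℂ}
    (hX : ‖p.1‖ < 1) (hY : ‖p.2‖ < 1) :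
    HasSum (fun mk : ℕ × ℕ => A mk.1 * B mk.2 *
      (∫ τ in Ioc (0 : ℝ) 1, w τ * ((τ : ℂ) ^ mk.1 * (1 - τ : ℂ) ^ mk.2)) * (p.1 ^ mk.1 * p.2 ^ mk.2))
      (betaTransform w f₁ f₂ p) := by
  have sX := (h₁ _ hX).summable.norm
  have sY := (h₂ _ hY).summable.norm
  set F : ℕ × ℕ → ℝ → ℂ := fun mk τ => (A mk.1 * B mk.2 * (p.1 ^ mk.1 * p.2 ^ mk.2)) *
    (w τ * ((τ : ℂ) ^ mk.1 * (1 - τ : ℂ) ^ mk.2)) with hF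
  have hFi : ∀ mk, IntegrableOn (F mk) (Ioc 0 1) := fun mk =>
    (integrable_mul_continuousOn hw (by fun_prop)).const_mul _
  have hb : ∀ mk, ∀ τ ∈ Ioc (0 : ℝ) 1,
      ‖F mk τ‖ ≤ ‖A mk.1 * p.1 ^ mk.1‖ * ‖B mk.2 * p.2 ^ mk.2‖ * ‖w τ‖ := by
    intro mk τ hτ
    have t₁ : ‖(τ : ℂ)‖ ≤ 1 := by
      rw [Complex.norm_real, Real.norm_of_nonneg hτ.1.le]; exact hτ.2
    have t₂ : ‖(1 - τ : ℂ)‖ ≤ 1 := by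
      rw [← Complex.ofReal_one, ← Complex.ofReal_sub, Complex.norm_real,
        Real.norm_of_nonneg (by linarith [hτ.2])]
      linarith [hτ.1]
    have : ‖(τ : ℂ) ^ mk.1 * (1 - τ : ℂ) ^ mk.2‖ ≤ 1 := by
      rw [norm_mul, norm_pow, norm_pow]
      exact mul_le_one₀ (pow_le_one₀ (norm_nonneg _) t₁) (by positivity) (pow_le_one₀ (norm_nonneg _) t₂)
    calc ‖F mk τ‖ = ‖A mk.1 * p.1 ^ mk.1‖ * ‖B mk.2 * p.2 ^ mk.2‖ * ‖w τ‖ *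
          ‖(τ : ℂ) ^ mk.1 * (1 - τ : ℂ) ^ mk.2‖ := by
          simp only [hF, norm_mul]; ring
      _ ≤ _ := mul_le_of_le_one_right (by positivity) this
  have key := hasSum_integral_of_summable_integral_norm (μ := volume.restrict (Ioc (0 : ℝ) 1)) hFi ?_
  · refine hasSum_of_eq key (fun mk => ?_) ?_
    · rw [hF, integral_const_mul]
      ring
    · refine setIntegral_congr_fun measurableSet_Ioc fun τ hτ => ?_
      have t₁ : ‖(τ : ℂ) * p.1‖ < 1 := by
        rw [norm_mul, Complex.norm_real, Real.norm_of_nonneg hτ.1.le]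
        nlinarith [norm_nonneg p.1, hτ.2]
      have t₂ : ‖(1 - τ : ℂ) * p.2‖ < 1 := by
        rw [norm_mul, ← Complex.ofReal_one, ← Complex.ofReal_sub, Complex.norm_real,
          Real.norm_of_nonneg (by linarith [hτ.2])]
        nlinarith [norm_nonneg p.2, hτ.1, hτ.2]
      have q₁ := h₁ _ t₁
      have q₂ := h₂ _ t₂
      have := tsum_mul_tsum_of_summable_norm q₁.summable.norm q₂.summable.norm
      rw [q₁.tsum_eq, q₂.tsum_eq] at this
      simp only [this, ← tsum_mul_left]
      refine tsum_congr fun mk => ?_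
      simp only [hF, mul_pow]
      ring
  · refine Summable.of_nonneg_of_le (fun _ => integral_nonneg fun _ => norm_nonneg _) (fun mk => ?_)
      ((sX.mul_of_nonneg sY (fun _ => norm_nonneg _) (fun _ => norm_nonneg _)).mul_right
        (∫ τ in Ioc (0 : ℝ) 1, ‖w τ‖))
    rw [← integral_const_mul]
    exact setIntegral_mono_on (hFi mk).norm (hw.norm.const_mul _) measurableSet_Ioc (hb mk)

/-- A two-variable identity theorem by slicing: on the complex line ζ ↦ ζp the admissible ζ form an
open set that is star-shaped about 0 and contains 1, and near ζ = 0 the line lies in the polydisc.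
The one-variable theorem then reaches ζ = 1. -/
lemma eqOn_zero_of_eqOn_polydisc {F : ℂ × ℂ → ℂ}
    (hF : DifferentiableOn ℂ F (cutPlane ×ˢ cutPlane))
    (h0 : ∀ p : ℂ × ℂ, ‖p.1‖ < 1 → ‖p.2‖ < 1 → F p = 0) {p : ℂ × ℂ}
    (hp : p ∈ cutPlane ×ˢ cutPlane) : F p = 0 := by
  set U : Set ℂ := {ζ | ζ * p.1 ∈ cutPlane ∧ ζ * p.2 ∈ cutPlane} with hU
  have hUo : IsOpen U :=
    (isOpen_cutPlane.preimage (by fun_prop : Continuous fun ζ : ℂ => ζ * p.1)).inter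
      (isOpen_cutPlane.preimage (by fun_prop : Continuous fun ζ : ℂ => ζ * p.2))
  have z0 : (0 : ℂ) ∈ cutPlane := mem_cutPlane_of_norm_lt_one (by simp)
  have hUs : StarConvex ℝ 0 U := by
    rw [starConvex_zero_iff]
    intro ζ hζ t t0 t1
    simp only [hU, mem_ofPred_eq, Complex.real_smul, mul_assoc]
    exact ⟨smul_mem_cutPlane hζ.1 t0 t1, smul_mem_cutPlane hζ.2 t0 t1⟩
  have U0 : (0 : ℂ) ∈ U := by simp [hU, z0]
  have hd : DifferentiableOn ℂ (fun ζ : ℂ => F (ζ * p.1, ζ * p.2)) U :=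
    hF.comp (by fun_prop) fun ζ hζ => ⟨hζ.1, hζ.2⟩
  have := (hd.analyticOnNhd hUo).eqOn_zero_of_preconnected_of_eventuallyEq_zero
    (hUs.isPathConnected U0).isConnected.isPreconnected U0 ?_
  · simpa using this (show (1 : ℂ) ∈ U by simpa [hU] using hp)
  · have c : Continuous fun ζ : ℂ => (ζ * p.1, ζ * p.2) := by fun_prop
    have : ∀ᶠ q : ℂ × ℂ in nhds ((0 : ℂ) * p.1, (0 : ℂ) * p.2), ‖q.1‖ < 1 ∧ ‖q.2‖ < 1 := by
      have o : IsOpen {q : ℂ × ℂ | ‖q.1‖ < 1 ∧ ‖q.2‖ < 1} :=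
        (isOpen_lt (f := fun q : ℂ × ℂ => ‖q.1‖) (g := fun _ => 1) (by fun_prop) (by fun_prop)).inter
          (isOpen_lt (f := fun q : ℂ × ℂ => ‖q.2‖) (g := fun _ => 1) (by fun_prop) (by fun_prop))
      exact o.mem_nhds (by simp)
    filter_upwards [c.continuousAt.eventually this] with ζ hζ using h0 _ hζ.1 hζ.2

end UnitaryForms
end

noncomputable section
namespace UnitaryForms

open MeasureTheory Set

/-! ### Hypergeometric functions on the cut plane -/

lemma poch_zero (a : ℂ) : poch a 0 = 1 := by simp [poch]

lemma poch_succ (a : ℂ) (m : ℕ) : poch a (m + 1) = poch a m * (a + m) := by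
  simp [poch, ascPochhammer_succ_eval]

lemma add_natCast_ne_zero {a : ℂ} (ha : 0 < a.re) (m : ℕ) : a + m ≠ 0 := by
  intro h
  have := congrArg Complex.re h
  simp at this
  have hm : (0 : ℝ) ≤ m := Nat.cast_nonneg m
  linarith

lemma poch_ne_zero {a : ℂ} (ha : 0 < a.re) (m : ℕ) : poch a m ≠ 0 := by
  induction m with
  | zero => simp [poch_zero]
  | succ m ih => rw [poch_succ]; exact mul_ne_zero ih (add_natCast_ne_zero ha m)

lemma Gamma_add_nat {a : ℂ} (ha : 0 < a.re) (m : ℕ) :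
    Complex.Gamma (a + m) = poch a m * Complex.Gamma a := by
  rw [poch, ← Complex.Gamma_add_nat_div_Gamma_eq a fun k h => add_natCast_ne_zero ha k (by rw [h]; ring),
    div_mul_cancel₀ _ (Complex.Gamma_ne_zero_of_re_pos ha)]

/-- The density of the Beta distribution with parameters `p`, `q`. -/
def betaWeight (p q : ℂ) (τ : ℝ) : ℂ :=
  (Complex.betaIntegral p q)⁻¹ * ((τ : ℂ) ^ (p - 1) * (1 - τ : ℂ) ^ (q - 1))

lemma integrableOn_betaWeight {p q : ℂ} (hp : 0 < p.re) (hq : 0 < q.re) :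
    IntegrableOn (betaWeight p q) (Ioc 0 1) :=
  ((intervalIntegrable_iff_integrableOn_Ioc_of_le zero_le_one).1
    (Complex.betaIntegral_convergent hp hq)).const_mul _

lemma betaIntegral_ne_zero {p q : ℂ} (hp : 0 < p.re) (hq : 0 < q.re) :
    Complex.betaIntegral p q ≠ 0 := by
  rw [Complex.betaIntegral_eq_Gamma_mul_div _ _ hp hq]
  exact div_ne_zero (mul_ne_zero (Complex.Gamma_ne_zero_of_re_pos hp)
    (Complex.Gamma_ne_zero_of_re_pos hq)) (Complex.Gamma_ne_zero_of_re_pos (by simp; linarith))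

lemma betaWeight_moment {p q : ℂ} (hp : 0 < p.re) (hq : 0 < q.re) (m k : ℕ) :
    ∫ τ in Ioc (0 : ℝ) 1, betaWeight p q τ * ((τ : ℂ) ^ m * (1 - τ : ℂ) ^ k) =
      poch p m * poch q k / poch (p + q) (m + k) := by
  have hpm : 0 < (p + m).re := by simp; positivity
  have hqk : 0 < (q + k).re := by simp; positivity
  have hpq : 0 < (p + q).re := by simp; linarith
  have e : ∫ τ in Ioc (0 : ℝ) 1, betaWeight p q τ * ((τ : ℂ) ^ m * (1 - τ : ℂ) ^ k) =
      (Complex.betaIntegral p q)⁻¹ * Complex.betaIntegral (p + m) (q + k) := by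
    -- The endpoints are discarded because splitting integer powers off the complex powers needs τ ≠
    -- 0 and 1−τ ≠ 0.
    rw [Complex.betaIntegral, Complex.betaIntegral, intervalIntegral.integral_of_le zero_le_one,
      intervalIntegral.integral_of_le zero_le_one, ← integral_const_mul,
      integral_Ioc_eq_integral_Ioo, integral_Ioc_eq_integral_Ioo, integral_Ioc_eq_integral_Ioo]
    refine setIntegral_congr_fun measurableSet_Ioo fun τ hτ => ?_
    have t0 : (τ : ℂ) ≠ 0 := by exact_mod_cast hτ.1.ne'
    have t1 : (1 - τ : ℂ) ≠ 0 := by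
      rw [sub_ne_zero]; exact_mod_cast hτ.2.ne'
    simp only [betaWeight, Complex.betaIntegral]
    rw [intervalIntegral.integral_of_le zero_le_one, integral_Ioc_eq_integral_Ioo,
      show p + m - 1 = (p - 1) + m by ring, show q + k - 1 = (q - 1) + k by ring,
      Complex.cpow_add _ _ t0, Complex.cpow_add _ _ t1, Complex.cpow_natCast, Complex.cpow_natCast]
    ring
  have g1 := Complex.Gamma_ne_zero_of_re_pos hp
  have g2 := Complex.Gamma_ne_zero_of_re_pos hq
  have g3 := Complex.Gamma_ne_zero_of_re_pos hpq
  have g4 := poch_ne_zero hpq (m + k)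
  have e2 : p + m + (q + k) = (p + q) + ((m + k : ℕ) : ℂ) := by push_cast; ring
  rw [e, Complex.betaIntegral_eq_Gamma_mul_div _ _ hp hq,
    Complex.betaIntegral_eq_Gamma_mul_div _ _ hpm hqk, e2, Gamma_add_nat hp, Gamma_add_nat hq,
    Gamma_add_nat hpq]
  field_simp

lemma hasCoeffs_one_sub_cpow (a : ℂ) :
    HasCoeffs (fun z => (1 - z) ^ (-a)) (fun m => poch a m / (m.factorial : ℂ)) := by
  intro z hz
  have h := (Complex.one_add_cpow_hasFPowerSeriesOnBall_zero (a := -a)).hasSum (y := -z)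
    (by
      rw [← ENNReal.ofReal_one, Metric.eball_ofReal]
      simpa using hz)
  refine hasSum_of_eq h (fun m => ?_) (by simp [sub_eq_add_neg])
  -- The binomial series is ₂F₁(a, b; b; z) for any admissible b; with b = 1 the two symbols (1)_m
  -- cancel.
  rw [binomialSeries_eq_ordinaryHypergeometricSeries (b := (1 : ℂ))
    (fun k hk => by
      have := congrArg Complex.re hk
      simp at this
      have hm : (0 : ℝ) ≤ k := Nat.cast_nonneg k
      linarith)]
  have hne := poch_ne_zero (a := 1) (by simp) m
  simp only [poch] at hne
  have : ((ordinaryHypergeometricSeries ℂ (- -a) 1 1).compContinuousLinearMap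
      (-(ContinuousLinearMap.id ℂ ℂ)) m fun _ => -z) =
      ordinaryHypergeometricSeries ℂ a 1 1 m fun _ => z := by
    rw [FormalMultilinearSeries.compContinuousLinearMap_apply, neg_neg]
    congr 1
    funext i
    simp
  rw [this, ordinaryHypergeometricSeries_apply_eq]
  simp only [smul_eq_mul, poch]
  field_simp

lemma differentiableOn_one_sub_cpow (a : ℂ) :
    DifferentiableOn ℂ (fun z : ℂ => (1 - z) ^ (-a)) cutPlane := fun _ hz =>
  ((differentiableAt_id.const_sub 1).cpow_const hz).differentiableWithinAt

/-- A trivial second factor makes one-variable Euler integrals a special case of Beta transforms. -/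
lemma hasCoeffs_one : HasCoeffs (fun _ => 1) (fun k => if k = 0 then 1 else 0) := by
  intro z _
  have := hasSum_ite_eq (0 : ℕ) (1 : ℂ)
  refine hasSum_of_eq this (fun k => ?_) rfl
  by_cases h : k = 0 <;> simp [h]

/-- The Euler integral for `₂F₁(a, b; c; X)`, constant in `Y`. -/
def gaussIntegral (a b c : ℂ) : ℂ × ℂ → ℂ :=
  betaTransform (betaWeight b (c - b)) (fun z => (1 - z) ^ (-a)) (fun _ => 1)

lemma hasSum_gaussIntegral {a b c : ℂ} (hb : 0 < b.re) (hc : 0 < (c - b).re) {p : ℂ × ℂ}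
    (h1 : ‖p.1‖ < 1) (h2 : ‖p.2‖ < 1) :
    HasSum (fun m => poch a m * poch b m / (poch c m * m.factorial) * p.1 ^ m)
      (gaussIntegral a b c p) := by
  have h := hasSum_betaTransform (integrableOn_betaWeight hb hc) (hasCoeffs_one_sub_cpow a)
    hasCoeffs_one h1 h2
  have inj : Function.Injective fun m : ℕ => (m, 0) := fun _ _ h => (Prod.ext_iff.1 h).1
  rw [← inj.hasSum_iff] at h
  · refine hasSum_of_eq h (fun m => ?_) rfl
    simp only [Function.comp_apply, betaWeight_moment hb hc, poch_zero, add_sub_cancel, if_true,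
      Nat.add_zero, pow_zero]
    ring
  · rintro ⟨m, k⟩ hmk
    have : k ≠ 0 := fun hk => hmk ⟨m, by simp [hk]⟩
    simp [this]

lemma tsum_gauss (a b c z : ℂ) : ordinaryHypergeometric a b c z =
    ∑' m : ℕ, poch a m * poch b m / (poch c m * m.factorial) * z ^ m := by
  rw [ordinaryHypergeometric_eq_tsum]
  refine tsum_congr fun m => ?_
  simp only [poch, smul_eq_mul]
  field_simp

/-- `gaussF` is a choice, which has the intended properties only once some continuation exists;
Euler's integral supplies it, under its own convergence conditions on b and c − b. -/
lemma gaussF_spec {a b c : ℂ} (hb : 0 < b.re) (hc : 0 < (c - b).re) :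
    DifferentiableOn ℂ (gaussF a b c) cutPlane ∧
      HasCoeffs (gaussF a b c) (fun m => poch a m * poch b m / (poch c m * m.factorial)) := by
  have hs : ∀ z : ℂ, ‖z‖ < 1 → HasSum (fun m => poch a m * poch b m / (poch c m * m.factorial) * z ^ m)
      (gaussIntegral a b c (z, 0)) := fun z hz => hasSum_gaussIntegral hb hc (p := (z, 0)) hz (by simp)
  have hex : ∃ F : ℂ → ℂ, DifferentiableOn ℂ F cutPlane ∧
      ∀ z : ℂ, ‖z‖ < 1 → F z = ordinaryHypergeometric a b c z := by
    refine ⟨fun z => gaussIntegral a b c (z, 0), ?_, fun z hz => ?_⟩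
    · exact (differentiableOn_betaTransform (integrableOn_betaWeight hb hc)
        (differentiableOn_one_sub_cpow a) (differentiableOn_const 1)).comp (by fun_prop)
        fun z hz => ⟨hz, mem_cutPlane_of_norm_lt_one (by simp)⟩
    · rw [tsum_gauss, (hs z hz).tsum_eq]
  have := Classical.epsilon_spec hex
  refine ⟨this.1, fun z hz => ?_⟩
  have e : gaussF a b c z = gaussIntegral a b c (z, 0) := by
    rw [← (hs z hz).tsum_eq, ← tsum_gauss]; exact this.2 z hz
  rw [e]; exact hs z hz

lemma gaussF_eq {a b c : ℂ} (hb : 0 < b.re) (hc : 0 < (c - b).re) {p : ℂ × ℂ}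
    (hp : p ∈ cutPlane ×ˢ cutPlane) : gaussF a b c p.1 = gaussIntegral a b c p := by
  have hG : DifferentiableOn ℂ (fun p : ℂ × ℂ => gaussF a b c p.1) (cutPlane ×ˢ cutPlane) :=
    (gaussF_spec hb hc).1.comp differentiableOn_fst fun p hp => hp.1
  have := eqOn_zero_of_eqOn_polydisc (F := fun p => gaussF a b c p.1 - gaussIntegral a b c p)
    (hG.sub (differentiableOn_betaTransform (integrableOn_betaWeight hb hc)
        (differentiableOn_one_sub_cpow a) (differentiableOn_const 1))) (fun p h1 h2 => ?_) hp
  · exact sub_eq_zero.1 this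
  · rw [sub_eq_zero]
    exact ((gaussF_spec hb hc).2 _ h1).unique (hasSum_gaussIntegral hb hc h1 h2)

/-- An integral representation of `F₃(a, b; a, b'; a + d; X, Y)`. -/
def appellIntegral (a b b' d : ℂ) : ℂ × ℂ → ℂ :=
  betaTransform (betaWeight a d) (fun z => (1 - z) ^ (-a)) (gaussF b b' d)

/-- The moment of the weight is (a)_m (d)_k/(a+d)_{m+k}. Its (d)_k cancels the denominator of ₂F₁(b,
b'; d), and its (a)_m joins the one from (1−z)^{-a}, giving the two numerator symbols (a)_m of F₃.
-/
lemma hasSum_appellIntegral {a b b' d : ℂ} (ha : 0 < a.re) (hb : 0 < b'.re) (hd : 0 < (d - b').re)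
    {p : ℂ × ℂ} (h1 : ‖p.1‖ < 1) (h2 : ‖p.2‖ < 1) :
    HasSum (fun mk : ℕ × ℕ => poch a mk.1 * poch b mk.2 * poch a mk.1 * poch b' mk.2 /
      (poch (a + d) (mk.1 + mk.2) * (mk.1.factorial : ℂ) * (mk.2.factorial : ℂ)) *
      p.1 ^ mk.1 * p.2 ^ mk.2) (appellIntegral a b b' d p) := by
  have hd0 : 0 < d.re := by simp at hd; linarith
  have h := hasSum_betaTransform (integrableOn_betaWeight ha hd0) (hasCoeffs_one_sub_cpow a)
    (gaussF_spec (a := b) hb hd).2 h1 h2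
  refine hasSum_of_eq h (fun mk => ?_) rfl
  rw [betaWeight_moment ha hd0]
  have := poch_ne_zero hd0 mk.2
  field_simp

lemma differentiableOn_appellIntegral {a b b' d : ℂ} (ha : 0 < a.re) (hb : 0 < b'.re)
    (hd : 0 < (d - b').re) : DifferentiableOn ℂ (appellIntegral a b b' d) (cutPlane ×ˢ cutPlane) :=
  differentiableOn_betaTransform
    (integrableOn_betaWeight ha (by simp at hd; linarith)) (differentiableOn_one_sub_cpow a)
      (gaussF_spec hb hd).1

lemma appellF3_eq {a b b' d : ℂ} (ha : 0 < a.re) (hb : 0 < b'.re) (hd : 0 < (d - b').re)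
    {p : ℂ × ℂ} (hp : p ∈ cutPlane ×ˢ cutPlane) :
    appellF3 a b a b' (a + d) p = appellIntegral a b b' d p := by
  have hdiff := differentiableOn_appellIntegral (b := b) ha hb hd
  have hs : ∀ p : ℂ × ℂ, ‖p.1‖ < 1 → ‖p.2‖ < 1 →
      appellIntegral a b b' d p = appellSeries a b a b' (a + d) p := fun p h1 h2 =>
    ((hasSum_appellIntegral ha hb hd h1 h2).tsum_eq).symm
  have hex : ∃ F : ℂ × ℂ → ℂ, DifferentiableOn ℂ F (cutPlane ×ˢ cutPlane) ∧
      ∀ p : ℂ × ℂ, ‖p.1‖ < 1 → ‖p.2‖ < 1 → F p = appellSeries a b a b' (a + d) p :=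
    ⟨_, hdiff, hs⟩
  have spec := Classical.epsilon_spec hex
  have := eqOn_zero_of_eqOn_polydisc
    (F := fun p => appellF3 a b a b' (a + d) p - appellIntegral a b b' d p)
    (DifferentiableOn.sub spec.1 hdiff) (fun p h1 h2 => ?_) hp
  · exact sub_eq_zero.1 this
  · rw [sub_eq_zero, hs p h1 h2]; exact spec.2 p h1 h2

/-! ### The partial differential equation -/

/-- On the term X^m Y^k the operators `euler a`, `euler b` are multiplication by a+m and b+k. With S
= a+b and M = m+k the unshifted part is (S+M)² − (N+1)(S+M) − S(S−N−1) = M(2S−N−1+M). Splitting M =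
m + k, the two halves are the sums multiplied by X and Y, by the recursions `r₁` and `r₂`. The
identity then extends from the polydisc. -/
lemma betaTransform_pde {w : ℝ → ℂ} (hw : IntegrableOn w (Ioc 0 1)) {f₁ f₂ : ℂ → ℂ}
    (h₁ : DifferentiableOn ℂ f₁ cutPlane) (h₂ : DifferentiableOn ℂ f₂ cutPlane) {A B : ℕ → ℂ}
    (c₁ : HasCoeffs f₁ A) (c₂ : HasCoeffs f₂ B) (a b N e₁ e₂ : ℂ) (C : ℕ → ℕ → ℂ)
    (hC : ∀ m k, A m * B k *
      (∫ τ in Ioc (0 : ℝ) 1, w τ * ((τ : ℂ) ^ m * (1 - τ : ℂ) ^ k)) = C m k)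
    (r₁ : ∀ m k : ℕ, (m + 1) * (2 * (a + b) - N + m + k) * C (m + 1) k =
      (a + m) * (a + m - e₁ + 1) * C m k)
    (r₂ : ∀ m k : ℕ, (k + 1) * (2 * (a + b) - N + m + k) * C m (k + 1) =
      (b + k) * (b + k - e₂ + 1) * C m k)
    {p : ℂ × ℂ} (hp : p ∈ cutPlane ×ˢ cutPlane) :
    betaTransform w (euler a (euler a f₁)) f₂ p + 2 * betaTransform w (euler a f₁) (euler b f₂) p
      + betaTransform w f₁ (euler b (euler b f₂)) p
      - (N + 1) * (betaTransform w (euler a f₁) f₂ p + betaTransform w f₁ (euler b f₂) p)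
      - p.1 * (betaTransform w (euler a (euler a f₁)) f₂ p
        - (e₁ - 1) * betaTransform w (euler a f₁) f₂ p)
      - p.2 * (betaTransform w f₁ (euler b (euler b f₂)) p
        - (e₂ - 1) * betaTransform w f₁ (euler b f₂) p)
      - (a + b) * (a + b - N - 1) * betaTransform w f₁ f₂ p = 0 := by
  have h₁' := differentiableOn_euler h₁ a
  have h₁'' := differentiableOn_euler h₁' a
  have h₂' := differentiableOn_euler h₂ b
  have h₂'' := differentiableOn_euler h₂' b
  have D := @differentiableOn_betaTransform w hw
  refine eqOn_zero_of_eqOn_polydisc (F := fun p : ℂ × ℂ =>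
    betaTransform w (euler a (euler a f₁)) f₂ p + 2 * betaTransform w (euler a f₁) (euler b f₂) p
      + betaTransform w f₁ (euler b (euler b f₂)) p
      - (N + 1) * (betaTransform w (euler a f₁) f₂ p + betaTransform w f₁ (euler b f₂) p)
      - p.1 * (betaTransform w (euler a (euler a f₁)) f₂ p
        - (e₁ - 1) * betaTransform w (euler a f₁) f₂ p)
      - p.2 * (betaTransform w f₁ (euler b (euler b f₂)) p
        - (e₂ - 1) * betaTransform w f₁ (euler b f₂) p)
      - (a + b) * (a + b - N - 1) * betaTransform w f₁ f₂ p) ?_ (fun p hX hY => ?_) hp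
  · have := D h₁'' h₂; have := D h₁' h₂'; have := D h₁ h₂''; have := D h₁' h₂
    have := D h₁ h₂'; have := D h₁ h₂
    fun_prop
  · have S := fun {f₁ f₂ : ℂ → ℂ} {A B : ℕ → ℂ} (c₁ : HasCoeffs f₁ A) (c₂ : HasCoeffs f₂ B) =>
      hasSum_betaTransform hw c₁ c₂ hX hY
    have s20 := S ((c₁.euler a).euler a) c₂
    have s11 := S (c₁.euler a) (c₂.euler b)
    have s02 := S c₁ ((c₂.euler b).euler b)
    have s10 := S (c₁.euler a) c₂
    have s01 := S c₁ (c₂.euler b)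
    have s00 := S c₁ c₂
    have T₁ := (s20.sub (s10.mul_left (e₁ - 1))).mul_left p.1
    have T₂ := (s02.sub (s01.mul_left (e₂ - 1))).mul_left p.2
    have inj₁ : Function.Injective fun mk : ℕ × ℕ => (mk.1 + 1, mk.2) := by
      rintro ⟨m, k⟩ ⟨m', k'⟩ h
      simpa using h
    have inj₂ : Function.Injective fun mk : ℕ × ℕ => (mk.1, mk.2 + 1) := by
      rintro ⟨m, k⟩ ⟨m', k'⟩ h
      simpa using h
    -- Multiplication by X shifts m to m+1; the reindexed sum misses only the terms with m = 0,
    -- which vanish because of the factor m.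
    have U₁ : HasSum (fun mk : ℕ × ℕ => (mk.1 : ℂ) * (2 * (a + b) - N + mk.1 + mk.2 - 1) *
        C mk.1 mk.2 * (p.1 ^ mk.1 * p.2 ^ mk.2)) (p.1 * (betaTransform w (euler a (euler a f₁)) f₂ p
          - (e₁ - 1) * betaTransform w (euler a f₁) f₂ p)) := by
      refine (inj₁.hasSum_iff ?_).1 (hasSum_of_eq T₁ (fun mk => ?_) rfl)
      · rintro ⟨m, k⟩ hmk
        rcases m with _ | m
        · simp
        · exact absurd ⟨(m, k), rfl⟩ hmk
      · have := r₁ mk.1 mk.2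
        simp only [Function.comp_apply, ← hC] at this ⊢
        push_cast
        rw [pow_succ]
        linear_combination (p.1 ^ mk.1 * p.1 * p.2 ^ mk.2) * this
    have U₂ : HasSum (fun mk : ℕ × ℕ => (mk.2 : ℂ) * (2 * (a + b) - N + mk.1 + mk.2 - 1) *
        C mk.1 mk.2 * (p.1 ^ mk.1 * p.2 ^ mk.2)) (p.2 * (betaTransform w f₁ (euler b (euler b f₂)) p
          - (e₂ - 1) * betaTransform w f₁ (euler b f₂) p)) := by
      refine (inj₂.hasSum_iff ?_).1 (hasSum_of_eq T₂ (fun mk => ?_) rfl)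
      · rintro ⟨m, k⟩ hmk
        rcases k with _ | k
        · simp
        · exact absurd ⟨(m, k), rfl⟩ hmk
      · have := r₂ mk.1 mk.2
        simp only [Function.comp_apply, ← hC] at this ⊢
        push_cast
        rw [pow_succ]
        linear_combination (p.1 ^ mk.1 * p.2 * p.2 ^ mk.2) * this
    have L := ((((s20.add (s11.mul_left 2)).add s02).sub ((s10.add s01).mul_left (N + 1))).sub
      (s00.mul_left ((a + b) * (a + b - N - 1)))).sub (U₁.add U₂)
    have Z := L.unique (hasSum_of_eq hasSum_zero (fun mk => ?_) rfl)
    · linear_combination Z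
    · simp only [← hC]; ring

end UnitaryForms
end

noncomputable section
namespace UnitaryForms

open MeasureTheory Set

/-! ### Functions of two variables and their logarithmic derivatives -/

/-- At the point `q`, the numbers `k₁, k₂` are `x ∂K/∂x, y ∂K/∂y`, and `k₁₁, k₁₂, k₂₂` are the
values of the iterates of the operators `x ∂/∂x, y ∂/∂y` on `K`. -/
def ThetaSystem (K : ℂ × ℂ → ℂ) (q : ℂ × ℂ) (k₁ k₂ k₁₁ k₁₂ k₂₂ : ℂ) : Prop :=
  ∃ K₁ K₂ : ℂ × ℂ → ℂ,
    (∀ᶠ q' in nhds q, HasFDerivAt K ((q'.1⁻¹ * K₁ q') • ContinuousLinearMap.fst ℂ ℂ ℂ +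
      (q'.2⁻¹ * K₂ q') • ContinuousLinearMap.snd ℂ ℂ ℂ) q') ∧ K₁ q = k₁ ∧ K₂ q = k₂ ∧
    HasFDerivAt K₁ ((q.1⁻¹ * k₁₁) • ContinuousLinearMap.fst ℂ ℂ ℂ +
      (q.2⁻¹ * k₁₂) • ContinuousLinearMap.snd ℂ ℂ ℂ) q ∧
    HasFDerivAt K₂ ((q.1⁻¹ * k₁₂) • ContinuousLinearMap.fst ℂ ℂ ℂ +
      (q.2⁻¹ * k₂₂) • ContinuousLinearMap.snd ℂ ℂ ℂ) q

/-- `x^{-a} y^{-b} ∫₀¹ w(τ) f₁(-τ/x) f₂(-(1-τ)/y) dτ`. -/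
def betaKernel (a b : ℂ) (w : ℝ → ℂ) (f₁ f₂ : ℂ → ℂ) (q : ℂ × ℂ) : ℂ :=
  q.1 ^ (-a) * q.2 ^ (-b) * betaTransform w f₁ f₂ (-q.1⁻¹, -q.2⁻¹)

/-- Pairs of complex numbers of positive real part. -/
def posQuadrant : Set (ℂ × ℂ) := {q | 0 < q.1.re ∧ 0 < q.2.re}

lemma isOpen_posQuadrant : IsOpen posQuadrant :=
  (isOpen_lt (f := fun _ : ℂ × ℂ => (0 : ℝ)) (g := fun q => q.1.re) (by fun_prop) (by fun_prop)).inter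
    (isOpen_lt (f := fun _ : ℂ × ℂ => (0 : ℝ)) (g := fun q => q.2.re) (by fun_prop) (by fun_prop))

lemma neg_inv_mem {q : ℂ × ℂ} (hq : q ∈ posQuadrant) :
    ((-q.1⁻¹, -q.2⁻¹) : ℂ × ℂ) ∈ cutPlane ×ˢ cutPlane :=
  ⟨neg_inv_mem_cutPlane hq.1, neg_inv_mem_cutPlane hq.2⟩

lemma ne_zero_of_re_pos {z : ℂ} (h : 0 < z.re) : z ≠ 0 := fun h0 => by simp [h0] at h

lemma integrableOn_mul_id {w : ℝ → ℂ} (hw : IntegrableOn w (Ioc 0 1)) :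
    IntegrableOn (fun τ : ℝ => w τ * (τ : ℂ)) (Ioc 0 1) :=
  integrable_mul_continuousOn hw (by fun_prop)

lemma integrableOn_mul_one_sub {w : ℝ → ℂ} (hw : IntegrableOn w (Ioc 0 1)) :
    IntegrableOn (fun τ : ℝ => w τ * (1 - τ : ℂ)) (Ioc 0 1) :=
  integrable_mul_continuousOn hw (by fun_prop)

/-- Since z d/dz commutes with z ↦ τz, the operator X∂/∂X passes through the integral onto f₁ and
leaves the weight unchanged. -/
lemma betaTransform_euler_left {w : ℝ → ℂ} (hw : IntegrableOn w (Ioc 0 1)) {f₁ f₂ : ℂ → ℂ}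
    (h₁ : DifferentiableOn ℂ f₁ cutPlane) (h₂ : DifferentiableOn ℂ f₂ cutPlane) (a : ℂ)
    {p : ℂ × ℂ} (hp : p ∈ cutPlane ×ˢ cutPlane) :
    betaTransform w (euler a f₁) f₂ p = a * betaTransform w f₁ f₂ p +
      p.1 * betaTransform (fun τ => w τ * τ) (deriv f₁) f₂ p := by
  simp only [betaTransform]
  rw [← integral_const_mul, ← integral_const_mul, ← integral_add]
  · refine integral_congr_ae (Filter.Eventually.of_forall fun τ => ?_)
    simp only [euler]; ring
  · exact (integrable_betaTransform hw h₁.continuousOn h₂.continuousOn hp).const_mul _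
  · exact (integrable_betaTransform (integrableOn_mul_id hw)
      (deriv_differentiableOn h₁).continuousOn h₂.continuousOn hp).const_mul _

lemma betaTransform_euler_right {w : ℝ → ℂ} (hw : IntegrableOn w (Ioc 0 1)) {f₁ f₂ : ℂ → ℂ}
    (h₁ : DifferentiableOn ℂ f₁ cutPlane) (h₂ : DifferentiableOn ℂ f₂ cutPlane) (b : ℂ)
    {p : ℂ × ℂ} (hp : p ∈ cutPlane ×ˢ cutPlane) :
    betaTransform w f₁ (euler b f₂) p = b * betaTransform w f₁ f₂ p +
      p.2 * betaTransform (fun τ => w τ * (1 - τ)) f₁ (deriv f₂) p := by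
  simp only [betaTransform]
  rw [← integral_const_mul, ← integral_const_mul, ← integral_add]
  · refine integral_congr_ae (Filter.Eventually.of_forall fun τ => ?_)
    simp only [euler]; ring
  · exact (integrable_betaTransform hw h₁.continuousOn h₂.continuousOn hp).const_mul _
  · exact (integrable_betaTransform (integrableOn_mul_one_sub hw)
      h₁.continuousOn (deriv_differentiableOn h₂).continuousOn hp).const_mul _

lemma hasFDerivAt_cpow_mul_cpow (a b : ℂ) {q : ℂ × ℂ} (hq : q ∈ posQuadrant) :
    HasFDerivAt (fun q : ℂ × ℂ => q.1 ^ a * q.2 ^ b)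
      ((q.1⁻¹ * (a * (q.1 ^ a * q.2 ^ b))) • ContinuousLinearMap.fst ℂ ℂ ℂ +
        (q.2⁻¹ * (b * (q.1 ^ a * q.2 ^ b))) • ContinuousLinearMap.snd ℂ ℂ ℂ) q := by
  have n1 := ne_zero_of_re_pos hq.1
  have n2 := ne_zero_of_re_pos hq.2
  have d1 := (hasDerivAt_id q.1).cpow_const (c := a) (Or.inl hq.1)
  have d2 := (hasDerivAt_id q.2).cpow_const (c := b) (Or.inl hq.2)
  have k1 := d1.comp_hasFDerivAt q (hasFDerivAt_fst (𝕜 := ℂ) (p := q))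
  have k2 := d2.comp_hasFDerivAt q (hasFDerivAt_snd (𝕜 := ℂ) (p := q))
  refine (k1.mul k2).congr_fderiv ?_
  simp only [id, Function.comp, Complex.cpow_sub _ _ n1, Complex.cpow_sub _ _ n2,
    Complex.cpow_one]
  ext <;> simp <;> field_simp

lemma thetaSystem_cpow (a b : ℂ) {q : ℂ × ℂ} (hq : q ∈ posQuadrant) :
    ThetaSystem (fun q : ℂ × ℂ => q.1 ^ a * q.2 ^ b) q (a * (q.1 ^ a * q.2 ^ b))
      (b * (q.1 ^ a * q.2 ^ b)) (a * (a * (q.1 ^ a * q.2 ^ b))) (a * (b * (q.1 ^ a * q.2 ^ b)))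
      (b * (b * (q.1 ^ a * q.2 ^ b))) := by
  have h := hasFDerivAt_cpow_mul_cpow a b hq
  refine ⟨fun q => a * (q.1 ^ a * q.2 ^ b), fun q => b * (q.1 ^ a * q.2 ^ b), ?_, rfl, rfl,
    (h.const_mul a).congr_fderiv ?_, (h.const_mul b).congr_fderiv ?_⟩
  · filter_upwards [isOpen_posQuadrant.mem_nhds hq] with q' hq'
    exact hasFDerivAt_cpow_mul_cpow a b hq'
  · ext <;> simp <;> ring
  · ext <;> simp <;> ring

/-- With X = −1/x one has −x∂_x = X∂_X, so −x∂_x applied to x^{-a} f(X) is x^{-a}(a + X∂_X)f.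
Logarithmic derivatives of a kernel are thus kernels of the same type, with `euler` applied to one
factor. -/
lemma hasFDerivAt_betaKernel {w : ℝ → ℂ} (hw : IntegrableOn w (Ioc 0 1)) {f₁ f₂ : ℂ → ℂ}
    (h₁ : DifferentiableOn ℂ f₁ cutPlane) (h₂ : DifferentiableOn ℂ f₂ cutPlane) (a b : ℂ)
    {q : ℂ × ℂ} (hq : q ∈ posQuadrant) :
    HasFDerivAt (betaKernel a b w f₁ f₂)
      ((q.1⁻¹ * -betaKernel a b w (euler a f₁) f₂ q) • ContinuousLinearMap.fst ℂ ℂ ℂ +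
        (q.2⁻¹ * -betaKernel a b w f₁ (euler b f₂) q) • ContinuousLinearMap.snd ℂ ℂ ℂ) q := by
  have n1 := ne_zero_of_re_pos hq.1
  have n2 := ne_zero_of_re_pos hq.2
  have hp := neg_inv_mem hq
  have i1 := (hasDerivAt_inv n1).neg.comp_hasFDerivAt q (hasFDerivAt_fst (𝕜 := ℂ) (p := q))
  have i2 := (hasDerivAt_inv n2).neg.comp_hasFDerivAt q (hasFDerivAt_snd (𝕜 := ℂ) (p := q))
  have J := (hasFDerivAt_betaTransform hw h₁ h₂ hp).comp q (i1.prodMk i2)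
  refine ((hasFDerivAt_cpow_mul_cpow (-a) (-b) hq).mul J).congr_fderiv ?_
  simp only [betaKernel, betaTransform_euler_left hw h₁ h₂ a hp,
    betaTransform_euler_right hw h₁ h₂ b hp]
  ext <;> simp [Function.comp] <;> field_simp <;> ring

lemma thetaSystem_betaKernel {w : ℝ → ℂ} (hw : IntegrableOn w (Ioc 0 1)) {f₁ f₂ : ℂ → ℂ}
    (h₁ : DifferentiableOn ℂ f₁ cutPlane) (h₂ : DifferentiableOn ℂ f₂ cutPlane) (a b : ℂ)
    {q : ℂ × ℂ} (hq : q ∈ posQuadrant) :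
    ThetaSystem (betaKernel a b w f₁ f₂) q (-betaKernel a b w (euler a f₁) f₂ q)
      (-betaKernel a b w f₁ (euler b f₂) q) (betaKernel a b w (euler a (euler a f₁)) f₂ q)
      (betaKernel a b w (euler a f₁) (euler b f₂) q)
      (betaKernel a b w f₁ (euler b (euler b f₂)) q) := by
  refine ⟨fun q => -betaKernel a b w (euler a f₁) f₂ q, fun q => -betaKernel a b w f₁ (euler b f₂) q,
    ?_, rfl, rfl,
    (hasFDerivAt_betaKernel hw (differentiableOn_euler h₁ a) h₂ a b hq).neg.congr_fderiv ?_,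
    (hasFDerivAt_betaKernel hw h₁ (differentiableOn_euler h₂ b) a b hq).neg.congr_fderiv ?_⟩
  · filter_upwards [isOpen_posQuadrant.mem_nhds hq] with q' hq'
    exact hasFDerivAt_betaKernel hw h₁ h₂ a b hq'
  · ext <;> simp
  · ext <;> simp

lemma contDiffAt_betaKernel {w : ℝ → ℂ} (hw : IntegrableOn w (Ioc 0 1)) {f₁ f₂ : ℂ → ℂ}
    (h₁ : DifferentiableOn ℂ f₁ cutPlane) (h₂ : DifferentiableOn ℂ f₂ cutPlane) (a b : ℂ)
    {q : ℂ × ℂ} (hq : q ∈ posQuadrant) : ContDiffAt ℂ 2 (betaKernel a b w f₁ f₂) q := by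
  have n1 := ne_zero_of_re_pos hq.1
  have n2 := ne_zero_of_re_pos hq.2
  have J : ContDiffAt ℂ 2 (betaTransform w f₁ f₂) (-q.1⁻¹, -q.2⁻¹) :=
    (contDiffOn_betaTransform 2 hw h₁ h₂).contDiffAt
      ((isOpen_cutPlane.prod isOpen_cutPlane).mem_nhds (neg_inv_mem hq))
  have i : ContDiffAt ℂ 2 (fun q : ℂ × ℂ => (-q.1⁻¹, -q.2⁻¹)) q :=
    ((contDiffAt_fst.inv n1).neg).prodMk ((contDiffAt_snd.inv n2).neg)
  have c : ∀ (a : ℂ) {z : ℂ}, 0 < z.re → ContDiffAt ℂ 2 (fun z : ℂ => z ^ a) z := fun a z hz =>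
    (AnalyticAt.cpow analyticAt_id analyticAt_const (Or.inl hz)).contDiffAt
  have JJ : ContDiffAt ℂ 2 (fun q : ℂ × ℂ => betaTransform w f₁ f₂ (-q.1⁻¹, -q.2⁻¹)) q :=
    ContDiffAt.comp (g := betaTransform w f₁ f₂) q J i
  exact (((c (-a) hq.1).comp q contDiffAt_fst).mul ((c (-b) hq.2).comp q contDiffAt_snd)).mul
    JJ

lemma betaKernel_pde {w : ℝ → ℂ} (hw : IntegrableOn w (Ioc 0 1)) {f₁ f₂ : ℂ → ℂ}
    (h₁ : DifferentiableOn ℂ f₁ cutPlane) (h₂ : DifferentiableOn ℂ f₂ cutPlane) {A B : ℕ → ℂ}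
    (c₁ : HasCoeffs f₁ A) (c₂ : HasCoeffs f₂ B) (a b N e₁ e₂ : ℂ) (C : ℕ → ℕ → ℂ)
    (hC : ∀ m k, A m * B k *
      (∫ τ in Ioc (0 : ℝ) 1, w τ * ((τ : ℂ) ^ m * (1 - τ : ℂ) ^ k)) = C m k)
    (r₁ : ∀ m k : ℕ, (m + 1) * (2 * (a + b) - N + m + k) * C (m + 1) k =
      (a + m) * (a + m - e₁ + 1) * C m k)
    (r₂ : ∀ m k : ℕ, (k + 1) * (2 * (a + b) - N + m + k) * C m (k + 1) =
      (b + k) * (b + k - e₂ + 1) * C m k)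
    {q : ℂ × ℂ} (hq : q ∈ posQuadrant) :
    betaKernel a b w (euler a (euler a f₁)) f₂ q + 2 * betaKernel a b w (euler a f₁) (euler b f₂) q +
      betaKernel a b w f₁ (euler b (euler b f₂)) q +
      (N + 1) * (-betaKernel a b w (euler a f₁) f₂ q + -betaKernel a b w f₁ (euler b f₂) q) +
      q.1⁻¹ * (betaKernel a b w (euler a (euler a f₁)) f₂ q +
        (e₁ - 1) * -betaKernel a b w (euler a f₁) f₂ q) +
      q.2⁻¹ * (betaKernel a b w f₁ (euler b (euler b f₂)) q +
        (e₂ - 1) * -betaKernel a b w f₁ (euler b f₂) q) =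
      (a + b) * (a + b - N - 1) * betaKernel a b w f₁ f₂ q := by
  have := betaTransform_pde hw h₁ h₂ c₁ c₂ a b N e₁ e₂ C hC r₁ r₂ (neg_inv_mem hq)
  simp only [betaKernel]
  linear_combination (q.1 ^ (-a) * q.2 ^ (-b)) * this

/-! ### Second derivatives along curves -/

/-- `x` is twice differentiable at `h₀`, with first and second derivative `x₁`, `x₂`. -/
def HasDeriv2 {E : Type*} [NormedAddCommGroup E] [NormedSpace ℝ E] (x : ℝ → E) (h₀ : ℝ) (x₁ x₂ : E) :
    Prop :=
  ∃ x' : ℝ → E, (∀ᶠ h in nhds h₀, HasDerivAt x (x' h) h) ∧ x' h₀ = x₁ ∧ HasDerivAt x' x₂ h₀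

lemma hasDeriv2_const (c h₀ : ℝ) : HasDeriv2 (fun _ => c) h₀ 0 0 :=
  ⟨fun _ => 0, Filter.Eventually.of_forall fun h => hasDerivAt_const h c, rfl, hasDerivAt_const _ _⟩

/-- Along each coordinate direction of (t, ρ, β) the functions x, y, ρ/|cw+d|² and β/|cw+d|² are
quotients of polynomials of degree at most two, so this one formula supplies all the derivatives
needed. -/
lemma hasDeriv2_quadratic_div (α β γ a b c h₀ : ℝ) (hQ : a * h₀ ^ 2 + b * h₀ + c ≠ 0) :
    HasDeriv2 (fun h => (α * h ^ 2 + β * h + γ) / (a * h ^ 2 + b * h + c)) h₀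
      ((2 * α * h₀ + β) / (a * h₀ ^ 2 + b * h₀ + c) - (α * h₀ ^ 2 + β * h₀ + γ) *
        (2 * a * h₀ + b) / (a * h₀ ^ 2 + b * h₀ + c) ^ 2)
      (2 * α / (a * h₀ ^ 2 + b * h₀ + c) - 2 * (2 * α * h₀ + β) * (2 * a * h₀ + b) /
        (a * h₀ ^ 2 + b * h₀ + c) ^ 2 - (α * h₀ ^ 2 + β * h₀ + γ) * (2 * a) /
        (a * h₀ ^ 2 + b * h₀ + c) ^ 2 + 2 * (α * h₀ ^ 2 + β * h₀ + γ) * (2 * a * h₀ + b) ^ 2 /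
        (a * h₀ ^ 2 + b * h₀ + c) ^ 3) := by
  have P : ∀ α β γ h : ℝ, HasDerivAt (fun h => α * h ^ 2 + β * h + γ) (2 * α * h + β) h := by
    intro α β γ h
    have := (((hasDerivAt_pow 2 h).const_mul α).add ((hasDerivAt_id h).const_mul β)).add_const γ
    refine this.congr_deriv ?_
    simp; ring
  have Q : ∀ α β h : ℝ, HasDerivAt (fun h => 2 * α * h + β) (2 * α) h := by
    intro α β h
    refine (((hasDerivAt_id h).const_mul (2 * α)).add_const β).congr_deriv ?_
    simp
  have cont : Continuous fun h : ℝ => a * h ^ 2 + b * h + c := by fun_prop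
  refine ⟨fun h => (2 * α * h + β) / (a * h ^ 2 + b * h + c) - (α * h ^ 2 + β * h + γ) *
        (2 * a * h + b) / (a * h ^ 2 + b * h + c) ^ 2, ?_, rfl, ?_⟩
  · filter_upwards [cont.continuousAt.eventually_ne hQ] with h hh
    refine ((P α β γ h).div (P a b c h) hh).congr_deriv ?_
    field_simp
  · refine (((Q α β h₀).div (P a b c h₀) hQ).sub
      (((P α β γ h₀).mul (Q a b h₀)).div ((P a b c h₀).pow 2) (pow_ne_zero 2 hQ))).congr_deriv ?_
    simp only [Pi.mul_apply, Pi.pow_apply]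
    generalize a * h₀ ^ 2 + b * h₀ + c = D at hQ ⊢
    field_simp
    push_cast
    ring

lemma ThetaSystem.comp {K : ℂ × ℂ → ℂ} {k₁ k₂ k₁₁ k₁₂ k₂₂ : ℂ} {x y : ℝ → ℝ} {h₀ x₁ x₂ y₁ y₂ : ℝ}
    (hK : ThetaSystem K ((x h₀ : ℂ), (y h₀ : ℂ)) k₁ k₂ k₁₁ k₁₂ k₂₂)
    (hx : HasDeriv2 x h₀ x₁ x₂) (hy : HasDeriv2 y h₀ y₁ y₂) (x0 : x h₀ ≠ 0) (y0 : y h₀ ≠ 0) :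
    HasDeriv2 (fun h => K ((x h : ℂ), (y h : ℂ))) h₀
      (k₁ * (x₁ / x h₀) + k₂ * (y₁ / y h₀))
      (k₁₁ * (x₁ / x h₀) ^ 2 + 2 * k₁₂ * (x₁ / x h₀ * (y₁ / y h₀)) + k₂₂ * (y₁ / y h₀) ^ 2 +
        k₁ * (x₂ / x h₀ - (x₁ / x h₀) ^ 2) + k₂ * (y₂ / y h₀ - (y₁ / y h₀) ^ 2)) := by
  obtain ⟨K₁, K₂, hd, rfl, rfl, d1, d2⟩ := hK
  obtain ⟨x', hx', rfl, hx''⟩ := hx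
  obtain ⟨y', hy', rfl, hy''⟩ := hy
  have curve : ∀ {h}, HasDerivAt x (x' h) h → HasDerivAt y (y' h) h →
      HasDerivAt (fun h => ((x h : ℂ), (y h : ℂ))) ((x' h : ℂ), (y' h : ℂ)) h :=
    fun a b => a.ofReal_comp.prodMk b.ofReal_comp
  have c0 := curve hx'.self_of_nhds hy'.self_of_nhds
  have X0 : (x h₀ : ℂ) ≠ 0 := by exact_mod_cast x0
  have Y0 : (y h₀ : ℂ) ≠ 0 := by exact_mod_cast y0
  refine ⟨fun h => K₁ ((x h : ℂ), (y h : ℂ)) * (x' h / x h) + K₂ ((x h : ℂ), (y h : ℂ)) * (y' h / y h),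
    ?_, rfl, ?_⟩
  · have := c0.continuousAt.eventually hd
    filter_upwards [this, hx', hy'] with h hh hxh hyh
    have := (hh.restrictScalars ℝ).comp_hasDerivAt h (curve hxh hyh)
    refine this.congr_deriv ?_
    simp
    ring
  · have e1 := (d1.restrictScalars ℝ).comp_hasDerivAt h₀ c0
    have e2 := (d2.restrictScalars ℝ).comp_hasDerivAt h₀ c0
    have q1 := hx''.ofReal_comp.div hx'.self_of_nhds.ofReal_comp X0
    have q2 := hy''.ofReal_comp.div hy'.self_of_nhds.ofReal_comp Y0
    refine ((e1.mul q1).add (e2.mul q2)).congr_deriv ?_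
    simp
    field_simp
    ring

end UnitaryForms
end

noncomputable section
namespace UnitaryForms

open Filter Topology

/-! ### The Laplace–Beltrami operator in the coordinates `t, ρ, β` -/

lemma lap_congr {n : ℕ} {f g : Pt n → ℂ} {Z : Pt n} (h : f =ᶠ[𝓝 Z] g) : lap f Z = lap g Z := by
  have h1 := h.fderiv (𝕜 := ℝ)
  have d : ∀ v, dW v f =ᶠ[𝓝 Z] dW v g := fun v => by
    filter_upwards [h1] with Z' hZ'
    simp only [dW, hZ']
  have d' : ∀ v, dWbar v f =ᶠ[𝓝 Z] dWbar v g := fun v => by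
    filter_upwards [h1] with Z' hZ'
    simp only [dWbar, hZ']
  have e : ∀ u v, dW u (dWbar v f) Z = dW u (dWbar v g) Z := fun u v => by
    simp only [dW, (d' v).fderiv_eq]
  have e' : ∀ u v, dWbar u (dW v f) Z = dWbar u (dW v g) Z := fun u v => by
    simp only [dWbar, (d v).fderiv_eq]
  simp only [lap, e, e']

section SecondDerivative
variable {n : ℕ} {f : Pt n → ℂ} {Z : Pt n}

/-- The second derivative, as a bilinear form. -/
def hess (f : Pt n → ℂ) (Z : Pt n) : Pt n →L[ℝ] Pt n →L[ℝ] ℂ := fderiv ℝ (fderiv ℝ f) Z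

lemma differentiableAt_fderiv_of_contDiffAt {E F : Type*} [NormedAddCommGroup E] [NormedSpace ℝ E]
    [NormedAddCommGroup F] [NormedSpace ℝ F] {f : E → F} {Z : E} (hf : ContDiffAt ℝ 2 f Z) :
    DifferentiableAt ℝ (fderiv ℝ f) Z :=
  (hf.fderiv_right (m := 1) (by norm_num)).differentiableAt (by norm_num)

lemma fderiv_fderiv_apply (hf : DifferentiableAt ℝ (fderiv ℝ f) Z) (c : ℂ) (u u' v : Pt n) :
    fderiv ℝ (fun Z => (fderiv ℝ f Z u + c * fderiv ℝ f Z u') / 2) Z v =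
      (hess f Z v u + c * hess f Z v u') / 2 := by
  have h : ∀ u, HasFDerivAt (fun Z => fderiv ℝ f Z u) ((hess f Z).flip u) Z := fun u =>
    (hf.hasFDerivAt.clm_apply (hasFDerivAt_const u Z)).congr_fderiv (by ext <;> simp [hess])
  have := ((h u).add ((h u').const_mul c)).mul_const (2⁻¹ : ℂ)
  have e : HasFDerivAt (fun Z => (fderiv ℝ f Z u + c * fderiv ℝ f Z u') * 2⁻¹) _ Z := this
  simp only [div_eq_mul_inv]
  rw [e.fderiv]
  simp
  ring

lemma dW_dWbar (hf : DifferentiableAt ℝ (fderiv ℝ f) Z) (u v : Pt n) :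
    dW v (dWbar u f) Z = (hess f Z v u + Complex.I * hess f Z v (Complex.I • u)
      - Complex.I * hess f Z (Complex.I • v) u + hess f Z (Complex.I • v) (Complex.I • u)) / 4 := by
  rw [dW, show dWbar u f = fun Z => (fderiv ℝ f Z u + Complex.I * fderiv ℝ f Z (Complex.I • u)) / 2
    from rfl, fderiv_fderiv_apply hf, fderiv_fderiv_apply hf]
  linear_combination (-(hess f Z (Complex.I • v) (Complex.I • u)) / 4) * Complex.I_sq

lemma dWbar_dW (hf : DifferentiableAt ℝ (fderiv ℝ f) Z) (u v : Pt n) :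
    dWbar v (dW u f) Z = (hess f Z v u - Complex.I * hess f Z v (Complex.I • u)
      + Complex.I * hess f Z (Complex.I • v) u + hess f Z (Complex.I • v) (Complex.I • u)) / 4 := by
  rw [dWbar, show dW u f = fun Z => (fderiv ℝ f Z u + (-Complex.I) * fderiv ℝ f Z (Complex.I • u)) / 2
    from by funext Z; simp only [dW]; ring, fderiv_fderiv_apply hf, fderiv_fderiv_apply hf]
  linear_combination (-(hess f Z (Complex.I • v) (Complex.I • u)) / 4) * Complex.I_sq

/-- The operator `lap` as a functional of the second derivative. -/
def lapForm (Z : Pt n) (H : Pt n →L[ℝ] Pt n →L[ℝ] ℂ) : ℂ :=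
  let dd := fun u v : Pt n => (H v u + Complex.I * H v (Complex.I • u)
      - Complex.I * H (Complex.I • v) u + H (Complex.I • v) (Complex.I • u)) / 4
  let dd' := fun u v : Pt n => (H v u - Complex.I * H v (Complex.I • u)
      + Complex.I * H (Complex.I • v) u + H (Complex.I • v) (Complex.I • u)) / 4
  (rho Z : ℂ) *
    ((∑ j : Fin n, 2 * Complex.I * (conj (Z.1 j) * dd (ez j) ew - Z.1 j * dd' (ez j) ew))
      + 2 * Complex.I * (conj Z.2 * dd ew ew - Z.2 * dd' ew ew)
      + ∑ j : Fin n, dd (ez j) (ez j))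

lemma lap_eq_lapForm (hf : DifferentiableAt ℝ (fderiv ℝ f) Z) : lap f Z = lapForm Z (hess f Z) := by
  simp only [lap, lapForm, dW_dWbar hf, dWbar_dW hf]

end SecondDerivative

/-- The bilinear form polarising `β`. -/
def betaForm (n : ℕ) : Pt n →L[ℝ] Pt n →L[ℝ] ℝ :=
  ∑ j, (innerSL ℝ : ℂ →L[ℝ] ℂ →L[ℝ] ℝ).bilinearComp
    ((ContinuousLinearMap.proj j).comp (ContinuousLinearMap.fst ℝ (Fin n → ℂ) ℂ))
    ((ContinuousLinearMap.proj j).comp (ContinuousLinearMap.fst ℝ (Fin n → ℂ) ℂ))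

lemma betaForm_apply {n : ℕ} (p q : Pt n) :
    betaForm n p q = ∑ j, ((p.1 j).re * (q.1 j).re + (p.1 j).im * (q.1 j).im) := by
  simp only [betaForm, sum_apply]
  refine Finset.sum_congr rfl fun j _ => ?_
  simp [innerSL_apply_apply, Complex.inner]
  ring

lemma betaForm_comm {n : ℕ} (p q : Pt n) : betaForm n p q = betaForm n q p := by
  simp only [betaForm_apply, mul_comm]

lemma beta_eq_betaForm {n : ℕ} (Z : Pt n) : beta Z = betaForm n Z Z := by
  rw [betaForm_apply, beta]
  refine Finset.sum_congr rfl fun j _ => ?_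
  rw [Complex.sq_norm, Complex.normSq_apply]

lemma hasFDerivAt_beta {n : ℕ} (Z : Pt n) :
    HasFDerivAt (beta : Pt n → ℝ) ((2 : ℝ) • betaForm n Z) Z := by
  have h : (beta : Pt n → ℝ) = fun Z => betaForm n Z Z := funext beta_eq_betaForm
  rw [h]
  refine (((betaForm n).hasFDerivAt).clm_apply (hasFDerivAt_id Z)).congr_fderiv ?_
  ext v <;> simp [betaForm_comm _ Z] <;> ring

/-- The coordinates `(t, ρ, β)`. -/
def coords {n : ℕ} (Z : Pt n) : ℝ × ℝ × ℝ := (tt Z, rho Z, beta Z)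

/-- The derivative of `coords` at `Z` in the direction `q`. -/
def dcoords {n : ℕ} (Z q : Pt n) : ℝ × ℝ × ℝ :=
  (q.2.re, q.2.im - 2 * betaForm n Z q, 2 * betaForm n Z q)

lemma contDiff_beta {n : ℕ} {m : WithTop ℕ∞} : ContDiff ℝ m (beta : Pt n → ℝ) := by
  have h : (beta : Pt n → ℝ) = fun Z => betaForm n Z Z := funext beta_eq_betaForm
  rw [h]; fun_prop

lemma contDiff_rho {n : ℕ} {m : WithTop ℕ∞} : ContDiff ℝ m (rho : Pt n → ℝ) := by
  have : ContDiff ℝ m (fun Z : Pt n => Z.2.im) := Complex.imCLM.contDiff.comp contDiff_snd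
  exact this.sub contDiff_beta

lemma contDiff_coords {n : ℕ} {m : WithTop ℕ∞} : ContDiff ℝ m (coords : Pt n → ℝ × ℝ × ℝ) := by
  have : ContDiff ℝ m (fun Z : Pt n => Z.2.re) := Complex.reCLM.contDiff.comp contDiff_snd
  exact this.prodMk (contDiff_rho.prodMk contDiff_beta)

lemma fderiv_coords {n : ℕ} (Z q : Pt n) : fderiv ℝ coords Z q = dcoords Z q := by
  have h1 : HasFDerivAt (tt : Pt n → ℝ) (Complex.reCLM.comp (ContinuousLinearMap.snd ℝ _ ℂ)) Z :=
    (Complex.reCLM.comp (ContinuousLinearMap.snd ℝ (Fin n → ℂ) ℂ)).hasFDerivAt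
  have h2 : HasFDerivAt (fun Z : Pt n => Z.2.im)
      (Complex.imCLM.comp (ContinuousLinearMap.snd ℝ _ ℂ)) Z :=
    (Complex.imCLM.comp (ContinuousLinearMap.snd ℝ (Fin n → ℂ) ℂ)).hasFDerivAt
  have := h1.prodMk ((h2.sub (hasFDerivAt_beta Z)).prodMk (hasFDerivAt_beta Z))
  have e : fderiv ℝ coords Z = _ := HasFDerivAt.fderiv this
  rw [e]
  simp [dcoords]

/-- The second-order chain rule: `coords` is quadratic, and its constant second derivative has
entries 0, −2⟨p,q⟩, 2⟨p,q⟩ because β enters ρ with a minus sign. -/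
lemma hess_comp_coords {n : ℕ} {G : ℝ × ℝ × ℝ → ℂ} {Z : Pt n} (hG : ContDiffAt ℝ 2 G (coords Z))
    (p q : Pt n) : hess (G ∘ coords) Z p q =
      fderiv ℝ (fderiv ℝ G) (coords Z) (dcoords Z p) (dcoords Z q) +
        fderiv ℝ G (coords Z) (0, -(2 * betaForm n p q), 2 * betaForm n p q) := by
  have cc : ContDiffAt ℝ 2 (coords : Pt n → _) Z := contDiff_coords.contDiffAt
  have hf : DifferentiableAt ℝ (fderiv ℝ (G ∘ coords)) Z :=
    differentiableAt_fderiv_of_contDiffAt (hG.comp Z cc)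
  have h1 : HasFDerivAt (fun Z' => fderiv ℝ (G ∘ coords) Z' q) ((hess (G ∘ coords) Z).flip q) Z :=
    (hf.hasFDerivAt.clm_apply (hasFDerivAt_const q Z)).congr_fderiv (by ext <;> simp [hess])
  have hev : (fun Z' => fderiv ℝ (G ∘ coords) Z' q) =ᶠ[𝓝 Z]
      fun Z' => fderiv ℝ G (coords Z') (dcoords Z' q) := by
    have : ∀ᶠ p in 𝓝 (coords Z), ContDiffAt ℝ 2 G p := hG.eventually (by simp)
    filter_upwards [cc.continuousAt.eventually this] with Z' hZ'
    rw [fderiv_comp _ (hZ'.differentiableAt (by norm_num))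
      ((contDiff_coords (m := 2)).differentiable (by norm_num) Z'), ContinuousLinearMap.comp_apply,
      fderiv_coords]
  have hd : HasFDerivAt (fun Z' : Pt n => dcoords Z' q)
      ((0 : Pt n →L[ℝ] ℝ).prod ((-((2 : ℝ) • (betaForm n).flip q)).prod
        ((2 : ℝ) • (betaForm n).flip q))) Z := by
    have b : HasFDerivAt (fun Z' : Pt n => 2 * betaForm n Z' q) ((2 : ℝ) • (betaForm n).flip q) Z :=
      ((((betaForm n).flip q).hasFDerivAt).const_mul 2)
    exact (hasFDerivAt_const _ _).prodMk ((b.const_sub _).prodMk b)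
  have h2 := ((differentiableAt_fderiv_of_contDiffAt hG).hasFDerivAt.comp Z
    (cc.differentiableAt (by norm_num)).hasFDerivAt).clm_apply hd
  have e := h1.unique (h2.congr_of_eventuallyEq hev)
  have e' := congrArg (fun T => T p) e
  simp only [ContinuousLinearMap.flip_apply] at e'
  rw [e']
  simp [fderiv_coords]
  rw [add_comm]

lemma betaForm_ew {n : ℕ} (Z : Pt n) (c : ℂ) : betaForm n Z (c • ew) = 0 := by
  simp [betaForm_apply, ew]

lemma betaForm_ez {n : ℕ} (Z : Pt n) (c : ℂ) (j : Fin n) :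
    betaForm n Z (c • ez j) = (Z.1 j).re * c.re + (Z.1 j).im * c.im := by
  rw [betaForm_apply, Finset.sum_eq_single j]
  · simp [ez]
  · intro k _ hk
    simp [ez, hk]
  · simp

/-- Moving z_j changes ρ and β by opposite amounts, so only the direction ∂_β − ∂_ρ occurs. The sum
of the z_j-terms of first kind gives 2β(∂_ρ∂_β − ∂_ρ²), the Laplacian in z gives β(∂_β − ∂_ρ)² +
n(∂_β − ∂_ρ), and the z_{n+1}-term gives (ρ+β)(∂_t² + ∂_ρ²). The mixed derivatives cancel in the
total. -/
lemma lap_comp_coords {n : ℕ} {G : ℝ × ℝ × ℝ → ℂ} {Z : Pt n} (hG : ContDiffAt ℝ 2 G (coords Z)) :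
    lap (G ∘ coords) Z = rho Z * ((rho Z + beta Z) *
      fderiv ℝ (fderiv ℝ G) (coords Z) (1, 0, 0) (1, 0, 0) +
      rho Z * fderiv ℝ (fderiv ℝ G) (coords Z) (0, 1, 0) (0, 1, 0) +
      beta Z * fderiv ℝ (fderiv ℝ G) (coords Z) (0, 0, 1) (0, 0, 1) +
      n * (fderiv ℝ G (coords Z) (0, 0, 1) - fderiv ℝ G (coords Z) (0, 1, 0))) := by
  have hf : DifferentiableAt ℝ (fderiv ℝ (G ∘ coords)) Z :=
    differentiableAt_fderiv_of_contDiffAt (hG.comp Z contDiff_coords.contDiffAt)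
  rw [lap_eq_lapForm hf, lapForm]
  have hsymm : fderiv ℝ (fderiv ℝ G) (coords Z) (0, 1, 0) (0, 0, 1) =
      fderiv ℝ (fderiv ℝ G) (coords Z) (0, 0, 1) (0, 1, 0) :=
    (hG.isSymmSndFDerivAt (by simp)) _ _
  set D := fderiv ℝ (fderiv ℝ G) (coords Z) with hD
  set d := fderiv ℝ G (coords Z) with hd
  have c1 : dcoords Z ew = (1, 0, 0) := by
    have := betaForm_ew Z 1
    simp only [one_smul] at this
    simp only [dcoords, this]
    simp [ew]
  have c2 : dcoords Z (Complex.I • ew) = (0, 1, 0) := by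
    simp only [dcoords, betaForm_ew]
    simp [ew]
  have split : ∀ r : ℝ, ((0, -r, r) : ℝ × ℝ × ℝ) = r • ((0, 0, 1) - (0, 1, 0)) := by
    intro r; ext <;> simp
  have c3 : ∀ j, dcoords Z (ez j) = (2 * (Z.1 j).re) • ((0, 0, 1) - (0, 1, 0) : ℝ × ℝ × ℝ) := by
    intro j
    have := betaForm_ez Z 1 j
    simp only [one_smul] at this
    rw [← split]
    simp only [dcoords, this]
    simp [ez]
  have c4 : ∀ j, dcoords Z (Complex.I • ez j) =
      (2 * (Z.1 j).im) • ((0, 0, 1) - (0, 1, 0) : ℝ × ℝ × ℝ) := by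
    intro j
    rw [← split]
    simp only [dcoords, betaForm_ez]
    simp [ez]
  have b1 : betaForm n ew ew = 0 := by have := betaForm_ew (n := n) ew 1; simpa using this
  have b2 : betaForm n (Complex.I • ew) ew = 0 := by
    have := betaForm_ew (n := n) (Complex.I • ew) 1; simpa using this
  have b3 : ∀ (p : Pt n) (j : Fin n), betaForm n ew p = 0 := by
    intro p j; rw [betaForm_comm]; have := betaForm_ew (n := n) p 1; simpa using this
  have b4 : ∀ (p : Pt n) (j : Fin n), betaForm n (Complex.I • ew) p = 0 := by
    intro p j; rw [betaForm_comm, betaForm_ew]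
  have b5 : ∀ j, betaForm n (ez j) (ez j) = 1 := by
    intro j; have := betaForm_ez (n := n) (ez j) 1 j; simpa [ez] using this
  have b6 : ∀ j, betaForm n (ez j) (Complex.I • ez j) = 0 := by
    intro j; rw [betaForm_ez]; simp [ez]
  have b7 : ∀ j, betaForm n (Complex.I • ez j) (ez j) = 0 := by
    intro j; rw [betaForm_comm, b6]
  have b8 : ∀ j, betaForm n (Complex.I • ez j) (Complex.I • ez j) = 1 := by
    intro j; rw [betaForm_ez]; simp [ez]
  have z0 : ((0, 0, 0) : ℝ × ℝ × ℝ) = 0 := rfl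
  have hI := Complex.I_sq
  have S1 : ∀ j : Fin n, 2 * Complex.I * (conj (Z.1 j) *
      ((hess (G ∘ coords) Z ew (ez j) + Complex.I * hess (G ∘ coords) Z ew (Complex.I • ez j)
      - Complex.I * hess (G ∘ coords) Z (Complex.I • ew) (ez j) +
        hess (G ∘ coords) Z (Complex.I • ew) (Complex.I • ez j)) / 4) - Z.1 j *
      ((hess (G ∘ coords) Z ew (ez j) - Complex.I * hess (G ∘ coords) Z ew (Complex.I • ez j)
      + Complex.I * hess (G ∘ coords) Z (Complex.I • ew) (ez j) +
        hess (G ∘ coords) Z (Complex.I • ew) (Complex.I • ez j)) / 4)) =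
      (‖Z.1 j‖ ^ 2 : ℝ) * (2 * (D (0, 1, 0) (0, 0, 1) - D (0, 1, 0) (0, 1, 0))) := by
    intro j
    have hz : Z.1 j = (Z.1 j).re + (Z.1 j).im * Complex.I := (Complex.re_add_im _).symm
    have hzc : conj (Z.1 j) = (Z.1 j).re - (Z.1 j).im * Complex.I := by
      apply Complex.ext <;> simp
    have hn : ((‖Z.1 j‖ ^ 2 : ℝ) : ℂ) = (Z.1 j).re ^ 2 + (Z.1 j).im ^ 2 := by
      rw [Complex.sq_norm, Complex.normSq_apply]; push_cast; ring
    simp only [hess_comp_coords hG, ← hD, ← hd, c1, c2, c3, c4, b3 _ j, b4 _ j, mul_zero, neg_zero, z0,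
      map_zero, add_zero, map_smul, map_sub, Complex.real_smul]
    rw [hn, hzc]
    set a := (Z.1 j).re
    set b := (Z.1 j).im
    rw [hz]
    push_cast
    set A := D (0, 1, 0) (0, 0, 1) - D (0, 1, 0) (0, 1, 0)
    set B := D (1, 0, 0) (0, 0, 1) - D (1, 0, 0) (0, 1, 0)
    linear_combination (-2 * (a : ℂ) ^ 2 * A - 2 * b ^ 2 * A) * hI
  have S2 : ∀ j : Fin n, (hess (G ∘ coords) Z (ez j) (ez j) +
      Complex.I * hess (G ∘ coords) Z (ez j) (Complex.I • ez j)
      - Complex.I * hess (G ∘ coords) Z (Complex.I • ez j) (ez j) +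
        hess (G ∘ coords) Z (Complex.I • ez j) (Complex.I • ez j)) / 4 =
      (‖Z.1 j‖ ^ 2 : ℝ) * (D (0, 0, 1) (0, 0, 1) - D (0, 0, 1) (0, 1, 0) - D (0, 1, 0) (0, 0, 1) +
        D (0, 1, 0) (0, 1, 0)) + (d (0, 0, 1) - d (0, 1, 0)) := by
    intro j
    have hn : ((‖Z.1 j‖ ^ 2 : ℝ) : ℂ) = (Z.1 j).re ^ 2 + (Z.1 j).im ^ 2 := by
      rw [Complex.sq_norm, Complex.normSq_apply]; push_cast; ring
    simp only [hess_comp_coords hG, ← hD, ← hd, c3, c4, b5, b6, b7, b8, split, mul_zero, mul_one,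
      neg_zero, map_smul, map_sub, smul_apply, sub_apply,
      Complex.real_smul]
    rw [hn]
    push_cast
    ring
  simp only [S1, S2]
  rw [Finset.sum_add_distrib, ← Finset.sum_mul, ← Finset.sum_mul, ← Complex.ofReal_sum]
  have hb : ∑ j, ‖Z.1 j‖ ^ 2 = beta Z := rfl
  rw [hb]
  simp only [hess_comp_coords hG, ← hD, ← hd, c1, c2, b1, b2, betaForm_ew, mul_zero,
    neg_zero, z0, map_zero, add_zero]
  have hw : conj Z.2 - Z.2 = -2 * Complex.I * (rho Z + beta Z : ℝ) := by
    rw [← im_eq]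
    apply Complex.ext <;> simp
    ring
  have hw' : conj Z.2 + Z.2 = 2 * (Z.2.re : ℂ) := by
    apply Complex.ext <;> simp
    ring
  have hs' : D (0, 1, 0) (1, 0, 0) = D (1, 0, 0) (0, 1, 0) := (hG.isSymmSndFDerivAt (by simp)) _ _
  rw [hsymm, hs']
  simp only [Finset.sum_const, Finset.card_univ, Fintype.card_fin, nsmul_eq_mul]
  push_cast at hw ⊢
  set A := D (1, 0, 0) (1, 0, 0)
  set B := D (0, 1, 0) (0, 1, 0)
  -- The mixed t, ρ derivatives cancel by symmetry, and what remains is 2i(z̄ − z)/4 = Im z_{n+1}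
  -- times the Laplacian in t and ρ.
  have key : 2 * Complex.I * (conj Z.2 * ((A + Complex.I * D (1, 0, 0) (0, 1, 0) -
      Complex.I * D (1, 0, 0) (0, 1, 0) + B) / 4) - Z.2 * ((A - Complex.I * D (1, 0, 0) (0, 1, 0) +
      Complex.I * D (1, 0, 0) (0, 1, 0) + B) / 4)) = (rho Z + beta Z) * (A + B) := by
    linear_combination (Complex.I * (A + B) / 2) * hw - ((rho Z + beta Z) * (A + B)) * hI
  rw [key]
  ring

end UnitaryForms
end

/-! ### The operator on functions of invariants and of ρ/|cw+d|², β/|cw+d|² -/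

noncomputable section
namespace UnitaryForms

open Filter Topology

lemma HasDeriv2.of_eq {E : Type*} [NormedAddCommGroup E] [NormedSpace ℝ E] {x y : ℝ → E} {h₀ : ℝ}
    {x₁ x₂ y₁ y₂ : E} (h : HasDeriv2 x h₀ x₁ x₂) (e : ∀ h, y h = x h) (e₁ : y₁ = x₁) (e₂ : y₂ = x₂) :
    HasDeriv2 y h₀ y₁ y₂ := by
  rw [e₁, e₂, funext e]; exact h

/-- Along an affine line with direction e the one-variable derivatives are the first and second
directional derivatives in direction e. -/
lemma HasDeriv2.fderiv_eq {G : ℝ × ℝ × ℝ → ℂ} {p e : ℝ × ℝ × ℝ} {h₀ : ℝ} {c : ℝ → ℝ × ℝ × ℝ}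
    {φ₁ φ₂ : ℂ} (h : HasDeriv2 (fun h => G (c h)) h₀ φ₁ φ₂) (hG : ContDiffAt ℝ 2 G p)
    (hc : ∀ h, c h = p + (h - h₀) • e) :
    fderiv ℝ G p e = φ₁ ∧ fderiv ℝ (fderiv ℝ G) p e e = φ₂ := by
  obtain ⟨φ', h1, h2, h3⟩ := h
  have hcd : ∀ h, HasDerivAt c e h := by
    intro h
    rw [funext hc]
    simpa using (((hasDerivAt_id h).sub_const h₀).smul_const e).const_add p
  have c0 : c h₀ = p := by simp [hc]
  have hev : ∀ᶠ q in 𝓝 (c h₀), ContDiffAt ℝ 2 G q := by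
    rw [c0]; exact hG.eventually (by simp)
  have hev' := (hcd h₀).continuousAt.eventually hev
  have key : φ' =ᶠ[𝓝 h₀] fun h => fderiv ℝ G (c h) e := by
    filter_upwards [h1, hev'] with h hh hq
    exact hh.unique ((hq.differentiableAt (by norm_num)).hasFDerivAt.comp_hasDerivAt h (hcd h))
  have d2 : HasDerivAt (fun h => fderiv ℝ G (c h) e) (fderiv ℝ (fderiv ℝ G) p e e) h₀ := by
    have := (differentiableAt_fderiv_of_contDiffAt (c0 ▸ hG : ContDiffAt ℝ 2 G (c h₀))).hasFDerivAt
    have := (this.comp_hasDerivAt h₀ (hcd h₀)).clm_apply (hasDerivAt_const h₀ e)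
    simpa [c0] using this
  refine ⟨?_, ?_⟩
  · rw [← h2, key.self_of_nhds]
    simp only [c0]
  · exact d2.unique (h3.congr_of_eventuallyEq key.symm)

/-- `lap` of a function of two invariants. -/
lemma lap_of_thetaSystem {n : ℕ} {K : ℂ × ℂ → ℂ} {x y : ℝ × ℝ × ℝ → ℝ} {Z : Pt n} {f : Pt n → ℂ}
    {k₁ k₂ k₁₁ k₁₂ k₂₂ : ℂ} {xt xtt xr xrr xb xbb yt ytt yr yrr yb ybb : ℝ}
    (hf : f =ᶠ[𝓝 Z] fun Z => K ((x (coords Z) : ℂ), (y (coords Z) : ℂ)))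
    (hx : ContDiffAt ℝ 2 x (coords Z)) (hy : ContDiffAt ℝ 2 y (coords Z))
    (hK : ContDiffAt ℂ 2 K ((x (coords Z) : ℂ), (y (coords Z) : ℂ)))
    (hT : ThetaSystem K ((x (coords Z) : ℂ), (y (coords Z) : ℂ)) k₁ k₂ k₁₁ k₁₂ k₂₂)
    (x0 : x (coords Z) ≠ 0) (y0 : y (coords Z) ≠ 0)
    (hxt : HasDeriv2 (fun h => x (h, rho Z, beta Z)) (tt Z) xt xtt)
    (hxr : HasDeriv2 (fun h => x (tt Z, h, beta Z)) (rho Z) xr xrr)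
    (hxb : HasDeriv2 (fun h => x (tt Z, rho Z, h)) (beta Z) xb xbb)
    (hyt : HasDeriv2 (fun h => y (h, rho Z, beta Z)) (tt Z) yt ytt)
    (hyr : HasDeriv2 (fun h => y (tt Z, h, beta Z)) (rho Z) yr yrr)
    (hyb : HasDeriv2 (fun h => y (tt Z, rho Z, h)) (beta Z) yb ybb)
    {X Y gxx gxy gyy lx ly : ℝ} (hX : x (coords Z) = X) (hY : y (coords Z) = Y)
    (hgxx : rho Z * ((rho Z + beta Z) * xt ^ 2 + rho Z * xr ^ 2 + beta Z * xb ^ 2) = gxx)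
    (hgxy : rho Z * ((rho Z + beta Z) * (xt * yt) + rho Z * (xr * yr) + beta Z * (xb * yb)) = gxy)
    (hgyy : rho Z * ((rho Z + beta Z) * yt ^ 2 + rho Z * yr ^ 2 + beta Z * yb ^ 2) = gyy)
    (hlx : rho Z * ((rho Z + beta Z) * xtt + rho Z * xrr + beta Z * xbb + n * (xb - xr)) = lx)
    (hly : rho Z * ((rho Z + beta Z) * ytt + rho Z * yrr + beta Z * ybb + n * (yb - yr)) = ly) :
    lap f Z = k₁₁ * (gxx / X ^ 2) + 2 * k₁₂ * (gxy / (X * Y)) + k₂₂ * (gyy / Y ^ 2) +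
      k₁ * (lx / X - gxx / X ^ 2) + k₂ * (ly / Y - gyy / Y ^ 2) := by
  set G : ℝ × ℝ × ℝ → ℂ := fun p => K ((x p : ℂ), (y p : ℂ)) with hGdef
  have hG : ContDiffAt ℝ 2 G (coords Z) := by
    have cx : ContDiffAt ℝ 2 (fun p => ((x p : ℂ), (y p : ℂ))) (coords Z) :=
      (Complex.ofRealCLM.contDiff.contDiffAt.comp _ hx).prodMk
        (Complex.ofRealCLM.contDiff.contDiffAt.comp _ hy)
    exact ContDiffAt.comp (g := K) (coords Z) (hK.restrict_scalars ℝ) cx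
  rw [lap_congr hf]
  have e : (fun Z : Pt n => K ((x (coords Z) : ℂ), (y (coords Z) : ℂ))) = G ∘ coords := rfl
  rw [e, lap_comp_coords hG]
  -- The operator in t, ρ, β contains only pure second derivatives, so it is enough to follow the
  -- three lines parallel to the axes. The numbers `gxx`, `gxy`, `gyy` are the values of its symbol
  -- on dx and dy, and `lx`, `ly` are its values on x and y.
  have ct := (ThetaSystem.comp (x := fun h => x (h, rho Z, beta Z)) (y := fun h => y (h, rho Z, beta Z))
    (h₀ := tt Z) hT hxt hyt x0 y0).fderiv_eq (G := G) (e := (1, 0, 0))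
    (c := fun h => (h, rho Z, beta Z)) hG (fun h => by simp [coords])
  have cr := (ThetaSystem.comp (x := fun h => x (tt Z, h, beta Z)) (y := fun h => y (tt Z, h, beta Z))
    (h₀ := rho Z) hT hxr hyr x0 y0).fderiv_eq (G := G) (e := (0, 1, 0))
    (c := fun h => (tt Z, h, beta Z)) hG (fun h => by simp [coords])
  have cb := (ThetaSystem.comp (x := fun h => x (tt Z, rho Z, h)) (y := fun h => y (tt Z, rho Z, h))
    (h₀ := beta Z) hT hxb hyb x0 y0).fderiv_eq (G := G) (e := (0, 0, 1))
    (c := fun h => (tt Z, rho Z, h)) hG (fun h => by simp [coords])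
  have ec : (tt Z, rho Z, beta Z) = coords Z := rfl
  simp only [ec, hX, hY] at ct cr cb
  rw [ct.2, cr.2, cb.2, cr.1, cb.1]
  have X0 : (X : ℂ) ≠ 0 := by rw [← hX]; exact_mod_cast x0
  have Y0 : (Y : ℂ) ≠ 0 := by rw [← hY]; exact_mod_cast y0
  rw [← hgxx, ← hgxy, ← hgyy, ← hlx, ← hly]
  push_cast
  field_simp
  ring

lemma coords_fst {n : ℕ} (Z : Pt n) : (coords Z).1 = tt Z := rfl
lemma coords_snd_fst {n : ℕ} (Z : Pt n) : (coords Z).2.1 = rho Z := rfl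
lemma coords_snd_snd {n : ℕ} (Z : Pt n) : (coords Z).2.2 = beta Z := rfl

/-- `x(Z, Z') + ε y(Z)` as a function of the coordinates of `Z`. -/
def xCoord (ε t' v' : ℝ) (p : ℝ × ℝ × ℝ) : ℝ :=
  ((p.1 - t') ^ 2 + (p.2.1 + p.2.2 - v') ^ 2 + 4 * ε * v' * p.2.2) / (4 * p.2.1 * v')

lemma contDiffAt_xCoord (ε t' v' : ℝ) {p : ℝ × ℝ × ℝ} (hv : v' ≠ 0) (hp : p.2.1 ≠ 0) :
    ContDiffAt ℝ 2 (xCoord ε t' v') p := by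
  refine ContDiffAt.div (by fun_prop) (by fun_prop) ?_
  simp [hv, hp]

lemma xinv_add_eq {n : ℕ} {Z Z' : Pt n} (hZ : Z ∈ HH n) (hZ' : Z' ∈ HH n) (ε : ℝ) :
    xinv Z Z' + ε * yinv Z = xCoord ε (tt Z') Z'.2.im (coords Z) := by
  have h1 := (rho_pos hZ).ne'
  have h2 := (im_pos hZ').ne'
  rw [xCoord, xinv, yinv, coords_fst, coords_snd_fst, coords_snd_snd, ← im_eq Z']
  rw [show rho Z + beta Z - rho Z' - beta Z' = rho Z + beta Z - Z'.2.im by rw [im_eq Z']; ring]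
  field_simp

section XCoord
variable (ε t r b t' v' : ℝ)

lemma hasDeriv2_xCoord_t (hr : r ≠ 0) (hv : v' ≠ 0) :
    HasDeriv2 (fun h => xCoord ε t' v' (h, r, b)) t (2 * (t - t') / (4 * r * v')) (2 / (4 * r * v')) := by
  have := hasDeriv2_quadratic_div 1 (-2 * t') (t' ^ 2 + (r + b - v') ^ 2 + 4 * ε * v' * b) 0 0
    (4 * r * v') t (by simp [hr, hv])
  refine this.of_eq (fun h => ?_) ?_ ?_
  · simp only [xCoord]; congr 1 <;> ring
  · field_simp; ring
  · field_simp; ring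

lemma hasDeriv2_xCoord_r (hr : r ≠ 0) (hv : v' ≠ 0) :
    HasDeriv2 (fun h => xCoord ε t' v' (t, h, b)) r
      (1 / (4 * v') - ((t - t') ^ 2 + (b - v') ^ 2 + 4 * ε * v' * b) / (4 * v' * r ^ 2))
      (2 * ((t - t') ^ 2 + (b - v') ^ 2 + 4 * ε * v' * b) / (4 * v' * r ^ 3)) := by
  have := hasDeriv2_quadratic_div 1 (2 * (b - v')) ((t - t') ^ 2 + (b - v') ^ 2 + 4 * ε * v' * b) 0
    (4 * v') 0 r (by simp [hr, hv])
  refine this.of_eq (fun h => ?_) ?_ ?_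
  · simp only [xCoord]; congr 1 <;> ring
  · simp only [zero_mul, zero_add, add_zero, mul_zero]; field_simp; ring
  · simp only [zero_mul, zero_add, add_zero, mul_zero]; field_simp; ring

lemma hasDeriv2_xCoord_b (hr : r ≠ 0) (hv : v' ≠ 0) :
    HasDeriv2 (fun h => xCoord ε t' v' (t, r, h)) b
      ((2 * (r + b - v') + 4 * ε * v') / (4 * r * v')) (2 / (4 * r * v')) := by
  have := hasDeriv2_quadratic_div 1 (2 * (r - v') + 4 * ε * v') ((t - t') ^ 2 + (r - v') ^ 2) 0 0
    (4 * r * v') b (by simp [hr, hv])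
  refine this.of_eq (fun h => ?_) ?_ ?_
  · simp only [xCoord]; congr 1 <;> ring
  · field_simp; ring
  · field_simp; ring

end XCoord

lemma isOpen_HH (n : ℕ) : IsOpen (HH n) := by
  have e : HH n = {W | 0 < rho W} := by ext; exact mem_HH_iff
  rw [e]; exact isOpen_lt continuous_const (contDiff_rho (m := 0)).continuous

/-- `lap` of a function of `x` and `y`. -/
lemma lap_xy {n : ℕ} {K : ℂ × ℂ → ℂ} {Z Z' : Pt n} (hZ : Z ∈ HH n) (hZ' : Z' ∈ HH n) {f : Pt n → ℂ}
    {k₁ k₂ k₁₁ k₁₂ k₂₂ : ℂ} (hf : f =ᶠ[𝓝 Z] fun Z => K ((xinv Z Z' : ℂ), (yinv Z : ℂ)))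
    (hK : ContDiffAt ℂ 2 K ((xinv Z Z' : ℂ), (yinv Z : ℂ)))
    (hT : ThetaSystem K ((xinv Z Z' : ℂ), (yinv Z : ℂ)) k₁ k₂ k₁₁ k₁₂ k₂₂)
    (x0 : xinv Z Z' ≠ 0) (y0 : yinv Z ≠ 0) :
    lap f Z = k₁₁ + 2 * k₁₂ + k₂₂ + (n + 1) * (k₁ + k₂) + (xinv Z Z' : ℂ)⁻¹ * (k₁₁ + (1 - 1) * k₁) +
        (yinv Z : ℂ)⁻¹ * (k₂₂ + (n - 1) * k₂) := by
  have hr := (rho_pos hZ).ne'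
  have hv := (im_pos hZ').ne'
  have ex : ∀ {W : Pt n}, W ∈ HH n → xinv W Z' = xCoord 0 (tt Z') Z'.2.im (coords W) := fun hW => by
    have := xinv_add_eq hW hZ' 0; simpa using this
  have ey : ∀ W : Pt n, yinv W = (coords W).2.2 / (coords W).2.1 := fun W => rfl
  have ho : ∀ᶠ W in 𝓝 Z, W ∈ HH n := (isOpen_HH n).mem_nhds hZ
  have hf' : f =ᶠ[𝓝 Z] fun W => K ((xCoord 0 (tt Z') Z'.2.im (coords W) : ℂ),
      (((coords W).2.2 / (coords W).2.1 : ℝ) : ℂ)) := by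
    filter_upwards [hf, ho] with W h1 h2
    rw [h1, ex h2, ey]
  rw [ex hZ, ey] at hK hT
  rw [ex hZ] at x0
  rw [ey] at y0
  have hyr := hasDeriv2_quadratic_div 0 0 (beta Z) 0 1 0 (rho Z) (by simp [hr])
  have hyb := hasDeriv2_quadratic_div 0 1 0 0 0 (rho Z) (beta Z) (by simp [hr])
  -- The symbol takes the values x+x², xy, y+y², and L maps x, y to 1+(n+2)x and n+(n+2)y. All five
  -- are functions of x and y only, which is why L preserves functions of the invariants.
  have := lap_of_thetaSystem (y := fun p => p.2.2 / p.2.1) hf'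
    (contDiffAt_xCoord 0 (tt Z') Z'.2.im hv hr)
    (ContDiffAt.div (by fun_prop) (by fun_prop) hr) hK hT x0 y0
    (hasDeriv2_xCoord_t _ _ _ _ _ _ hr hv) (hasDeriv2_xCoord_r _ _ _ _ _ _ hr hv)
    (hasDeriv2_xCoord_b _ _ _ _ _ _ hr hv) (hasDeriv2_const (beta Z / rho Z) _)
    (hyr.of_eq (y₁ := -beta Z / rho Z ^ 2) (y₂ := 2 * beta Z / rho Z ^ 3)
      (fun h => by simp) (by simp; field_simp) (by simp))
    (hyb.of_eq (y₁ := 1 / rho Z) (y₂ := 0) (fun h => by simp) (by simp) (by simp))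
    (X := xinv Z Z') (Y := yinv Z) (gxx := xinv Z Z' + xinv Z Z' ^ 2) (gxy := xinv Z Z' * yinv Z)
    (gyy := yinv Z + yinv Z ^ 2) (lx := 1 + (n + 2) * xinv Z Z') (ly := n + (n + 2) * yinv Z)
    (ex hZ).symm (ey Z).symm ?_ ?_ ?_ ?_ ?_
  · rw [this]
    rw [← ex hZ] at x0
    have X0 : (xinv Z Z' : ℂ) ≠ 0 := by exact_mod_cast x0
    have Y0 : (yinv Z : ℂ) ≠ 0 := by exact_mod_cast y0
    push_cast
    field_simp
    ring
  all_goals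
    simp only [ey Z, ex hZ, xCoord, coords_fst, coords_snd_fst, coords_snd_snd]
    field_simp
    ring

/-- `lap` of a function of `x` (`ε = 0`) or of `x + y` (`ε = 1`). -/
lemma lap_x_add {n : ℕ} {K : ℂ × ℂ → ℂ} {Z Z' : Pt n} (hZ : Z ∈ HH n) (hZ' : Z' ∈ HH n) {f : Pt n → ℂ}
    {k₁ k₂ k₁₁ k₁₂ k₂₂ : ℂ} {ε : ℝ} (hε : ε = 0 ∨ ε = 1)
    (hf : f =ᶠ[𝓝 Z] fun Z => K (((xinv Z Z' + ε * yinv Z : ℝ) : ℂ), 1))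
    (hK : ContDiffAt ℂ 2 K (((xinv Z Z' + ε * yinv Z : ℝ) : ℂ), 1))
    (hT : ThetaSystem K (((xinv Z Z' + ε * yinv Z : ℝ) : ℂ), 1) k₁ k₂ k₁₁ k₁₂ k₂₂)
    (x0 : xinv Z Z' + ε * yinv Z ≠ 0) :
    lap f Z = k₁₁ + (n + 1) * k₁ +
      ((xinv Z Z' + ε * yinv Z : ℝ) : ℂ)⁻¹ * (k₁₁ + (1 + ε * n - 1) * k₁) := by
  have hr := (rho_pos hZ).ne'
  have hv := (im_pos hZ').ne'
  have hf' : f =ᶠ[𝓝 Z] fun W => K ((xCoord ε (tt Z') Z'.2.im (coords W) : ℂ), ((1 : ℝ) : ℂ)) := by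
    filter_upwards [hf, (isOpen_HH n).mem_nhds hZ] with W h1 h2
    rw [h1, xinv_add_eq h2 hZ', Complex.ofReal_one]
  have X0 : ((xinv Z Z' + ε * yinv Z : ℝ) : ℂ) ≠ 0 := by exact_mod_cast x0
  have hX : xCoord ε (tt Z') Z'.2.im (coords Z) = xinv Z Z' + ε * yinv Z := (xinv_add_eq hZ hZ' ε).symm
  set X := xinv Z Z' + ε * yinv Z with hXdef
  rw [← hX] at hK hT x0
  rw [← Complex.ofReal_one] at hK hT
  -- The second variable is frozen at 1. For X = x+εy the symbol is x+x² + 2εxy + ε²(y+y²), and this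
  -- equals X+X² exactly because ε² = ε.
  have := lap_of_thetaSystem (y := fun _ => 1) hf'
    (contDiffAt_xCoord ε (tt Z') Z'.2.im hv hr) contDiffAt_const hK hT x0 one_ne_zero
    (hasDeriv2_xCoord_t _ _ _ _ _ _ hr hv) (hasDeriv2_xCoord_r _ _ _ _ _ _ hr hv)
    (hasDeriv2_xCoord_b _ _ _ _ _ _ hr hv) (hasDeriv2_const _ _) (hasDeriv2_const _ _)
    (hasDeriv2_const _ _) (X := X) (Y := 1) (gxx := X + X ^ 2) (gxy := 0)
    (gyy := 0) (lx := 1 + ε * n + (n + 2) * X) (ly := 0) hX rfl ?_ (by ring) (by ring) ?_ (by ring)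
  · rw [this]
    push_cast
    field_simp
    ring
  all_goals
    rw [← hX]
    simp only [xCoord, coords_fst, coords_snd_fst, coords_snd_snd]
    rcases hε with rfl | rfl
    all_goals
      field_simp
      ring

lemma hasDeriv2_linear_div {D : ℝ → ℝ} {β γ a b c h₀ D₀ D₁ D₂ : ℝ}
    (hD : ∀ h, D h = a * h ^ 2 + b * h + c) (e₀ : D h₀ = D₀) (e₁ : 2 * a * h₀ + b = D₁)
    (e₂ : 2 * a = D₂) (hne : D₀ ≠ 0) :
    HasDeriv2 (fun h => (β * h + γ) / D h) h₀ (β / D₀ - (β * h₀ + γ) * D₁ / D₀ ^ 2)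
      (-2 * β * D₁ / D₀ ^ 2 - (β * h₀ + γ) * D₂ / D₀ ^ 2 + 2 * (β * h₀ + γ) * D₁ ^ 2 / D₀ ^ 3) := by
  have e₀' : a * h₀ ^ 2 + b * h₀ + c = D₀ := by rw [← hD, e₀]
  have := hasDeriv2_quadratic_div 0 β γ a b c h₀ (by rw [e₀']; exact hne)
  rw [e₀', e₁, e₂] at this
  refine this.of_eq (fun h => by rw [hD]; simp) ?_ ?_
  · ring
  · ring

/-- `|c z_{n+1} + d|²` in the coordinates `t, ρ, β`. -/
def slashDen (c d : ℝ) (p : ℝ × ℝ × ℝ) : ℝ := (c * p.1 + d) ^ 2 + c ^ 2 * (p.2.1 + p.2.2) ^ 2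

/-- `lap` of a function of `ρ / |c z_{n+1} + d|²` and `β / |c z_{n+1} + d|²`. -/
lemma lap_slash {n : ℕ} {K : ℂ × ℂ → ℂ} {Z : Pt n} (hZ : Z ∈ HH n) {c d : ℝ}
    (hcd : slashDen c d (coords Z) ≠ 0) {f : Pt n → ℂ} {k₁ k₂ k₁₁ k₁₂ k₂₂ : ℂ}
    (hf : f =ᶠ[𝓝 Z] fun Z => K (((rho Z / slashDen c d (coords Z) : ℝ) : ℂ),
      ((beta Z / slashDen c d (coords Z) : ℝ) : ℂ)))
    (hK : ContDiffAt ℂ 2 K (((rho Z / slashDen c d (coords Z) : ℝ) : ℂ),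
      ((beta Z / slashDen c d (coords Z) : ℝ) : ℂ)))
    (hT : ThetaSystem K (((rho Z / slashDen c d (coords Z) : ℝ) : ℂ),
      ((beta Z / slashDen c d (coords Z) : ℝ) : ℂ)) k₁ k₂ k₁₁ k₁₂ k₂₂)
    (b0 : beta Z ≠ 0) :
    lap f Z = k₁₁ - (n + 1) * k₁ + rho Z / beta Z * (k₂₂ + (n - 1) * k₂) := by
  have hr := (rho_pos hZ).ne'
  have cD : ContDiffAt ℝ 2 (slashDen c d) (coords Z) := by unfold slashDen; fun_prop
  set D := slashDen c d (coords Z) with hD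
  have X0 : rho Z / D ≠ 0 := div_ne_zero hr hcd
  have Y0 : beta Z / D ≠ 0 := div_ne_zero b0 hcd
  have ht : ∀ h, slashDen c d (h, rho Z, beta Z) =
      c ^ 2 * h ^ 2 + 2 * c * d * h + (d ^ 2 + c ^ 2 * (rho Z + beta Z) ^ 2) := by
    intro h; simp only [slashDen]; ring
  have hρ : ∀ h, slashDen c d (tt Z, h, beta Z) =
      c ^ 2 * h ^ 2 + 2 * c ^ 2 * beta Z * h + ((c * tt Z + d) ^ 2 + c ^ 2 * beta Z ^ 2) := by
    intro h; simp only [slashDen]; ring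
  have hβ : ∀ h, slashDen c d (tt Z, rho Z, h) =
      c ^ 2 * h ^ 2 + 2 * c ^ 2 * rho Z * h + ((c * tt Z + d) ^ 2 + c ^ 2 * rho Z ^ 2) := by
    intro h; simp only [slashDen]; ring
  have e1 : 2 * c ^ 2 * tt Z + 2 * c * d = 2 * c * (c * tt Z + d) := by ring
  have e2 : 2 * c ^ 2 * rho Z + 2 * c ^ 2 * beta Z = 2 * c ^ 2 * (rho Z + beta Z) := by ring
  have e3 : 2 * c ^ 2 * beta Z + 2 * c ^ 2 * rho Z = 2 * c ^ 2 * (rho Z + beta Z) := by ring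
  -- The symbol and the values of L agree in form with those for the pair (ρ, β), that is for c = 0,
  -- d = 1, as the invariance of L predicts.
  have := lap_of_thetaSystem (x := fun p => p.2.1 / slashDen c d p)
    (y := fun p => p.2.2 / slashDen c d p) hf
    (ContDiffAt.div (by fun_prop) cD hcd) (ContDiffAt.div (by fun_prop) cD hcd) hK hT X0 Y0
    ((hasDeriv2_linear_div (β := 0) (γ := rho Z) ht hD.symm e1 rfl hcd).of_eq (fun h => by simp) rfl rfl)
    ((hasDeriv2_linear_div (β := 1) (γ := 0) hρ hD.symm e2 rfl hcd).of_eq (fun h => by simp) rfl rfl)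
    ((hasDeriv2_linear_div (β := 0) (γ := rho Z) hβ hD.symm e3 rfl hcd).of_eq (fun h => by simp) rfl rfl)
    ((hasDeriv2_linear_div (β := 0) (γ := beta Z) ht hD.symm e1 rfl hcd).of_eq (fun h => by simp) rfl rfl)
    ((hasDeriv2_linear_div (β := 0) (γ := beta Z) hρ hD.symm e2 rfl hcd).of_eq (fun h => by simp) rfl rfl)
    ((hasDeriv2_linear_div (β := 1) (γ := 0) hβ hD.symm e3 rfl hcd).of_eq (fun h => by simp) rfl rfl)
    (X := rho Z / D) (Y := beta Z / D) (gxx := (rho Z / D) ^ 2) (gxy := 0)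
    (gyy := rho Z / D * (beta Z / D)) (lx := -n * (rho Z / D)) (ly := n * (rho Z / D)) rfl rfl
    ?_ ?_ ?_ ?_ ?_
  · rw [this]
    have R0 : (rho Z : ℂ) ≠ 0 := by exact_mod_cast hr
    have B0 : (beta Z : ℂ) ≠ 0 := by exact_mod_cast b0
    have D0 : (D : ℂ) ≠ 0 := by exact_mod_cast hcd
    push_cast
    field_simp
    ring
  all_goals
    have hD' : D = (c * tt Z + d) ^ 2 + c ^ 2 * (rho Z + beta Z) ^ 2 := rfl
    clear_value D
    field_simp
    rw [hD']
    ring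

/-- `lap` of a function of `ρ / |c z_{n+1} + d|²`. -/
lemma lap_slash_rho {n : ℕ} {K : ℂ × ℂ → ℂ} {Z : Pt n} (hZ : Z ∈ HH n) {c d : ℝ}
    (hcd : slashDen c d (coords Z) ≠ 0) {f : Pt n → ℂ} {k₁ k₂ k₁₁ k₁₂ k₂₂ : ℂ}
    (hf : f =ᶠ[𝓝 Z] fun Z => K (((rho Z / slashDen c d (coords Z) : ℝ) : ℂ), 1))
    (hK : ContDiffAt ℂ 2 K (((rho Z / slashDen c d (coords Z) : ℝ) : ℂ), 1))
    (hT : ThetaSystem K (((rho Z / slashDen c d (coords Z) : ℝ) : ℂ), 1) k₁ k₂ k₁₁ k₁₂ k₂₂) :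
    lap f Z = k₁₁ - (n + 1) * k₁ := by
  have hr := (rho_pos hZ).ne'
  have cD : ContDiffAt ℝ 2 (slashDen c d) (coords Z) := by unfold slashDen; fun_prop
  set D := slashDen c d (coords Z) with hD
  have X0 : rho Z / D ≠ 0 := div_ne_zero hr hcd
  have ht : ∀ h, slashDen c d (h, rho Z, beta Z) =
      c ^ 2 * h ^ 2 + 2 * c * d * h + (d ^ 2 + c ^ 2 * (rho Z + beta Z) ^ 2) := by
    intro h; simp only [slashDen]; ring
  have hρ : ∀ h, slashDen c d (tt Z, h, beta Z) =
      c ^ 2 * h ^ 2 + 2 * c ^ 2 * beta Z * h + ((c * tt Z + d) ^ 2 + c ^ 2 * beta Z ^ 2) := by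
    intro h; simp only [slashDen]; ring
  have hβ : ∀ h, slashDen c d (tt Z, rho Z, h) =
      c ^ 2 * h ^ 2 + 2 * c ^ 2 * rho Z * h + ((c * tt Z + d) ^ 2 + c ^ 2 * rho Z ^ 2) := by
    intro h; simp only [slashDen]; ring
  have e1 : 2 * c ^ 2 * tt Z + 2 * c * d = 2 * c * (c * tt Z + d) := by ring
  have e2 : 2 * c ^ 2 * rho Z + 2 * c ^ 2 * beta Z = 2 * c ^ 2 * (rho Z + beta Z) := by ring
  have e3 : 2 * c ^ 2 * beta Z + 2 * c ^ 2 * rho Z = 2 * c ^ 2 * (rho Z + beta Z) := by ring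
  rw [← Complex.ofReal_one] at hK hT
  -- Freezing the second variable avoids division by β, so the computation also holds on the axis z
  -- = 0.
  have := lap_of_thetaSystem (x := fun p => p.2.1 / slashDen c d p) (y := fun _ => 1)
    (by simp only [Complex.ofReal_one]; exact hf) (ContDiffAt.div (by fun_prop) cD hcd) contDiffAt_const hK hT X0 one_ne_zero
    ((hasDeriv2_linear_div (β := 0) (γ := rho Z) ht hD.symm e1 rfl hcd).of_eq (fun h => by simp) rfl rfl)
    ((hasDeriv2_linear_div (β := 1) (γ := 0) hρ hD.symm e2 rfl hcd).of_eq (fun h => by simp) rfl rfl)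
    ((hasDeriv2_linear_div (β := 0) (γ := rho Z) hβ hD.symm e3 rfl hcd).of_eq (fun h => by simp) rfl rfl)
    (hasDeriv2_const _ _) (hasDeriv2_const _ _) (hasDeriv2_const _ _)
    (X := rho Z / D) (Y := 1) (gxx := (rho Z / D) ^ 2) (gxy := 0)
    (gyy := 0) (lx := -n * (rho Z / D)) (ly := 0) rfl rfl
    ?_ (by ring) (by ring) ?_ (by ring)
  · rw [this]
    have R0 : (rho Z : ℂ) ≠ 0 := by exact_mod_cast hr
    have D0 : (D : ℂ) ≠ 0 := by exact_mod_cast hcd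
    push_cast
    field_simp
    ring
  all_goals
    have hD' : D = (c * tt Z + d) ^ 2 + c ^ 2 * (rho Z + beta Z) ^ 2 := rfl
    clear_value D
    field_simp
    rw [hD']
    ring

end UnitaryForms
end

noncomputable section
namespace UnitaryForms

open Filter Topology

/-! ### Series of functions from a compact family -/

/-- Uniform bounds for a family of functions over a compact parameter set. -/
lemma exists_uniform_bound {P E F : Type*} [NormedAddCommGroup P] [NormedAddCommGroup E]
    [NormedAddCommGroup F] {G : P × E → F} {W : Set (P × E)} (hW : IsOpen W)
    (hG : ContinuousOn G W) {K : Set P} (hK : IsCompact K) {Z₀ : E} (hKW : ∀ p ∈ K, (p, Z₀) ∈ W) :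
    ∃ ε > 0, ∃ M ≥ 0, ∀ p ∈ K, ∀ Z ∈ Metric.ball Z₀ ε, (p, Z) ∈ W ∧ ‖G (p, Z)‖ ≤ M := by
  have hK2 : IsCompact (K ×ˢ ({Z₀} : Set E)) := hK.prod isCompact_singleton
  have hsub : K ×ˢ ({Z₀} : Set E) ⊆ W := by
    rintro ⟨p, Z⟩ ⟨hp, rfl⟩; exact hKW p hp
  obtain ⟨M, hM⟩ := (hK2.image_of_continuousOn (hG.norm.mono hsub)).bddAbove
  have ho : IsOpen (W ∩ (fun q => ‖G q‖) ⁻¹' Set.Iio (max M 0 + 1)) :=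
    hG.norm.isOpen_inter_preimage hW isOpen_Iio
  -- The bound is an open condition that holds along the compact slice over Z₀; the tube lemma makes
  -- the neighbourhood of Z₀ independent of the parameter.
  obtain ⟨u, v, -, hv, hu', hv', huv⟩ := generalized_tube_lemma hK isCompact_singleton ho
    (fun q hq => ⟨hsub hq, lt_of_le_of_lt (hM (Set.mem_image_of_mem _ hq))
      (by have := le_max_left M 0; linarith)⟩)
  obtain ⟨ε, ε0, hε⟩ := Metric.isOpen_iff.1 hv Z₀ (hv' rfl)
  refine ⟨ε, ε0, max M 0 + 1, by positivity, fun p hp Z hZ => ?_⟩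
  obtain ⟨h1, h2⟩ := huv (Set.mk_mem_prod (hu' hp) (hε hZ))
  exact ⟨h1, le_of_lt h2⟩

section ContinuousFamily
variable {P E F : Type*} [NormedAddCommGroup P] [NormedAddCommGroup E]
  [NormedAddCommGroup F] [NormedSpace ℝ F] [CompleteSpace F] {Ψ : P × E → F} {W : Set (P × E)}
  {K : Set P} {Z₀ : E} {ι : Type*} {c : ι → ℝ} {p : ι → P}

lemma summable_family (hW : IsOpen W) (hΨ : ContinuousOn Ψ W) (hK : IsCompact K)
    (hKW : ∀ p ∈ K, (p, Z₀) ∈ W) (hc : Summable fun i => |c i|) (hp : ∀ i, p i ∈ K) :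
    Summable (fun i => c i • Ψ (p i, Z₀)) := by
  obtain ⟨ε, ε0, M, M0, hM⟩ := exists_uniform_bound hW hΨ hK hKW
  refine Summable.of_norm_bounded (hc.mul_right M) fun i => ?_
  rw [norm_smul]
  gcongr
  · exact le_rfl
  · exact (hM _ (hp i) _ (Metric.mem_ball_self ε0)).2

lemma eventually_mem_family (hW : IsOpen W) (hK : IsCompact K) (hKW : ∀ p ∈ K, (p, Z₀) ∈ W) :
    ∀ᶠ Z in 𝓝 Z₀, ∀ p ∈ K, (p, Z) ∈ W := by
  obtain ⟨ε, ε0, M, M0, hM⟩ := exists_uniform_bound (G := fun _ => (0 : ℝ)) hW continuousOn_const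
    hK hKW
  filter_upwards [Metric.ball_mem_nhds Z₀ ε0] with Z hZ p hp using (hM p hp Z hZ).1

lemma continuousAt_tsum_family (hW : IsOpen W) (hΨ : ContinuousOn Ψ W)
    (hK : IsCompact K) (hKW : ∀ p ∈ K, (p, Z₀) ∈ W) (hc : Summable fun i => |c i|)
    (hp : ∀ i, p i ∈ K) : ContinuousAt (fun Z => ∑' i, c i • Ψ (p i, Z)) Z₀ := by
  obtain ⟨ε, ε0, M, M0, hM⟩ := exists_uniform_bound hW hΨ hK hKW
  refine ContinuousOn.continuousAt (s := Metric.ball Z₀ ε)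
    (continuousOn_tsum (fun i => ?_) (hc.mul_right M) fun i Z hZ => ?_) (Metric.ball_mem_nhds Z₀ ε0)
  · exact (hΨ.comp (f := fun Z => (p i, Z)) (by fun_prop)
      fun Z hZ => (hM _ (hp i) Z hZ).1).const_smul (c i)
  · rw [norm_smul]
    gcongr
    · exact le_rfl
    · exact (hM _ (hp i) Z hZ).2

end ContinuousFamily

section Family
variable {P E F : Type*} [NormedAddCommGroup P] [NormedSpace ℝ P] [NormedAddCommGroup E]
  [NormedSpace ℝ E] [NormedAddCommGroup F] [NormedSpace ℝ F]

lemma hasFDerivAt_slice {G : P × E → F} {p : P} {Z : E} (h : DifferentiableAt ℝ G (p, Z)) :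
    HasFDerivAt (fun Z => G (p, Z))
      ((fderiv ℝ G (p, Z)).comp (ContinuousLinearMap.inr ℝ P E)) Z :=
  h.hasFDerivAt.comp Z (hasFDerivAt_prodMk_right p Z)

/-- The derivative of a family of functions, as a family of functions. -/
def sliceDeriv (G : P × E → F) (q : P × E) : E →L[ℝ] F :=
  (fderiv ℝ G q).comp (ContinuousLinearMap.inr ℝ P E)

lemma contDiffOn_sliceDeriv {G : P × E → F} {W : Set (P × E)} (hW : IsOpen W) {m k : WithTop ℕ∞}
    (hG : ContDiffOn ℝ m G W) (hk : k + 1 ≤ m) : ContDiffOn ℝ k (sliceDeriv G) W :=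
  (hG.fderiv_of_isOpen hW hk).clm_comp contDiffOn_const

variable [CompleteSpace F] {Ψ : P × E → F} {W : Set (P × E)} {K : Set P} {Z₀ : E} {ι : Type*}
  {c : ι → ℝ} {p : ι → P}

/-- Termwise differentiation of a series over a compact family. -/
lemma eventually_hasFDerivAt_tsum_family (hW : IsOpen W) (hΨ : ContDiffOn ℝ 1 Ψ W)
    (hK : IsCompact K) (hKW : ∀ p ∈ K, (p, Z₀) ∈ W) (hc : Summable fun i => |c i|)
    (hp : ∀ i, p i ∈ K) :
    ∀ᶠ Z in 𝓝 Z₀, HasFDerivAt (fun Z => ∑' i, c i • Ψ (p i, Z))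
      (∑' i, c i • sliceDeriv Ψ (p i, Z)) Z := by
  obtain ⟨ε, ε0, M, M0, hM⟩ := exists_uniform_bound hW
    (contDiffOn_sliceDeriv hW hΨ (k := 0) (by norm_num)).continuousOn hK hKW
  have hZB := Metric.mem_ball_self (x := Z₀) ε0
  filter_upwards [Metric.isOpen_ball.mem_nhds hZB] with Z hZ
  have h0 := summable_family hW hΨ.continuousOn hK hKW hc hp
  have h1 : ∀ i, ∀ Z ∈ Metric.ball Z₀ ε, HasFDerivAt (fun Z => c i • Ψ (p i, Z))
      (c i • sliceDeriv Ψ (p i, Z)) Z := fun i Z hZ => by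
    have hd : DifferentiableAt ℝ Ψ (p i, Z) :=
      (hΨ.contDiffAt (hW.mem_nhds (hM _ (hp i) Z hZ).1)).differentiableAt (by norm_num)
    exact (hasFDerivAt_slice hd).fun_const_smul (c i)
  have h2 : ∀ i, ∀ Z ∈ Metric.ball Z₀ ε, ‖c i • sliceDeriv Ψ (p i, Z)‖ ≤ |c i| * M :=
    fun i Z hZ => by
      rw [norm_smul, Real.norm_eq_abs]
      exact mul_le_mul_of_nonneg_left (hM _ (hp i) Z hZ).2 (abs_nonneg _)
  exact hasFDerivAt_tsum_of_isPreconnected (hc.mul_right M) Metric.isOpen_ball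
    (convex_ball Z₀ ε).isPreconnected h1 h2 hZB h0 hZ

lemma contDiffAt_one_tsum_family (hW : IsOpen W) (hΨ : ContDiffOn ℝ 1 Ψ W)
    (hK : IsCompact K) (hKW : ∀ p ∈ K, (p, Z₀) ∈ W) (hc : Summable fun i => |c i|)
    (hp : ∀ i, p i ∈ K) : ContDiffAt ℝ 1 (fun Z => ∑' i, c i • Ψ (p i, Z)) Z₀ := by
  have h1 := (eventually_hasFDerivAt_tsum_family hW hΨ hK hKW hc hp).and
    (eventually_mem_family hW hK hKW)
  obtain ⟨U, hU, hUo, hZU⟩ := eventually_nhds_iff.1 h1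
  refine ContDiffOn.contDiffAt (s := U) ?_ (hUo.mem_nhds hZU)
  rw [show (1 : WithTop ℕ∞) = 0 + 1 from rfl, contDiffOn_succ_iff_fderiv_of_isOpen hUo]
  refine ⟨fun Z hZ => (hU Z hZ).1.differentiableAt.differentiableWithinAt, by simp, ?_⟩
  rw [contDiffOn_zero]
  refine ContinuousOn.congr (f := fun Z => ∑' i, c i • sliceDeriv Ψ (p i, Z)) (fun Z hZ => ?_)
    fun Z hZ => (hU Z hZ).1.fderiv
  exact (continuousAt_tsum_family hW (contDiffOn_sliceDeriv hW hΨ (k := 0)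
    (by norm_num)).continuousOn hK (hU Z hZ).2 hc hp).continuousWithinAt

/-- A series `∑ cᵢ Ψ(pᵢ, Z)` with `cᵢ` summable and `pᵢ` in a compact set can be differentiated
twice term by term. -/
lemma contDiffAt_tsum_family (hW : IsOpen W) (hΨ : ContDiffOn ℝ 2 Ψ W)
    (hK : IsCompact K) (hKW : ∀ p ∈ K, (p, Z₀) ∈ W) (hc : Summable fun i => |c i|)
    (hp : ∀ i, p i ∈ K) : ContDiffAt ℝ 2 (fun Z => ∑' i, c i • Ψ (p i, Z)) Z₀ := by
  have h1 := (eventually_hasFDerivAt_tsum_family hW (hΨ.of_le (by norm_num)) hK hKW hc hp).and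
    (eventually_mem_family hW hK hKW)
  obtain ⟨U, hU, hUo, hZU⟩ := eventually_nhds_iff.1 h1
  refine ContDiffOn.contDiffAt (s := U) ?_ (hUo.mem_nhds hZU)
  rw [show (2 : WithTop ℕ∞) = 1 + 1 from by norm_num, contDiffOn_succ_iff_fderiv_of_isOpen hUo]
  refine ⟨fun Z hZ => (hU Z hZ).1.differentiableAt.differentiableWithinAt, by simp, ?_⟩
  refine ContDiffOn.congr (f := fun Z => ∑' i, c i • sliceDeriv Ψ (p i, Z)) (fun Z hZ => ?_)
    fun Z hZ => (hU Z hZ).1.fderiv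
  exact (contDiffAt_one_tsum_family hW (contDiffOn_sliceDeriv hW hΨ (k := 1)
    (by norm_num)) hK (hU Z hZ).2 hc hp).contDiffWithinAt

/-- The derivative `sliceDeriv Ψ` is a family over the same compact set, so the first-order result
applies to it once more. -/
lemma fderiv_fderiv_tsum_family (hW : IsOpen W) (hΨ : ContDiffOn ℝ 2 Ψ W)
    (hK : IsCompact K) (hKW : ∀ p ∈ K, (p, Z₀) ∈ W) (hc : Summable fun i => |c i|)
    (hp : ∀ i, p i ∈ K) :
    HasSum (fun i => fderiv ℝ (fderiv ℝ fun Z => c i • Ψ (p i, Z)) Z₀)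
      (fderiv ℝ (fderiv ℝ fun Z => ∑' i, c i • Ψ (p i, Z)) Z₀) := by
  have h1 := (eventually_hasFDerivAt_tsum_family hW (hΨ.of_le (by norm_num)) hK hKW hc hp)
  have hs := contDiffOn_sliceDeriv hW hΨ (k := 1) (by norm_num)
  have h2 := (eventually_hasFDerivAt_tsum_family hW hs hK hKW hc hp).self_of_nhds
  have e : fderiv ℝ (fun Z => ∑' i, c i • Ψ (p i, Z)) =ᶠ[𝓝 Z₀]
      fun Z => ∑' i, c i • sliceDeriv Ψ (p i, Z) := h1.mono fun Z hZ => hZ.fderiv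
  rw [e.fderiv_eq, h2.fderiv]
  have h3 := (summable_family hW (contDiffOn_sliceDeriv hW hs (k := 0)
    (by norm_num)).continuousOn hK hKW hc hp).hasSum
  convert! h3 using 2 with i
  have ei : fderiv ℝ (fun Z => c i • Ψ (p i, Z)) =ᶠ[𝓝 Z₀]
      fun Z => c i • sliceDeriv Ψ (p i, Z) := by
    filter_upwards [eventually_mem_family hW hK hKW] with Z hZ
    exact ((hasFDerivAt_slice ((hΨ.contDiffAt (hW.mem_nhds (hZ _ (hp i)))).differentiableAt
      (by norm_num))).const_smul (c i)).fderiv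
  rw [ei.fderiv_eq]
  exact ((hasFDerivAt_slice ((hs.contDiffAt (hW.mem_nhds (hKW _ (hp i)))).differentiableAt
      (by norm_num))).const_smul (c i)).fderiv

end Family

/-- `lap` as a continuous linear functional of the second derivative. -/
lemma hasSum_lapForm {n : ℕ} {ι : Type*} {H : ι → Pt n →L[ℝ] Pt n →L[ℝ] ℂ}
    {S : Pt n →L[ℝ] Pt n →L[ℝ] ℂ} (h : HasSum H S) (Z : Pt n) :
    HasSum (fun i => lapForm Z (H i)) (lapForm Z S) := by
  have ha : ∀ u v, HasSum (fun i => H i u v) (S u v) := fun u v =>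
    (h.mapL (ContinuousLinearMap.apply ℝ _ u)).mapL (ContinuousLinearMap.apply ℝ _ v)
  simp only [lapForm]
  refine HasSum.mul_left _ (HasSum.add (HasSum.add (hasSum_sum fun j _ => ?_) ?_)
    (hasSum_sum fun j _ => ?_))
  · refine HasSum.mul_left _ (HasSum.sub (HasSum.mul_left _ ?_) (HasSum.mul_left _ ?_))
    · exact ((((ha _ _).add ((ha _ _).mul_left _)).sub ((ha _ _).mul_left _)).add (ha _ _)).div_const _
    · exact ((((ha _ _).sub ((ha _ _).mul_left _)).add ((ha _ _).mul_left _)).add (ha _ _)).div_const _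
  · refine HasSum.mul_left _ (HasSum.sub (HasSum.mul_left _ ?_) (HasSum.mul_left _ ?_))
    · exact ((((ha _ _).add ((ha _ _).mul_left _)).sub ((ha _ _).mul_left _)).add (ha _ _)).div_const _
    · exact ((((ha _ _).sub ((ha _ _).mul_left _)).add ((ha _ _).mul_left _)).add (ha _ _)).div_const _
  · exact ((((ha _ _).add ((ha _ _).mul_left _)).sub ((ha _ _).mul_left _)).add (ha _ _)).div_const _

/-- A series over a compact family whose terms are eigenfunctions of `lap` at `Z₀`. -/
lemma tsum_family_lap {n : ℕ} {P : Type*} [NormedAddCommGroup P] [NormedSpace ℝ P] {Ψ : P × Pt n → ℂ}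
    {W : Set (P × Pt n)} (hW : IsOpen W) (hΨ : ContDiffOn ℝ 2 Ψ W) {K : Set P} (hK : IsCompact K)
    {Z₀ : Pt n} (hKW : ∀ p ∈ K, (p, Z₀) ∈ W) {ι : Type*} {c : ι → ℝ} {p : ι → P}
    (hc : Summable fun i => |c i|) (hp : ∀ i, p i ∈ K) {f : ι → Pt n → ℂ} {U : Set (Pt n)}
    (hU : U ∈ 𝓝 Z₀) (hf : ∀ Z ∈ U, ∀ i, f i Z = c i • Ψ (p i, Z)) {lam : ℂ}
    (hlam : ∀ i, lap (f i) Z₀ = lam * f i Z₀) :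
    Summable (fun i => f i Z₀) ∧ ContDiffAt ℝ 2 (fun Z => ∑' i, f i Z) Z₀ ∧
      lap (fun Z => ∑' i, f i Z) Z₀ = lam * ∑' i, f i Z₀ := by
  have h1 := summable_family hW hΨ.continuousOn hK hKW hc hp
  have h2 := contDiffAt_tsum_family hW hΨ hK hKW hc hp
  have h3 := fderiv_fderiv_tsum_family hW hΨ hK hKW hc hp
  have hZU : Z₀ ∈ U := mem_of_mem_nhds hU
  have e : (fun Z => ∑' i, f i Z) =ᶠ[𝓝 Z₀] fun Z => ∑' i, c i • Ψ (p i, Z) := by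
    filter_upwards [hU] with Z hZ using tsum_congr (hf Z hZ)
  have ei : ∀ i, f i =ᶠ[𝓝 Z₀] fun Z => c i • Ψ (p i, Z) := fun i => by
    filter_upwards [hU] with Z hZ using hf Z hZ i
  have hs : Summable (fun i => f i Z₀) := h1.congr fun i => (hf Z₀ hZU i).symm
  refine ⟨hs, h2.congr_of_eventuallyEq e, ?_⟩
  have hd : ∀ i, ContDiffAt ℝ 2 (fun Z => c i • Ψ (p i, Z)) Z₀ := fun i =>
    (ContDiffAt.comp (g := Ψ) Z₀ (hΨ.contDiffAt (hW.mem_nhds (hKW _ (hp i))))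
      (contDiffAt_const.prodMk contDiffAt_id)).const_smul (c i)
  rw [lap_congr e, lap_eq_lapForm (differentiableAt_fderiv_of_contDiffAt h2)]
  have h4 := hasSum_lapForm h3 Z₀
  refine h4.unique ?_
  have h5 : ∀ i, lapForm Z₀ (fderiv ℝ (fderiv ℝ fun Z => c i • Ψ (p i, Z)) Z₀) = lam * f i Z₀ :=
    fun i => by
      rw [← hlam i, lap_congr (ei i),
        lap_eq_lapForm (differentiableAt_fderiv_of_contDiffAt (hd i))]; rfl
  simp only [h5]
  exact hs.hasSum.mul_left lam

end UnitaryForms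
end

noncomputable section
namespace UnitaryForms

open Filter Topology

/-! ### Series over lattice points -/

lemma contDiffAt_ofReal_cpow {E : Type*} [NormedAddCommGroup E] [NormedSpace ℝ E] {g : E → ℝ} {x : E}
    {m : WithTop ℕ∞} (hg : ContDiffAt ℝ m g x) (h0 : 0 < g x) (a : ℂ) :
    ContDiffAt ℝ m (fun x => (g x : ℂ) ^ a) x := by
  have e : (fun x => (g x : ℂ) ^ a) =ᶠ[𝓝 x] fun x => Complex.exp ((Real.log (g x) : ℂ) * a) := by
    filter_upwards [hg.continuousAt.eventually (isOpen_Ioi.mem_nhds h0)] with z hz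
    have hz : 0 < g z := hz
    rw [Complex.cpow_def_of_ne_zero (by exact_mod_cast hz.ne'), Complex.ofReal_log hz.le]
  refine ContDiffAt.congr_of_eventuallyEq ?_ e
  have h1 : ContDiffAt ℝ m (fun x => (Real.log (g x) : ℂ)) x :=
    Complex.ofRealCLM.contDiff.contDiffAt.comp x (hg.log h0.ne')
  exact (h1.mul contDiffAt_const).cexp

section Pair
variable {n : ℕ}

/-- The normalised denominator `|ω₁ w + ω₂|² + ν e(Z)`. -/
def pairDen (e : Pt n → ℝ) (q : (ℂ × ℂ × ℝ × ℂ) × Pt n) : ℝ :=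
  ‖q.1.1 * q.2.2 + q.1.2.1‖ ^ 2 + q.1.2.2.1 * e q.2

/-- The members of a compact family to which series over lattice points are reduced. -/
def pairFun (a : ℂ) (e : Pt n → ℝ) (H : ℝ × Pt n → ℂ) (q : (ℂ × ℂ × ℝ × ℂ) × Pt n) : ℂ :=
  q.1.2.2.2 * (((pairDen e q)⁻¹ : ℝ) : ℂ) ^ a * H (q.1.2.2.1 * (pairDen e q)⁻¹, q.2)

/-- The domain of the family. -/
def pairDom (e : Pt n → ℝ) (V : Set (ℝ × Pt n)) : Set ((ℂ × ℂ × ℝ × ℂ) × Pt n) :=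
  {q | 0 < pairDen e q} ∩ (fun q => (q.1.2.2.1 * (pairDen e q)⁻¹, q.2)) ⁻¹' V

lemma contDiff_pairDen {e : Pt n → ℝ} (he : ContDiff ℝ 2 e) : ContDiff ℝ 2 (pairDen e) := by
  unfold pairDen
  have h2 : ContDiff ℝ 2 fun q : (ℂ × ℂ × ℝ × ℂ) × Pt n => e q.2 := he.comp contDiff_snd
  have h1 : ContDiff ℝ 2 fun q : (ℂ × ℂ × ℝ × ℂ) × Pt n => ‖q.1.1 * q.2.2 + q.1.2.1‖ ^ 2 :=
    ContDiff.norm_sq ℝ (by fun_prop)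
  fun_prop

lemma contDiffAt_pairArg {e : Pt n → ℝ} (he : ContDiff ℝ 2 e) {q : (ℂ × ℂ × ℝ × ℂ) × Pt n}
    (hq : 0 < pairDen e q) :
    ContDiffAt ℝ 2 (fun q : (ℂ × ℂ × ℝ × ℂ) × Pt n => (q.1.2.2.1 * (pairDen e q)⁻¹, q.2)) q := by
  have h := (contDiff_pairDen he).contDiffAt (x := q)
  have hi : ContDiffAt ℝ 2 (fun q => (pairDen e q)⁻¹) q := h.inv hq.ne'
  fun_prop

lemma isOpen_pairDom {e : Pt n → ℝ} (he : ContDiff ℝ 2 e) {V : Set (ℝ × Pt n)} (hV : IsOpen V) :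
    IsOpen (pairDom e V) :=
  ContinuousOn.isOpen_inter_preimage
    (fun _ hq => (contDiffAt_pairArg he hq).continuousAt.continuousWithinAt)
    (isOpen_lt continuous_const (contDiff_pairDen he).continuous) hV

lemma contDiffOn_pairFun {e : Pt n → ℝ} (he : ContDiff ℝ 2 e) {V : Set (ℝ × Pt n)} (hV : IsOpen V)
    {H : ℝ × Pt n → ℂ} (hH : ContDiffOn ℝ 2 H V) (a : ℂ) :
    ContDiffOn ℝ 2 (pairFun a e H) (pairDom e V) := by
  rintro q ⟨hq, hqV⟩
  have hq : 0 < pairDen e q := hq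
  have h := (contDiff_pairDen he).contDiffAt (x := q)
  have hi : ContDiffAt ℝ 2 (fun q => (pairDen e q)⁻¹) q := h.inv hq.ne'
  have h1 := contDiffAt_ofReal_cpow hi (inv_pos.2 hq) a
  have h2 : ContDiffAt ℝ 2 (fun q : (ℂ × ℂ × ℝ × ℂ) × Pt n => H (q.1.2.2.1 * (pairDen e q)⁻¹, q.2)) q :=
    ContDiffAt.comp (g := H) q (hH.contDiffAt (hV.mem_nhds hqV)) (contDiffAt_pairArg he hq)
  have h3 : ContDiffAt ℝ 2 (fun q : (ℂ × ℂ × ℝ × ℂ) × Pt n => q.1.2.2.2) q := by fun_prop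
  exact ((h3.mul h1).mul h2).contDiffWithinAt

/-- Regularity of series `∑ᵢ Xᵢᵃ H(Xᵢ, Z)` with `Xᵢ = (|pᵢ z_{n+1} + qᵢ|² + e(Z))⁻¹`. -/
lemma tsum_pair_lap {ι : Type*} {P Q : ι → ℂ} {N₀ κ : ℝ} {a lam : ℂ} {e : Pt n → ℝ}
    {H : ℝ × Pt n → ℂ} {V : Set (ℝ × Pt n)} {Z₀ : Pt n} {f : ι → Pt n → ℂ} {U : Set (Pt n)}
    (hN₀ : 0 < N₀) (hN : ∀ i, N₀ ≤ ‖P i‖ ^ 2 + ‖Q i‖ ^ 2)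
    (hs : Summable fun i => (‖P i‖ ^ 2 + ‖Q i‖ ^ 2) ^ (-a.re))
    (he : ContDiff ℝ 2 e) (hV : IsOpen V) (hH : ContDiffOn ℝ 2 H V) (hV0 : ∀ X ≥ 0, (X, Z₀) ∈ V)
    (hκ : 0 < κ) (hκN : ∀ i, κ * (‖P i‖ ^ 2 + ‖Q i‖ ^ 2) ≤ ‖P i * Z₀.2 + Q i‖ ^ 2 + e Z₀)
    (hU : U ∈ 𝓝 Z₀) (hf : ∀ Z ∈ U, ∀ i, f i Z = (((‖P i * Z.2 + Q i‖ ^ 2 + e Z)⁻¹ : ℝ) : ℂ) ^ a *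
      H ((‖P i * Z.2 + Q i‖ ^ 2 + e Z)⁻¹, Z))
    (hlam : ∀ i, lap (f i) Z₀ = lam * f i Z₀) :
    Summable (fun i => f i Z₀) ∧ ContDiffAt ℝ 2 (fun Z => ∑' i, f i Z) Z₀ ∧
      lap (fun Z => ∑' i, f i Z) Z₀ = lam * ∑' i, f i Z₀ := by
  set N : ι → ℝ := fun i => ‖P i‖ ^ 2 + ‖Q i‖ ^ 2 with hNdef
  have Npos : ∀ i, 0 < N i := fun i => hN₀.trans_le (hN i)
  let r : ι → ℝ := fun i => (Real.sqrt (N i))⁻¹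
  have hr : ∀ i, r i ^ 2 = (N i)⁻¹ := fun i => by
    simp only [r, inv_pow, Real.sq_sqrt (Npos i).le]
  -- The linear form is scaled to unit size, 1/N is kept as a parameter, and N^{-a} is split into
  -- the summable modulus N^{-Re a} and a factor of modulus one. Then Xᵢ is the parameter 1/N
  -- divided by the normalised denominator.
  let p : ι → ℂ × ℂ × ℝ × ℂ := fun i =>
    (r i * P i, r i * Q i, (N i)⁻¹, (((N i)⁻¹ : ℝ) : ℂ) ^ (a.im * Complex.I))
  have hden : ∀ i Z, ‖P i * Z.2 + Q i‖ ^ 2 + e Z = N i * pairDen e (p i, Z) := fun i Z => by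
    have h : (r i : ℂ) * P i * Z.2 + r i * Q i = r i * (P i * Z.2 + Q i) := by ring
    have hn : (N i) ≠ 0 := (Npos i).ne'
    simp only [pairDen, p]
    rw [h, norm_mul, mul_pow, Complex.norm_real, Real.norm_eq_abs, sq_abs, hr]
    field_simp
  -- The closed condition keeps the denominators away from 0 on all of K, limit points included. The
  -- parameter 1/N may reach 0 in K, so H has to be regular up to X = 0.
  let K : Set (ℂ × ℂ × ℝ × ℂ) := (Metric.closedBall 0 1 ×ˢ Metric.closedBall 0 1 ×ˢ
    Set.Icc 0 (N₀⁻¹) ×ˢ Metric.closedBall 0 1) ∩ {q | κ ≤ pairDen e (q, Z₀)}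
  have hK : IsCompact K := by
    refine IsCompact.inter_right ((isCompact_closedBall _ _).prod ((isCompact_closedBall _ _).prod
      (isCompact_Icc.prod (isCompact_closedBall _ _)))) ?_
    exact isClosed_le continuous_const
      ((contDiff_pairDen he).continuous.comp (Continuous.prodMk continuous_id continuous_const))
  have hle : ∀ i, ∀ A : ℂ, ‖A‖ ^ 2 ≤ N i → ‖(r i : ℂ) * A‖ ≤ 1 := fun i A hA => by
    rw [← sq_le_one_iff₀ (norm_nonneg _), norm_mul, mul_pow, Complex.norm_real, Real.norm_eq_abs,
      sq_abs, hr]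
    rw [inv_mul_le_iff₀ (Npos i)]; simpa using hA
  have hp : ∀ i, p i ∈ K := fun i => by
    refine ⟨⟨?_, ?_, ⟨?_, ?_⟩, ?_⟩, ?_⟩
    · exact mem_closedBall_zero_iff.2 (hle i _ (by simp [hNdef]))
    · exact mem_closedBall_zero_iff.2 (hle i _ (by simp [hNdef]))
    · exact (inv_pos.2 (Npos i)).le
    · exact inv_anti₀ hN₀ (hN i)
    · rw [mem_closedBall_zero_iff]
      simp only [p]
      rw [Complex.norm_cpow_eq_rpow_re_of_pos (inv_pos.2 (Npos i))]
      simp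
    · have := hκN i
      rw [hden] at this
      have hn := Npos i
      change κ ≤ pairDen e (p i, Z₀)
      nlinarith
  have hKW : ∀ q ∈ K, (q, Z₀) ∈ pairDom e V := fun q hq => by
    have h1 : 0 < pairDen e (q, Z₀) := hκ.trans_le hq.2
    exact ⟨h1, hV0 _ (mul_nonneg hq.1.2.2.1.1 (inv_pos.2 h1).le)⟩
  have hev := eventually_mem_family (isOpen_pairDom he hV) hK hKW
  refine tsum_family_lap (isOpen_pairDom he hV) (contDiffOn_pairFun he hV hH a) hK hKW
    (c := fun i => (N i) ^ (-a.re)) (p := p) (f := f) (U := U ∩ {Z | ∀ p ∈ K, (p, Z) ∈ pairDom e V})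
    ?_ hp (inter_mem hU hev) ?_ hlam
  · exact hs.abs
  · rintro Z ⟨hZU, hZ⟩ i
    have hD : 0 < pairDen e (p i, Z) := (hZ _ (hp i)).1
    rw [hf Z hZU i, hden, mul_inv, pairFun, Complex.ofReal_mul,
      Complex.mul_cpow_ofReal_nonneg (inv_pos.2 (Npos i)).le (inv_pos.2 hD).le,
      Complex.real_smul, ← mul_assoc, ← mul_assoc]
    congr 2
    have hne : (((N i)⁻¹ : ℝ) : ℂ) ≠ 0 := by exact_mod_cast (inv_pos.2 (Npos i)).ne'
    have : ((N i ^ (-a.re) : ℝ) : ℂ) = (((N i)⁻¹ : ℝ) : ℂ) ^ (a.re : ℂ) := by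
      rw [← Complex.ofReal_cpow (inv_pos.2 (Npos i)).le, Real.inv_rpow (Npos i).le,
        Real.rpow_neg (Npos i).le]
    rw [this, ← Complex.cpow_add _ _ hne, Complex.re_add_im]

end Pair
end UnitaryForms
end

noncomputable section
namespace UnitaryForms

open Filter Topology

/-! ### Sums over the modular group -/

lemma summable_int_sq_rpow {σ : ℝ} (hσ : 1 < σ) :
    Summable fun x : ℤ × ℤ => ((x.1 : ℝ) ^ 2 + (x.2 : ℝ) ^ 2) ^ (-σ) := by
  have h := EisensteinSeries.summable_one_div_norm_rpow (k := 2 * σ) (by linarith)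
  have h2 := (finTwoArrowEquiv ℤ).symm.summable_iff.2 h
  refine Summable.of_nonneg_of_le (fun x => by positivity) (fun x => ?_) h2
  simp only [Function.comp_apply, finTwoArrowEquiv_symm_apply]
  rcases eq_or_ne x 0 with rfl | hx
  · simp [Real.zero_rpow (show -σ ≠ 0 by linarith)]
    positivity
  · have hn : 0 < ‖![x.1, x.2]‖ := by
      rw [norm_pos_iff]; intro h0; apply hx
      have a := congrFun h0 0; have b := congrFun h0 1
      exact Prod.ext (by simpa using a) (by simpa using b)
    rw [show -(2 * σ) = 2 * (-σ) by ring, Real.rpow_mul hn.le]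
    refine Real.rpow_le_rpow_of_nonpos (by positivity) ?_ (by linarith)
    rw [Real.rpow_two, EisensteinSeries.norm_eq_max_natAbs]
    simp only [Matrix.cons_val_zero, Matrix.cons_val_one]
    push_cast
    rw [Nat.cast_natAbs, Nat.cast_natAbs, Int.cast_abs, Int.cast_abs]
    rcases max_choice |(x.1 : ℝ)| |(x.2 : ℝ)| with h | h <;> rw [h, sq_abs] <;>
      nlinarith [sq_nonneg (x.1 : ℝ), sq_nonneg (x.2 : ℝ)]

lemma summable_one_add_sq_rpow {σ : ℝ} (hσ : 1 < σ) :
    Summable fun k : ℤ => (1 + (k : ℝ) ^ 2) ^ (-σ) := by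
  have := (summable_int_sq_rpow hσ).comp_injective (i := fun k : ℤ => ((1 : ℤ), k))
    (fun a b h => by simpa using h)
  refine this.congr fun k => by simp

/-- The translation part of a matrix with given lower row. -/
def shiftPart (A : SL(2, ℤ)) : ℤ :=
  ⌊((A 0 0 * A 1 0 + A 0 1 * A 1 1 : ℤ) : ℝ) / ((A 1 0 ^ 2 + A 1 1 ^ 2 : ℤ) : ℝ)⌋

lemma row_sq_pos (A : SL(2, ℤ)) : 1 ≤ A 1 0 ^ 2 + A 1 1 ^ 2 := by
  rcases row_ne_zero A with h | h <;> have := sq_pos_of_ne_zero h <;> nlinarith [sq_nonneg (A 1 0), sq_nonneg (A 1 1)]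

/-- Matrices with a common lower row differ by a left translation T^m, which adds m to
(ac+bd)/(c²+d²); the integer part of this quotient therefore tells them apart. -/
lemma injective_row_shiftPart :
    Function.Injective fun A : SL(2, ℤ) => ((A 1 0, A 1 1), shiftPart A) := by
  intro A B h
  simp only [Prod.mk.injEq] at h
  obtain ⟨⟨hc, hd⟩, hk⟩ := h
  have dA := det_eq A
  have dB := det_eq B
  have hM := row_sq_pos B
  simp only [shiftPart] at hk
  rw [hc, hd] at dA hk
  set a := A 0 0; set b := A 0 1; set a' := B 0 0; set b' := B 0 1; set c := B 1 0; set d := B 1 1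
  set m := a' * b - a * b' with hm
  have e1 : a = a' + m * c := by rw [hm]; linear_combination a' * dA - a * dB
  have e2 : b = b' + m * d := by rw [hm]; linear_combination b' * dA - b * dB
  have hM' : ((c ^ 2 + d ^ 2 : ℤ) : ℝ) ≠ 0 := by
    have : c ^ 2 + d ^ 2 ≠ 0 := by linarith
    exact_mod_cast this
  have e3 : ((a * c + b * d : ℤ) : ℝ) / ((c ^ 2 + d ^ 2 : ℤ) : ℝ) =
      ((a' * c + b' * d : ℤ) : ℝ) / ((c ^ 2 + d ^ 2 : ℤ) : ℝ) + (m : ℤ) := by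
    rw [div_add' _ _ _ hM']
    congr 1
    rw [e1, e2]; push_cast; ring
  rw [e3, Int.floor_add_intCast] at hk
  have m0 : m = 0 := by linarith
  rw [m0] at e1 e2
  ext i j
  fin_cases i <;> fin_cases j
  · simpa using e1
  · simpa using e2
  · exact hc
  · exact hd

/-- The sum of the squares of the entries. -/
def entrySq (A : SL(2, ℤ)) : ℝ :=
  (A 0 0 : ℝ) ^ 2 + (A 0 1 : ℝ) ^ 2 + ((A 1 0 : ℝ) ^ 2 + (A 1 1 : ℝ) ^ 2)

/-- Put M = c²+d² and t = (ac+bd)/M. Determinant one gives (a²+b²)M = (ac+bd)²+1, so t²M ≤ a²+b²,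
while the integer part k of t satisfies k² ≤ 2t²+2. Hence M(1+k²) ≤ 3M + 2(a²+b²). -/
lemma le_entrySq (A : SL(2, ℤ)) : 
    ((A 1 0 : ℝ) ^ 2 + (A 1 1 : ℝ) ^ 2) * (1 + (shiftPart A : ℝ) ^ 2) ≤ 3 * entrySq A := by
  have hM : (1 : ℝ) ≤ (A 1 0 : ℝ) ^ 2 + (A 1 1 : ℝ) ^ 2 := by exact_mod_cast row_sq_pos A
  have hd : (A 0 0 : ℝ) * A 1 1 - A 0 1 * A 1 0 = 1 := by exact_mod_cast det_eq A
  have k1 := Int.floor_le (((A 0 0 * A 1 0 + A 0 1 * A 1 1 : ℤ) : ℝ) / ((A 1 0 ^ 2 + A 1 1 ^ 2 : ℤ) : ℝ))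
  have k2 := Int.lt_floor_add_one
    (((A 0 0 * A 1 0 + A 0 1 * A 1 1 : ℤ) : ℝ) / ((A 1 0 ^ 2 + A 1 1 ^ 2 : ℤ) : ℝ))
  change (shiftPart A : ℝ) ≤ _ at k1
  change _ < (shiftPart A : ℝ) + 1 at k2
  unfold entrySq
  push_cast at k1 k2
  set a := (A 0 0 : ℝ); set b := (A 0 1 : ℝ); set c := (A 1 0 : ℝ); set d := (A 1 1 : ℝ)
  set k := (shiftPart A : ℝ)
  set t := (a * c + b * d) / (c ^ 2 + d ^ 2) with ht
  have hk : k ^ 2 ≤ 2 * t ^ 2 + 2 := by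
    nlinarith [sq_nonneg (2 * t - k), mul_nonneg (sub_nonneg.2 k1) (sub_nonneg.2 k2.le)]
  have hab : t ^ 2 * (c ^ 2 + d ^ 2) ≤ a ^ 2 + b ^ 2 := by
    rw [ht, div_pow, div_mul_eq_mul_div, div_le_iff₀ (by positivity)]
    have : (a ^ 2 + b ^ 2) * (c ^ 2 + d ^ 2) = (a * c + b * d) ^ 2 + 1 := by
      linear_combination (a * d - b * c + 1) * hd
    nlinarith
  nlinarith

lemma entrySq_pos (A : SL(2, ℤ)) : 1 ≤ entrySq A := by
  have hM : (1 : ℝ) ≤ (A 1 0 : ℝ) ^ 2 + (A 1 1 : ℝ) ^ 2 := by exact_mod_cast row_sq_pos A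
  unfold entrySq; nlinarith [sq_nonneg (A 0 0 : ℝ), sq_nonneg (A 0 1 : ℝ)]

/-- Through the injection (lower row, shift) the sum is dominated by a product of a sum over ℤ² and
a sum over ℤ, both convergent for σ > 1. -/
lemma summable_entrySq_rpow {σ : ℝ} (hσ : 1 < σ) :
    Summable fun A : SL(2, ℤ) => entrySq A ^ (-σ) := by
  have h := ((summable_int_sq_rpow hσ).mul_of_nonneg (summable_one_add_sq_rpow hσ)
    (fun _ => by positivity) (fun _ => by positivity)).comp_injective injective_row_shiftPart
  refine Summable.of_nonneg_of_le (fun A => Real.rpow_nonneg (by linarith [entrySq_pos A]) _)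
    (fun A => ?_) (h.mul_left ((3 : ℝ) ^ σ))
  simp only [Function.comp_apply]
  have hM : (1 : ℝ) ≤ (A 1 0 : ℝ) ^ 2 + (A 1 1 : ℝ) ^ 2 := by exact_mod_cast row_sq_pos A
  have h3 : (3 : ℝ) ^ σ = 3⁻¹ ^ (-σ) := by rw [Real.inv_rpow (by norm_num), Real.rpow_neg (by norm_num), inv_inv]
  rw [← Real.mul_rpow (by positivity) (by positivity), h3, ← Real.mul_rpow (by norm_num) (by positivity)]
  refine Real.rpow_le_rpow_of_nonpos (by positivity) ?_ (by linarith)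
  linarith [le_entrySq A]

lemma summable_GZ {n : ℕ} {f : SL(2, ℤ) → ℝ} (hf : Summable f) (h0 : ∀ A, 0 ≤ f A) :
    Summable fun γ : GZ n => f γ.2 := by
  have h1 : Summable fun _ : Equiv.Perm (Fin n) => (1 : ℝ) := Summable.of_finite
  have := h1.mul_of_nonneg hf (fun _ => zero_le_one) h0
  simpa using this

/-- A lower bound for linear forms on the upper half plane. -/
lemma exists_le_normSq_linear {w : ℂ} (hw : 0 < w.im) :
    ∃ δ > 0, ∀ c d : ℝ, δ * (c ^ 2 + d ^ 2) ≤ ‖(c : ℂ) * w + d‖ ^ 2 := by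
  set u := w.re; set v := w.im
  refine ⟨(2 + (1 + 2 * u ^ 2) / v ^ 2)⁻¹, by positivity, fun c d => ?_⟩
  rw [inv_mul_le_iff₀ (by positivity), Complex.sq_norm, Complex.normSq_apply]
  simp only [Complex.add_re, Complex.mul_re, Complex.ofReal_re, Complex.ofReal_im, Complex.add_im,
    Complex.mul_im, zero_mul, sub_zero, add_zero]
  change c ^ 2 + d ^ 2 ≤ (2 + (1 + 2 * u ^ 2) / v ^ 2) * ((c * u + d) * (c * u + d) + c * v * (c * v))
  have e : (1 + 2 * u ^ 2) / v ^ 2 * (c * v * (c * v)) = (1 + 2 * u ^ 2) * c ^ 2 := by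
    field_simp
  have h1 : 0 ≤ (1 + 2 * u ^ 2) / v ^ 2 * ((c * u + d) * (c * u + d)) := by
    have := mul_self_nonneg (c * u + d); positivity
  have h2 : d ^ 2 ≤ 2 * ((c * u + d) * (c * u + d)) + 2 * u ^ 2 * c ^ 2 := by
    nlinarith [sq_nonneg (2 * c * u + d)]
  nlinarith [mul_self_nonneg (c * v)]

/-! ### The linear forms behind x(Z, γZ') and their lower bounds -/

section Pairs
variable {n : ℕ}

/-- The coefficient `c w' + d` in `x(Z, γ Z') = |(c w' + d) w - (a w' + b)|² / (4 ρ v')`. -/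
def coefP (Z' : Pt n) (γ : GZ n) : ℂ := den γ.2 Z'

/-- The coefficient `-(a w' + b)` in `x(Z, γ Z') = |(c w' + d) w - (a w' + b)|² / (4 ρ v')`. -/
def coefQ (Z' : Pt n) (γ : GZ n) : ℂ := -((γ.2 0 0 : ℂ) * Z'.2 + (γ.2 0 1 : ℂ))

lemma coefP_ne_zero {Z' : Pt n} (hZ' : Z' ∈ HH n) (γ : GZ n) : coefP Z' γ ≠ 0 := den_ne_zero _ hZ'

lemma coef_sub {Z' : Pt n} (hZ' : Z' ∈ HH n) (γ : GZ n) (w : ℂ) :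
    coefP Z' γ * w + coefQ Z' γ = coefP Z' γ * (w - (act γ Z').2) := by
  have := coefP_ne_zero hZ' γ
  simp only [coefP] at this
  simp only [act, coefP, coefQ]
  field_simp
  ring

lemma xinv_act_eq {Z Z' : Pt n} (hZ' : Z' ∈ HH n) (γ : GZ n) :
    xinv Z (act γ Z') = ‖coefP Z' γ * Z.2 + coefQ Z' γ‖ ^ 2 / (4 * rho Z * Z'.2.im) := by
  have := coefP_ne_zero hZ' γ
  have h2 : Complex.normSq (coefP Z' γ) ≠ 0 := by simpa using this
  rw [xinv_eq, act_im γ hZ', coef_sub hZ', Complex.sq_norm, Complex.normSq_mul]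
  change _ / (4 * rho Z * (Z'.2.im / Complex.normSq (coefP Z' γ))) = _
  rw [mul_div_assoc', div_div_eq_mul_div, mul_comm (Complex.normSq (coefP Z' γ))]

/-- Because the determinant is one, passing from w to w̄ adds a quantity independent of γ. Since w̄
lies in the lower half plane, the form at w̄ never vanishes and controls the coefficients. -/
lemma coef_conj {Z' : Pt n} (γ : GZ n) (w : ℂ) :
    ‖coefP Z' γ * conj w + coefQ Z' γ‖ ^ 2 = ‖coefP Z' γ * w + coefQ Z' γ‖ ^ 2 + 4 * w.im * Z'.2.im := by
  have hd : (γ.2 0 0 : ℝ) * γ.2 1 1 - γ.2 0 1 * γ.2 1 0 = 1 := by exact_mod_cast det_eq γ.2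
  simp only [coefP, coefQ, den, Complex.sq_norm, Complex.normSq_apply, Complex.add_re, Complex.add_im,
    Complex.mul_re, Complex.mul_im, Complex.neg_re, Complex.neg_im, Complex.conj_re, Complex.conj_im,
    Complex.intCast_re, Complex.intCast_im]
  linear_combination (4 * w.im * Z'.2.im) * hd

/-- The size of the coefficients. -/
def coefSize (Z' : Pt n) (γ : GZ n) : ℝ := ‖coefP Z' γ‖ ^ 2 + ‖coefQ Z' γ‖ ^ 2

lemma exists_le_coefSize {Z' : Pt n} (hZ' : Z' ∈ HH n) :
    ∃ δ > 0, (∀ γ : GZ n, δ * entrySq γ.2 ≤ coefSize Z' γ) ∧ ∀ γ : GZ n, δ ≤ ‖coefP Z' γ‖ ^ 2 := by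
  obtain ⟨δ, δ0, h⟩ := exists_le_normSq_linear (im_pos hZ')
  refine ⟨δ, δ0, fun γ => ?_, fun γ => ?_⟩
  · have h1 := h (γ.2 1 0) (γ.2 1 1)
    have h2 := h (γ.2 0 0) (γ.2 0 1)
    simp only [coefSize, coefP, coefQ, norm_neg, den, entrySq]
    push_cast at h1 h2
    linarith
  · have h1 := h (γ.2 1 0) (γ.2 1 1)
    have hM : (1 : ℝ) ≤ (γ.2 1 0 : ℝ) ^ 2 + (γ.2 1 1 : ℝ) ^ 2 := by exact_mod_cast row_sq_pos γ.2
    simp only [coefP, den]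
    push_cast at h1
    nlinarith

lemma summable_coefSize {Z' : Pt n} (hZ' : Z' ∈ HH n) {σ : ℝ} (hσ : 1 < σ) :
    Summable fun γ : GZ n => coefSize Z' γ ^ (-σ) := by
  obtain ⟨δ, δ0, h, -⟩ := exists_le_coefSize hZ'
  have hs := summable_GZ (n := n) (summable_entrySq_rpow hσ)
    (fun A => Real.rpow_nonneg (by linarith [entrySq_pos A]) _)
  refine Summable.of_nonneg_of_le (fun γ => by unfold coefSize; positivity) (fun γ => ?_)
    (hs.mul_left (δ ^ (-σ)))
  have := entrySq_pos γ.2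
  rw [← Real.mul_rpow δ0.le (by linarith)]
  exact Real.rpow_le_rpow_of_nonpos (by positivity) (h γ) (by linarith)

lemma exists_coefSize_lower {Z' : Pt n} (hZ' : Z' ∈ HH n) : ∃ N₀ > 0, ∀ γ : GZ n, N₀ ≤ coefSize Z' γ := by
  obtain ⟨δ, δ0, -, h⟩ := exists_le_coefSize hZ'
  exact ⟨δ, δ0, fun γ => (h γ).trans (by unfold coefSize; nlinarith [sq_nonneg ‖coefQ Z' γ‖])⟩

/-- P and Q can be recovered from the values at w and w̄, whose difference is 2i(Im w)P. With B =
|Pw̄+Q| ≥ |Pw+Q| this gives |P| ≤ B/Im w and |Q| ≤ (1+|w|/Im w)B, whence the constant. -/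
lemma exists_coefSize_le {Z' : Pt n} (hZ' : Z' ∈ HH n) {w : ℂ} (hw : 0 < w.im) :
    ∃ κ > 0, ∀ γ : GZ n, κ * coefSize Z' γ ≤
      ‖coefP Z' γ * w + coefQ Z' γ‖ ^ 2 + 4 * w.im * Z'.2.im := by
  have hv := im_pos hZ'
  set v := w.im with hvdef
  refine ⟨(1 / v ^ 2 + (1 + ‖w‖ / v) ^ 2)⁻¹, by positivity, fun γ => ?_⟩
  rw [inv_mul_le_iff₀ (by positivity), ← coef_conj]
  set p := coefP Z' γ with hp
  set q := coefQ Z' γ with hq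
  set B := ‖p * conj w + q‖
  have hB : 0 ≤ B := norm_nonneg _
  have h1 : ‖p * w + q‖ ≤ B := by
    have := coef_conj (Z' := Z') γ w
    refine abs_le_of_sq_le_sq' ?_ hB |>.2
    rw [this]; nlinarith [mul_pos hw hv]
  have h2 : ‖p‖ * v ≤ B := by
    have e : p * (2 * v * Complex.I) = (p * w + q) - (p * conj w + q) := by
      have : w - conj w = 2 * v * Complex.I := by rw [Complex.sub_conj]; push_cast; rfl
      rw [← this]; ring
    have h := norm_sub_le (p * w + q) (p * conj w + q)
    rw [← e, norm_mul] at h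
    have : ‖(2 * v * Complex.I : ℂ)‖ = 2 * v := by
      simp [abs_of_pos hw]
    rw [this] at h
    nlinarith
  have h3 : ‖q‖ ≤ B + ‖p‖ * ‖w‖ := by
    have : q = (p * conj w + q) - p * conj w := by ring
    calc ‖q‖ = ‖(p * conj w + q) - p * conj w‖ := by rw [← this]
      _ ≤ B + ‖p * conj w‖ := norm_sub_le _ _
      _ = B + ‖p‖ * ‖w‖ := by rw [norm_mul, RCLike.norm_conj]
  have h2' : ‖p‖ ≤ B / v := by rwa [le_div_iff₀ hw]
  have h3' : ‖q‖ ≤ (1 + ‖w‖ / v) * B := by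
    calc ‖q‖ ≤ B + B / v * ‖w‖ := h3.trans (by gcongr)
      _ = _ := by ring
  have e1 : ‖p‖ ^ 2 ≤ (B / v) ^ 2 := by gcongr
  have e2 : ‖q‖ ^ 2 ≤ ((1 + ‖w‖ / v) * B) ^ 2 := by gcongr
  calc coefSize Z' γ = ‖p‖ ^ 2 + ‖q‖ ^ 2 := rfl
    _ ≤ (B / v) ^ 2 + ((1 + ‖w‖ / v) * B) ^ 2 := add_le_add e1 e2
    _ = _ := by ring

lemma finite_coefSize_lt {Z' : Pt n} (hZ' : Z' ∈ HH n) {T : ℝ} (T0 : 0 < T) :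
    {γ : GZ n | coefSize Z' γ < T}.Finite := by
  obtain ⟨N₀, N0, hN⟩ := exists_coefSize_lower hZ'
  have ht := (summable_coefSize hZ' (σ := 2) (by norm_num)).tendsto_cofinite_zero
  have := ht.eventually (gt_mem_nhds (show (0 : ℝ) < T ^ (-2 : ℝ) by positivity))
  refine (Filter.eventually_cofinite.1 this).subset fun γ hγ => ?_
  have hγ : coefSize Z' γ < T := hγ
  change ¬ (coefSize Z' γ ^ (-2 : ℝ) < T ^ (-2 : ℝ))
  rw [not_lt]
  exact Real.rpow_le_rpow_of_nonpos (N0.trans_le (hN γ)) hγ.le (by norm_num)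

/-- The linear forms that do not vanish at a point are bounded below there. -/
lemma exists_coefSize_le_of_ne {Z Z' : Pt n} (hZ : Z ∈ HH n) (hZ' : Z' ∈ HH n) :
    ∃ κ > 0, ∀ γ : GZ n, Z.2 ≠ (act γ Z').2 →
      κ * coefSize Z' γ ≤ ‖coefP Z' γ * Z.2 + coefQ Z' γ‖ ^ 2 := by
  obtain ⟨κ, κ0, hκ⟩ := exists_coefSize_le hZ' (im_pos hZ)
  obtain ⟨N₀, N0, hN⟩ := exists_coefSize_lower hZ'
  set E := 4 * Z.2.im * Z'.2.im
  have E0 : 0 < E := by have := im_pos hZ; have := im_pos hZ'; positivity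
  -- With this T, a form of size at least T has E ≤ (κ/2)·size, so half of the available bound
  -- absorbs the extra term E. Only finitely many forms are smaller, and for these the minimum of
  -- the nonzero values serves.
  set T := 2 * E / κ
  have T0 : 0 < T := by positivity
  set S : Set (GZ n) := {γ | coefSize Z' γ < T} ∩ {γ | Z.2 ≠ (act γ Z').2}
  have hfin : S.Finite := (finite_coefSize_lt hZ' T0).inter_of_left _
  have hpos : ∀ γ ∈ S, 0 < ‖coefP Z' γ * Z.2 + coefQ Z' γ‖ ^ 2 := fun γ hγ => by
    have : coefP Z' γ * Z.2 + coefQ Z' γ ≠ 0 := by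
      rw [coef_sub hZ']
      exact mul_ne_zero (coefP_ne_zero hZ' γ) (sub_ne_zero.2 hγ.2)
    positivity
  have hm : ∃ m > 0, ∀ γ ∈ S, m ≤ ‖coefP Z' γ * Z.2 + coefQ Z' γ‖ ^ 2 := by
    rcases S.eq_empty_or_nonempty with h0 | h0
    · exact ⟨1, one_pos, by simp [h0]⟩
    · obtain ⟨γ₀, hγ₀, h1⟩ := Set.exists_min_image _ (fun γ => ‖coefP Z' γ * Z.2 + coefQ Z' γ‖ ^ 2) hfin h0
      exact ⟨_, hpos γ₀ hγ₀, h1⟩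
  obtain ⟨m, m0, hm⟩ := hm
  refine ⟨min (κ / 2) (m / T), by positivity, fun γ hne => ?_⟩
  have N1 := N0.trans_le (hN γ)
  by_cases hγ : coefSize Z' γ < T
  · calc min (κ / 2) (m / T) * coefSize Z' γ ≤ m / T * T := by gcongr; exact min_le_right _ _
      _ = m := by field_simp
      _ ≤ _ := hm γ ⟨hγ, hne⟩
  · push Not at hγ
    have h1 := hκ γ
    have h2 : E ≤ κ / 2 * coefSize Z' γ := by
      calc E = κ / 2 * T := by simp only [T]; field_simp
        _ ≤ _ := by gcongr
    have h3 : min (κ / 2) (m / T) * coefSize Z' γ ≤ κ / 2 * coefSize Z' γ := by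
      gcongr; exact min_le_left _ _
    linarith

/-- Off the orbit of `z'_{n+1}`, the linear forms are bounded below. -/
lemma exists_coefSize_le_of_not_sameOrbit {Z Z' : Pt n} (hZ : Z ∈ HH n) (hZ' : Z' ∈ HH n)
    (h : ¬ SameOrbit Z Z') :
    ∃ κ > 0, ∀ γ : GZ n, κ * coefSize Z' γ ≤ ‖coefP Z' γ * Z.2 + coefQ Z' γ‖ ^ 2 := by
  obtain ⟨κ, κ0, hκ⟩ := exists_coefSize_le_of_ne hZ hZ'
  exact ⟨κ, κ0, fun γ => hκ γ fun h0 => h ⟨γ, h0⟩⟩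

/-- If γw' = w then Pw+Q = 0, and the bound of `exists_coefSize_le` limits the size of the
coefficients by a constant. -/
lemma finite_snd_eq {Z Z' : Pt n} (hZ : Z ∈ HH n) (hZ' : Z' ∈ HH n) :
    {γ : GZ n | Z.2 = (act γ Z').2}.Finite := by
  obtain ⟨κ, κ0, hκ⟩ := exists_coefSize_le hZ' (im_pos hZ)
  have hE : 0 < 4 * Z.2.im * Z'.2.im := by have := im_pos hZ; have := im_pos hZ'; positivity
  refine (finite_coefSize_lt hZ' (T := 4 * Z.2.im * Z'.2.im / κ + 1) (by positivity)).subset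
    fun γ hγ => ?_
  have hγ : Z.2 = (act γ Z').2 := hγ
  have h := hκ γ
  rw [coef_sub hZ', hγ, sub_self, mul_zero, norm_zero, zero_pow two_ne_zero, zero_add, ← hγ,
    ← le_div_iff₀' κ0] at h
  exact h.trans_lt (lt_add_one _)

/-- High up in a vertical strip the linear forms are uniformly bounded below. -/
lemma exists_coefSize_le_strip {Z' : Pt n} (hZ' : Z' ∈ HH n) :
    ∃ V₀ ≥ 1, ∀ w : ℂ, V₀ ≤ w.im → |w.re| ≤ 1 / 2 → ∀ γ : GZ n,
      coefSize Z' γ ≤ 20 * ‖coefP Z' γ * w + coefQ Z' γ‖ ^ 2 := by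
  obtain ⟨δ, δ0, -, h⟩ := exists_le_coefSize hZ'
  have hv := im_pos hZ'
  -- As |cw'+d|² ≥ δ, every point γw' has height at most v'/δ, hence at most half of Im w. This
  -- bounds |w − γw'| below by Im w/2, giving |P| ≤ 2B and |Q| ≤ 4B for B = |Pw+Q|; the constant 20
  -- is 2²+4².
  refine ⟨max 1 (2 * Z'.2.im / δ), le_max_left _ _, fun w hw hre γ => ?_⟩
  have w1 : 1 ≤ w.im := (le_max_left _ _).trans hw
  have w2 : 2 * Z'.2.im / δ ≤ w.im := (le_max_right _ _).trans hw
  have hi : (act γ Z').2.im ≤ w.im / 2 := by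
    rw [act_im γ hZ', Complex.normSq_eq_norm_sq]
    have := h γ
    calc Z'.2.im / ‖den γ.2 Z'‖ ^ 2 ≤ Z'.2.im / δ := by gcongr; exact this
      _ ≤ w.im / 2 := by linarith [show 2 * Z'.2.im / δ = 2 * (Z'.2.im / δ) by ring]
  set p := coefP Z' γ with hp
  set q := coefQ Z' γ with hq
  set B := ‖p * w + q‖ with hB
  have h1 : ‖p‖ * (w.im / 2) ≤ B := by
    rw [hB, hp, hq, coef_sub hZ', norm_mul]
    gcongr
    refine le_trans ?_ (Complex.abs_im_le_norm _)
    rw [Complex.sub_im]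
    exact le_trans (by linarith) (le_abs_self _)
  have hw' : ‖w‖ ≤ 3 / 2 * w.im := by
    refine (Complex.norm_le_abs_re_add_abs_im w).trans ?_
    rw [abs_of_pos (by linarith : 0 < w.im)]; linarith
  have h3 : ‖q‖ ≤ B + ‖p‖ * ‖w‖ := by
    calc ‖q‖ = ‖(p * w + q) - p * w‖ := by ring_nf
      _ ≤ B + ‖p * w‖ := norm_sub_le _ _
      _ = B + ‖p‖ * ‖w‖ := by rw [norm_mul]
  have h4 : ‖p‖ * ‖w‖ ≤ 3 * B := by
    calc ‖p‖ * ‖w‖ ≤ ‖p‖ * (3 / 2 * w.im) := by gcongr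
      _ = 3 * (‖p‖ * (w.im / 2)) := by ring
      _ ≤ 3 * B := by gcongr
  have h5 : ‖p‖ ≤ 2 * B := by nlinarith [norm_nonneg p]
  have h6 : ‖q‖ ≤ 4 * B := by linarith
  have e1 : ‖p‖ ^ 2 ≤ (2 * B) ^ 2 := by gcongr
  have e2 : ‖q‖ ^ 2 ≤ (4 * B) ^ 2 := by gcongr
  simp only [coefSize]
  nlinarith

end Pairs
end UnitaryForms
end

noncomputable section
namespace UnitaryForms

open Filter Topology

/-! ### Poincaré series of a general kernel -/

/-! ### Openness, density and invariance of the regular sets -/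

section Domains
variable {n : ℕ}

lemma isOpen_offAxis (n : ℕ) : IsOpen (offAxis n) :=
  (isOpen_HH n).inter (isOpen_compl_singleton.preimage continuous_fst)

/-- A zero of Pw+Q at a nearby point W would make the form at Z equal to −P(w_W − w_Z), while its
squared modulus is at least κ|P|². Points of the orbit thus keep distance √κ from z_{n+1}. -/
lemma isOpen_regX {Z' : Pt n} (hZ' : Z' ∈ HH n) : IsOpen (regX Z') := by
  rw [isOpen_iff_mem_nhds]
  rintro Z ⟨hZ, h⟩
  obtain ⟨κ, κ0, hκ⟩ := exists_coefSize_le_of_not_sameOrbit hZ hZ' h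
  have hn : {W : Pt n | ‖W.2 - Z.2‖ < √κ} ∈ 𝓝 Z :=
    (isOpen_lt (by fun_prop) continuous_const).mem_nhds (by simpa using κ0)
  filter_upwards [(isOpen_HH n).mem_nhds hZ, hn] with W hW hd
  refine ⟨hW, ?_⟩
  rintro ⟨γ, hγ⟩
  have hd : ‖W.2 - Z.2‖ < √κ := hd
  have h0 : coefP Z' γ * W.2 + coefQ Z' γ = 0 := by rw [coef_sub hZ', hγ, sub_self, mul_zero]
  have h1 := hκ γ
  have e : coefP Z' γ * Z.2 + coefQ Z' γ = -(coefP Z' γ * (W.2 - Z.2)) := by linear_combination h0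
  have hp : 0 < ‖coefP Z' γ‖ := norm_pos_iff.2 (coefP_ne_zero hZ' γ)
  rw [e, norm_neg, norm_mul, mul_pow] at h1
  have h2 : ‖W.2 - Z.2‖ ^ 2 < κ := by
    calc ‖W.2 - Z.2‖ ^ 2 < √κ ^ 2 := by gcongr
      _ = κ := Real.sq_sqrt κ0.le
  have h3 : ‖coefP Z' γ‖ ^ 2 ≤ coefSize Z' γ := by unfold coefSize; nlinarith [sq_nonneg ‖coefQ Z' γ‖]
  have h4 : 0 < ‖coefP Z' γ‖ ^ 2 := by positivity
  nlinarith

lemma regF3_eq (Z' : Pt n) : regF3 Z' = offAxis n ∩ regX Z' := by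
  ext Z; simp only [regF3, offAxis, regX, Set.mem_inter_iff, Set.mem_ofPred_eq]; tauto

lemma regXY_eq (Z' : Pt n) : regXY Z' = offAxis n ∪ regX Z' := by
  ext Z; simp only [regXY, offAxis, regX, Set.mem_union, Set.mem_ofPred_eq]; tauto

lemma isOpen_regF3 {Z' : Pt n} (hZ' : Z' ∈ HH n) : IsOpen (regF3 Z') :=
  regF3_eq Z' ▸ (isOpen_offAxis n).inter (isOpen_regX hZ')

lemma isOpen_regXY {Z' : Pt n} (hZ' : Z' ∈ HH n) : IsOpen (regXY Z') :=
  regXY_eq Z' ▸ (isOpen_offAxis n).union (isOpen_regX hZ')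

/-- The orbit in the last coordinate is countable, since a matrix is determined by integers, so its
complement in ℂ is dense; density of z ≠ 0 needs n ≥ 1. -/
lemma HH_subset_closure_regF3 (hn : 1 ≤ n) (Z' : Pt n) : HH n ⊆ closure (regF3 Z') := by
  have : Countable SL(2, ℤ) := injective_row_shiftPart.countable
  have : Nonempty (Fin n) := ⟨⟨0, hn⟩⟩
  have hc : (Set.range fun γ : GZ n => (act γ Z').2).Countable := Set.countable_range _
  have hd : Dense (({0}ᶜ : Set (Fin n → ℂ)) ×ˢ (Set.range fun γ : GZ n => (act γ Z').2)ᶜ) :=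
    (dense_compl_singleton 0).prod (hc.dense_compl ℂ)
  refine (hd.open_subset_closure_inter (isOpen_HH n)).trans (closure_mono ?_)
  rintro Z ⟨h1, h2, h3⟩
  exact ⟨h1, h2, fun ⟨γ, hγ⟩ => h3 ⟨γ, hγ.symm⟩⟩

lemma regF3_subset_regX (Z' : Pt n) : regF3 Z' ⊆ regX Z' := regF3_eq Z' ▸ Set.inter_subset_right
lemma regF3_subset_offAxis (Z' : Pt n) : regF3 Z' ⊆ offAxis n := regF3_eq Z' ▸ Set.inter_subset_left
lemma regX_subset_regXY (Z' : Pt n) : regX Z' ⊆ regXY Z' := regXY_eq Z' ▸ Set.subset_union_right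

lemma act_mem_offAxis (γ : GZ n) {Z : Pt n} (h : Z ∈ offAxis n) : act γ Z ∈ offAxis n :=
  ⟨act_mem_HH γ h.1, act_fst_ne_zero γ h.1 h.2⟩

lemma act_mem_regX {Z' : Pt n} (hZ' : Z' ∈ HH n) (γ : GZ n) {Z : Pt n} (h : Z ∈ regX Z') :
    act γ Z ∈ regX Z' :=
  ⟨act_mem_HH γ h.1, (sameOrbit_act γ h.1 hZ').not.2 h.2⟩

end Domains

section Translation
variable {n : ℕ}

/-- The translation `z_{n+1} ↦ z_{n+1} + m`. -/
def translation (n : ℕ) (m : ℤ) : GZ n := (1, ModularGroup.T ^ m)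

lemma translation_act (m : ℤ) (Z : Pt n) : act (translation n m) Z = (Z.1, Z.2 + m) := by
  refine Prod.ext (funext fun j => ?_) ?_ <;>
    simp [act, translation, den, ModularGroup.coe_T_zpow]

lemma beta_translate (Z : Pt n) (m : ℂ) : beta ((Z.1, Z.2 + m) : Pt n) = beta Z := rfl

lemma rho_translate (Z : Pt n) (m : ℤ) : rho ((Z.1, Z.2 + m) : Pt n) = rho Z := by
  simp [rho, beta]

/-- Every point can be moved into the strip `|Re z_{n+1}| ≤ 1/2` by a translation. -/
lemma exists_translation_strip (Z : Pt n) : ∃ γ : GZ n, beta (act γ Z) = beta Z ∧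
    rho (act γ Z) = rho Z ∧ |(act γ Z).2.re| ≤ 1 / 2 := by
  refine ⟨translation n (-round Z.2.re), ?_⟩
  rw [translation_act]
  refine ⟨beta_translate _ _, rho_translate _ _, ?_⟩
  have := abs_sub_round Z.2.re
  simpa [sub_eq_add_neg] using this

end Translation

section Poincare
variable {n : ℕ} {g : ℝ → ℝ → ℂ} {Z' : Pt n}

lemma poincare_act (hZ' : Z' ∈ HH n) (δ : GZ n) {Z : Pt n} (hZ : Z ∈ HH n) :
    poincare g (act δ Z) Z' = poincare g Z Z' := by
  rw [poincare, poincare, ← (Equiv.mulLeft δ).tsum_eq]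
  refine tsum_congr fun γ => ?_
  rw [Equiv.coe_mulLeft, poincareTerm, poincareTerm, act_mul _ _ hZ',
    xinv_act δ hZ (act_mem_HH γ hZ'), yinv_act δ hZ]

/-- A Poincaré series is an automorphic form as soon as its kernel decays like
`x^{-σ} y^{-τ}` and the series can be differentiated term by term. -/
theorem isAutForm_poincare {Ω : Set (Pt n)} {lam : ℂ} {σ τ C : ℝ} (hZ' : Z' ∈ HH n)
    (ho : IsOpen Ω) (hs : Ω ⊆ HH n) (hd : HH n ⊆ closure Ω) (hi : ∀ γ : GZ n, ∀ Z ∈ Ω, act γ Z ∈ Ω)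
    (hσ : 1 < σ)
    (hg : ∀ x > 0, ∀ y ≥ 0, ‖g x y‖ ≤ C * (x ^ (-σ) * y ^ (-τ)))
    (hreg : ∀ Z ∈ Ω, Summable (poincareTerm g Z Z') ∧ ContDiffAt ℝ 2 (fun Z => poincare g Z Z') Z ∧
      lap (fun Z => poincare g Z Z') Z = lam * poincare g Z Z') :
    IsAutForm n Ω lam (fun Z => poincare g Z Z') where
  isOpen := ho
  subset := hs
  dense := hd
  act_mem := hi
  contDiffOn := fun Z hZ => (hreg Z hZ).2.1.contDiffWithinAt
  eigen := fun Z hZ => (hreg Z hZ).2.2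
  invariant := fun γ Z hZ => poincare_act hZ' γ (hs hZ)
  growth := by
    obtain ⟨V₀, hV₀, hV⟩ := exists_coefSize_le_strip hZ'
    obtain ⟨N₀, N0, hN⟩ := exists_coefSize_lower hZ'
    have hsum := summable_coefSize hZ' hσ
    have hv := im_pos hZ'
    set S := ∑' γ : GZ n, coefSize Z' γ ^ (-σ)
    have S0 : 0 ≤ S := tsum_nonneg fun γ => Real.rpow_nonneg (N0.le.trans (hN γ)) _
    -- In the strip x ≥ size/(80 v'ρ), with 80 = 4·20, and this accounts for ρ^σ. The factor y^{-τ}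
    -- equals β₀^{-τ}ρ^τ; since constant and exponent may not depend on β₀, the radius is taken at
    -- least β₀^{-τ}, at the cost of one more power of ρ.
    refine ⟨|C| * (80 * Z'.2.im) ^ σ * S + 1, by positivity, σ + τ + 1, fun β₀ =>
      ⟨max V₀ (β₀ ^ (-τ)), lt_of_lt_of_le (by linarith) (le_max_left _ _), fun Z hZ hβ hρ => ?_⟩⟩
    obtain ⟨γ₀, e1, e2, e3⟩ := exists_translation_strip Z
    rw [← poincare_act hZ' γ₀ (hs hZ)]
    have hW : act γ₀ Z ∈ Ω := hi γ₀ Z hZ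
    rw [← e2] at hρ ⊢
    rw [← e1] at hβ
    set W := act γ₀ Z
    have r1 : V₀ ≤ rho W := (le_max_left _ _).trans hρ
    have r2 : β₀ ^ (-τ) ≤ rho W := (le_max_right _ _).trans hρ
    have r0 : 0 < rho W := by linarith
    have him : V₀ ≤ W.2.im := by rw [im_eq]; linarith [beta_nonneg W]
    have hb0 : 0 ≤ β₀ := hβ ▸ beta_nonneg W
    have hterm : ∀ γ : GZ n, ‖poincareTerm g W Z' γ‖ ≤
        |C| * (80 * Z'.2.im) ^ σ * rho W ^ (σ + τ + 1) * coefSize Z' γ ^ (-σ) := fun γ => by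
      have hNγ := N0.trans_le (hN γ)
      have hx : coefSize Z' γ / (80 * Z'.2.im * rho W) ≤ xinv W (act γ Z') := by
        rw [xinv_act_eq hZ', div_le_div_iff₀ (by positivity) (by positivity)]
        have := hV W.2 him e3 γ
        have h4 : 0 < 4 * rho W * Z'.2.im := by positivity
        nlinarith
      have hx0 : 0 < coefSize Z' γ / (80 * Z'.2.im * rho W) := by positivity
      have hy : yinv W ^ (-τ) ≤ rho W ^ (τ + 1) := by
        rw [yinv, hβ, Real.div_rpow hb0 r0.le, Real.rpow_neg r0.le, div_inv_eq_mul,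
          Real.rpow_add r0, Real.rpow_one, mul_comm]
        gcongr
      have hy0 : 0 ≤ yinv W := div_nonneg (beta_nonneg W) r0.le
      calc ‖poincareTerm g W Z' γ‖ ≤ C * (xinv W (act γ Z') ^ (-σ) * yinv W ^ (-τ)) :=
            hg _ (hx0.trans_le hx) _ hy0
        _ ≤ |C| * (xinv W (act γ Z') ^ (-σ) * yinv W ^ (-τ)) := by
            gcongr
            · exact mul_nonneg (Real.rpow_nonneg (hx0.le.trans hx) _) (Real.rpow_nonneg hy0 _)
            · exact le_abs_self C
        _ ≤ |C| * ((coefSize Z' γ / (80 * Z'.2.im * rho W)) ^ (-σ) * rho W ^ (τ + 1)) := by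
            gcongr |C| * (?_ * ?_)
            exact Real.rpow_le_rpow_of_nonpos hx0 hx (by linarith)
        _ = _ := by
            rw [Real.div_rpow hNγ.le (by positivity), Real.rpow_neg (x := 80 * Z'.2.im * rho W) (by positivity),
              div_inv_eq_mul, Real.mul_rpow (by positivity) r0.le,
              show σ + τ + 1 = σ + (τ + 1) by ring, Real.rpow_add r0 σ]
            ring
    have := tsum_of_norm_bounded (hsum.hasSum.mul_left _) hterm
    refine this.trans ?_
    have : 0 ≤ rho W ^ (σ + τ + 1) := by positivity
    calc _ = |C| * (80 * Z'.2.im) ^ σ * S * rho W ^ (σ + τ + 1) := by ring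
      _ ≤ _ := by gcongr; linarith

end Poincare
end UnitaryForms
end

noncomputable section
namespace UnitaryForms

open Filter Topology MeasureTheory Set

/-! ### The hypergeometric kernels -/

/-- For positive x, y the integrand is evaluated on the negative axes only, so bounds of the factors
there are enough to dominate the kernels by their leading powers. -/
lemma norm_betaTransform_le {w : ℝ → ℂ} (hw : IntegrableOn w (Ioc 0 1)) {f₁ f₂ : ℂ → ℂ} {M₁ M₂ : ℝ}
    (h₁ : ∀ r : ℝ, 0 ≤ r → ‖f₁ (-r)‖ ≤ M₁) (h₂ : ∀ r : ℝ, 0 ≤ r → ‖f₂ (-r)‖ ≤ M₂)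
    {r₁ r₂ : ℝ} (hr₁ : 0 ≤ r₁) (hr₂ : 0 ≤ r₂) :
    ‖betaTransform w f₁ f₂ (-r₁, -r₂)‖ ≤ (∫ τ in Ioc (0 : ℝ) 1, ‖w τ‖) * (M₁ * M₂) := by
  have M₁0 : 0 ≤ M₁ := (norm_nonneg _).trans (h₁ 0 le_rfl)
  rw [← integral_mul_const]
  refine norm_integral_le_of_norm_le (hw.norm.mul_const _) ?_
  refine (ae_restrict_iff' measurableSet_Ioc).2 (Eventually.of_forall fun τ hτ => ?_)
  rw [norm_mul, norm_mul]
  have e1 : (τ : ℂ) * -(r₁ : ℂ) = -((τ * r₁ : ℝ) : ℂ) := by push_cast; ring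
  have e2 : (1 - τ : ℂ) * -(r₂ : ℂ) = -(((1 - τ) * r₂ : ℝ) : ℂ) := by push_cast; ring
  have k1 := h₁ (τ * r₁) (mul_nonneg hτ.1.le hr₁)
  have k2 := h₂ ((1 - τ) * r₂) (mul_nonneg (sub_nonneg.2 hτ.2) hr₂)
  simp only [e1, e2]
  gcongr

lemma norm_one_sub_cpow_le {a : ℂ} (ha : 0 ≤ a.re) (r : ℝ) (hr : 0 ≤ r) :
    ‖(1 - (-(r : ℂ))) ^ (-a)‖ ≤ 1 := by
  have : (1 - (-(r : ℂ))) = ((1 + r : ℝ) : ℂ) := by push_cast; ring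
  rw [this, Complex.norm_cpow_eq_rpow_re_of_pos (by linarith)]
  exact Real.rpow_le_one_of_one_le_of_nonpos (by linarith) (by simpa using ha)

lemma neg_ofReal_mem_cutPlane {r : ℝ} (hr : -1 < r) : -(r : ℂ) ∈ cutPlane := by
  refine Or.inl ?_
  simp; linarith

lemma exists_norm_gaussF_le {a b c : ℂ} (ha : 0 ≤ a.re) (hb : 0 < b.re) (hc : 0 < (c - b).re) :
    ∃ M : ℝ, 0 ≤ M ∧ ∀ r : ℝ, 0 ≤ r → ‖gaussF a b c (-r)‖ ≤ M := by
  have h0 : 0 ≤ ∫ τ in Ioc (0 : ℝ) 1, ‖betaWeight b (c - b) τ‖ := integral_nonneg fun _ => norm_nonneg _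
  refine ⟨(∫ τ in Ioc (0 : ℝ) 1, ‖betaWeight b (c - b) τ‖) * (1 * 1), by positivity, fun r hr => ?_⟩
  have hm : ((-(r : ℂ), -((0 : ℝ) : ℂ)) : ℂ × ℂ) ∈ cutPlane ×ˢ cutPlane :=
    ⟨neg_ofReal_mem_cutPlane (by linarith), neg_ofReal_mem_cutPlane (by norm_num)⟩
  have e := gaussF_eq (a := a) hb hc hm
  simp only at e
  rw [e]
  exact norm_betaTransform_le (integrableOn_betaWeight hb hc) (norm_one_sub_cpow_le ha)
    (fun _ _ => by simp) hr le_rfl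

lemma ofReal_cpow_neg {x : ℝ} (hx : 0 ≤ x) (s : ℂ) : (x : ℂ) ^ (-s) = ((x⁻¹ : ℝ) : ℂ) ^ s := by
  rw [Complex.ofReal_inv, Complex.inv_cpow _ _ (by
    rw [Complex.arg_ofReal_of_nonneg hx]; exact Real.pi_pos.ne), Complex.cpow_neg]

/-! #### The degenerate kernels -/

/-- The degenerate kernels as functions of `x + ε y`, `ε = 0, 1`. -/
def gaussKer (n : ℕ) (s : ℂ) (ε x : ℝ) : ℂ :=
  (x : ℂ) ^ (-s) * gaussF s (s - ε * n) (2 * s - n) (-(x : ℂ)⁻¹)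

lemma kerX_eq (n : ℕ) (s : ℂ) : kerX n s = fun x y => gaussKer n s 0 (x + 0 * y) := by
  funext x y; simp [kerX, gaussKer]

lemma kerXY_eq (n : ℕ) (s : ℂ) : kerXY n s = fun x y => gaussKer n s 1 (x + 1 * y) := by
  funext x y; simp [kerXY, gaussKer]

/-- The weight of the degenerate kernels. -/
def gaussKerWeight (n : ℕ) (s : ℂ) (ε : ℝ) : ℝ → ℂ :=
  betaWeight (s - ε * n) (2 * s - n - (s - ε * n))

section Degenerate
variable {n : ℕ} {s : ℂ} {ε : ℝ}

lemma gaussKer_param (hs : (n : ℝ) < s.re) (hε : ε = 0 ∨ ε = 1) :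
    0 < s.re ∧ 0 < (s - ε * n).re ∧ 0 < (2 * s - n - (s - ε * n)).re := by
  have hn : (0 : ℝ) ≤ n := n.cast_nonneg
  have e1 : (s - ε * n).re = s.re - ε * n := by simp
  have e2 : (2 * s - n - (s - ε * n)).re = s.re - n + ε * n := by simp; ring
  rw [e1, e2]
  rcases hε with rfl | rfl <;> exact ⟨by linarith, by linarith, by linarith⟩

/-- Taking b = 0, f₂ = 1 and second variable 1 places the one-variable kernels within the
two-variable formalism. -/
lemma gaussKer_eq_betaKernel (hs : (n : ℝ) < s.re) (hε : ε = 0 ∨ ε = 1) {x : ℝ} (hx : 0 < x) :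
    gaussKer n s ε x = betaKernel s 0 (gaussKerWeight n s ε) (fun z => (1 - z) ^ (-s))
      (fun _ => 1) ((x : ℂ), 1) := by
  obtain ⟨-, h1, h2⟩ := gaussKer_param hs hε
  have hm : ((x : ℂ), (1 : ℂ)) ∈ posQuadrant := ⟨by simpa using hx, by simp⟩
  rw [gaussKer, betaKernel, neg_zero, Complex.cpow_zero, mul_one]
  congr 1
  exact gaussF_eq h1 h2 (neg_inv_mem hm)

lemma euler_zero_one : euler 0 (fun _ => (1 : ℂ)) = fun _ => 0 := by
  funext z; simp [euler]

lemma betaKernel_zero_right (a b : ℂ) (w : ℝ → ℂ) (f : ℂ → ℂ) (q : ℂ × ℂ) :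
    betaKernel a b w f (fun _ => 0) q = 0 := by simp [betaKernel, betaTransform]

lemma euler_zero_zero : euler 0 (fun _ => (0 : ℂ)) = fun _ => 0 := by
  funext z; simp [euler]

/-- The terms of the degenerate Poincaré series are eigenfunctions. -/
lemma lap_gaussKer (hs : (n : ℝ) < s.re) (hε : ε = 0 ∨ ε = 1) {Z Z' : Pt n} (hZ : Z ∈ HH n)
    (hZ' : Z' ∈ HH n) (h0 : 0 < xinv Z Z' + ε * yinv Z) :
    lap (fun Z => gaussKer n s ε (xinv Z Z' + ε * yinv Z)) Z =
      s * (s - n - 1) * gaussKer n s ε (xinv Z Z' + ε * yinv Z) := by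
  obtain ⟨-, h1, h2⟩ := gaussKer_param hs hε
  have hw : IntegrableOn (gaussKerWeight n s ε) (Ioc 0 1) := integrableOn_betaWeight h1 h2
  have d1 := differentiableOn_one_sub_cpow s
  have d2 : DifferentiableOn ℂ (fun _ : ℂ => (1 : ℂ)) cutPlane := differentiableOn_const 1
  have hq : (((xinv Z Z' + ε * yinv Z : ℝ) : ℂ), (1 : ℂ)) ∈ posQuadrant :=
    ⟨by rw [Complex.ofReal_re]; exact h0, by simp⟩
  have hc : ContinuousAt (fun W : Pt n => xinv W Z' + ε * yinv W) Z := by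
    have hcr : Continuous (rho : Pt n → ℝ) := (contDiff_rho (m := 0)).continuous
    have hcb : Continuous (beta : Pt n → ℝ) := (contDiff_beta (m := 0)).continuous
    have hr := (rho_pos hZ).ne'
    have hv := (im_pos hZ').ne'
    simp only [xinv_eq, yinv]
    refine ContinuousAt.add (ContinuousAt.div ?_ (by fun_prop) (by positivity))
      (continuousAt_const.mul (hcb.continuousAt.div hcr.continuousAt hr))
    exact (Complex.continuous_normSq.comp (by fun_prop)).continuousAt
  have hf : (fun Z => gaussKer n s ε (xinv Z Z' + ε * yinv Z)) =ᶠ[𝓝 Z] fun Z =>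
      betaKernel s 0 (gaussKerWeight n s ε) (fun z => (1 - z) ^ (-s)) (fun _ => 1)
        (((xinv Z Z' + ε * yinv Z : ℝ) : ℂ), 1) := by
    filter_upwards [hc.eventually (isOpen_Ioi.mem_nhds h0)] with W hW
    exact gaussKer_eq_betaKernel hs hε hW
  rw [lap_x_add hZ hZ' hε hf (contDiffAt_betaKernel hw d1 d2 s 0 hq)
    (thetaSystem_betaKernel hw d1 d2 s 0 hq) h0.ne', gaussKer_eq_betaKernel hs hε h0]
  -- With b = 0 the operator `euler 0` kills the constant f₂ and all coefficients with k ≠ 0 vanish,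
  -- so the hypergeometric equation in x alone remains. The exponent 1+εn yields the parameter s−εn.
  have hp := betaKernel_pde hw d1 d2 (hasCoeffs_one_sub_cpow s) hasCoeffs_one s 0 n (1 + ε * n) 1
    (fun m k => if k = 0 then poch s m * poch (s - ε * n) m / (poch (2 * s - n) m * m.factorial) else 0)
    (fun m k => ?_) (fun m k => ?_) (fun m k => ?_) hq
  · rw [euler_zero_one, euler_zero_zero] at hp
    simp only [betaKernel_zero_right] at hp
    linear_combination hp
  · rw [gaussKerWeight, betaWeight_moment h1 h2]
    split_ifs with hk
    · subst hk
      rw [poch_zero, add_zero, show s - ε * n + (2 * s - n - (s - ε * n)) = 2 * s - n by ring]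
      ring
    · simp
  · split_ifs with hk
    · subst hk
      rw [poch_succ, poch_succ, poch_succ, Nat.factorial_succ]
      have hc0 : 0 < (2 * s - n).re := by simp at h1 h2 ⊢; linarith
      have n1 : (2 * s - n : ℂ) + m ≠ 0 := add_natCast_ne_zero hc0 m
      have n2 : poch (2 * s - n) m ≠ 0 := poch_ne_zero hc0 m
      have n3 : (m.factorial : ℂ) ≠ 0 := by exact_mod_cast m.factorial_ne_zero
      have n4 : (m : ℂ) + 1 ≠ 0 := by exact_mod_cast m.succ_ne_zero
      push_cast
      have e : (2 * (s + 0) - n + m + 0 : ℂ) = 2 * s - n + m := by ring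
      rw [e]
      generalize (2 * s - n + m : ℂ) = A at *
      field_simp
      ring
    · simp
  · rw [if_neg (Nat.succ_ne_zero k)]
    rcases k with _ | k
    · simp
    · simp

lemma exists_norm_gaussKer_le (hs : (n : ℝ) < s.re) (hε : ε = 0 ∨ ε = 1) :
    ∃ C : ℝ, ∀ x > 0, ∀ y ≥ 0, ‖gaussKer n s ε (x + ε * y)‖ ≤ C * (x ^ (-s.re) * y ^ (-(0 : ℝ))) := by
  obtain ⟨h0, h1, h2⟩ := gaussKer_param hs hε
  obtain ⟨M, M0, hM⟩ := exists_norm_gaussF_le h0.le h1 h2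
  refine ⟨M, fun x hx y hy => ?_⟩
  have hε0 : 0 ≤ ε := by rcases hε with rfl | rfl <;> norm_num
  have hX : x ≤ x + ε * y := by nlinarith [mul_nonneg hε0 hy]
  have hX0 : 0 < x + ε * y := hx.trans_le hX
  rw [gaussKer, norm_mul, Complex.norm_cpow_eq_rpow_re_of_pos hX0, neg_zero, Real.rpow_zero, mul_one,
    mul_comm]
  have := hM (x + ε * y)⁻¹ (inv_nonneg.2 hX0.le)
  rw [Complex.ofReal_inv] at this
  rw [Complex.neg_re]
  refine mul_le_mul this ?_ (by positivity) M0
  exact Real.rpow_le_rpow_of_nonpos hx hX (by linarith)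

/-- Termwise differentiation of the degenerate Poincaré series. -/
lemma poincare_gaussKer_regular (hn : 1 ≤ n) (hs : (n : ℝ) < s.re) (hε : ε = 0 ∨ ε = 1) {Z Z' : Pt n}
    (hZ : Z ∈ HH n) (hZ' : Z' ∈ HH n)
    (hκ : ∃ κ > 0, ∀ γ : GZ n, κ * coefSize Z' γ ≤
      ‖coefP Z' γ * Z.2 + coefQ Z' γ‖ ^ 2 + 4 * Z'.2.im * ε * beta Z) :
    let g := fun x y => gaussKer n s ε (x + ε * y)
    Summable (poincareTerm g Z Z') ∧ ContDiffAt ℝ 2 (fun Z => poincare g Z Z') Z ∧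
      lap (fun Z => poincare g Z Z') Z = s * (s - n - 1) * poincare g Z Z' := by
  intro g
  obtain ⟨κ, κ0, hκ⟩ := hκ
  obtain ⟨h0, h1, h2⟩ := gaussKer_param hs hε
  obtain ⟨N₀, N0, hN⟩ := exists_coefSize_lower hZ'
  have hn1 : (1 : ℝ) ≤ n := by exact_mod_cast hn
  have hv := im_pos hZ'
  have hcr : ContDiff ℝ 2 (rho : Pt n → ℝ) := contDiff_rho
  have hcb : ContDiff ℝ 2 (beta : Pt n → ℝ) := contDiff_beta
  -- Over the denominator 4ρv' the argument is a squared linear form plus e(W) = 4v'εβ(W), the shape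
  -- required by `tsum_pair_lap`.
  have key : ∀ γ : GZ n, ∀ W ∈ HH n, xinv W (act γ Z') + ε * yinv W =
      (‖coefP Z' γ * W.2 + coefQ Z' γ‖ ^ 2 + 4 * Z'.2.im * ε * beta W) / (4 * rho W * Z'.2.im) := fun γ W hW => by
    have hr := (rho_pos hW).ne'
    rw [xinv_act_eq hZ', yinv]
    field_simp
  set v := Z'.2.im
  have hco : Continuous fun q : ℝ × Pt n => 4 * rho q.2 * v * q.1 :=
    ((continuous_const.mul (hcr.continuous.comp continuous_snd)).mul continuous_const).mul continuous_fst
  -- Here X is the reciprocal of the numerator, so the inverse of the argument is 4ρv'X; the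
  -- condition −1 < 4ρv'X is an open neighbourhood of X ≥ 0 on which the negative of this stays in
  -- the cut plane.
  refine tsum_pair_lap (f := fun γ W => poincareTerm g W Z' γ) (P := coefP Z') (Q := coefQ Z') (a := s)
    (e := fun W => 4 * v * ε * beta W) (U := HH n)
    (H := fun q => ((4 * rho q.2 * v : ℝ) : ℂ) ^ s *
      gaussF s (s - ε * n) (2 * s - n) (-((4 * rho q.2 * v * q.1 : ℝ) : ℂ)))
    (V := {q | 0 < rho q.2} ∩ {q | -1 < 4 * rho q.2 * v * q.1})
    N0 hN (summable_coefSize hZ' (by linarith)) (by fun_prop) ?_ ?_ ?_ κ0 hκ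
    ((isOpen_HH n).mem_nhds hZ) ?_ ?_
  · exact (isOpen_lt continuous_const (hcr.continuous.comp continuous_snd)).inter
      (isOpen_lt continuous_const hco)
  · rintro q ⟨q1, q2⟩
    have q1 : 0 < rho q.2 := q1
    have hrr : ContDiffAt ℝ 2 (fun q : ℝ × Pt n => rho q.2) q := (hcr.comp contDiff_snd).contDiffAt
    have c1 : ContDiffAt ℝ 2 (fun q : ℝ × Pt n => ((4 * rho q.2 * v : ℝ) : ℂ) ^ s) q :=
      contDiffAt_ofReal_cpow (by fun_prop) (by positivity) s
    have c2 : ContDiffAt ℝ 2 (fun q : ℝ × Pt n => -((4 * rho q.2 * v * q.1 : ℝ) : ℂ)) q :=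
      (Complex.ofRealCLM.contDiff.contDiffAt.comp q
        (f := fun q : ℝ × Pt n => 4 * rho q.2 * v * q.1) (by fun_prop)).neg
    have c3 : ContDiffAt ℝ 2 (gaussF s (s - ε * n) (2 * s - n)) (-((4 * rho q.2 * v * q.1 : ℝ) : ℂ)) :=
      (((gaussF_spec h1 h2).1.contDiffOn isOpen_cutPlane).contDiffAt
        (isOpen_cutPlane.mem_nhds (neg_ofReal_mem_cutPlane q2))).restrict_scalars ℝ
    exact (c1.mul (ContDiffAt.comp (g := gaussF s (s - ε * n) (2 * s - n)) q c3 c2)).contDiffWithinAt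
  · intro X hX
    have hr := rho_pos hZ
    refine ⟨hr, ?_⟩
    change -1 < 4 * rho Z * v * X
    have : 0 ≤ 4 * rho Z * v * X := by positivity
    linarith
  · intro W hW γ
    have hr := rho_pos hW
    have hε0 : 0 ≤ ε := by rcases hε with rfl | rfl <;> norm_num
    have hb := beta_nonneg W
    simp only [poincareTerm, g, gaussKer]
    rw [key γ W hW, ← Complex.ofReal_inv, ofReal_cpow_neg (by positivity)]
    set D := ‖coefP Z' γ * W.2 + coefQ Z' γ‖ ^ 2 + 4 * v * ε * beta W with hD
    have D0 : 0 ≤ D := by positivity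
    rw [inv_div, div_eq_mul_inv, mul_comm _ D⁻¹, Complex.ofReal_mul D⁻¹,
      Complex.mul_cpow_ofReal_nonneg (by positivity) (by positivity), mul_assoc]
  · intro γ
    have hr := rho_pos hZ
    have hNγ := N0.trans_le (hN γ)
    refine lap_gaussKer hs hε hZ (act_mem_HH γ hZ') ?_
    rw [key γ Z hZ]
    have := hκ γ
    exact div_pos (lt_of_lt_of_le (by positivity) this) (by positivity)

theorem isAutForm_poincare_kerX (hn : 1 ≤ n) (hs : (n : ℝ) < s.re) {Z' : Pt n} (hZ' : Z' ∈ HH n) :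
    (∀ Z ∈ regX Z', Summable (poincareTerm (kerX n s) Z Z')) ∧
      IsAutForm n (regX Z') (s * (s - n - 1)) (fun Z => poincare (kerX n s) Z Z') := by
  have hreg := fun Z (hZ : Z ∈ regX Z') => poincare_gaussKer_regular hn hs (Or.inl rfl) hZ.1 hZ' (by
    simpa using exists_coefSize_le_of_not_sameOrbit hZ.1 hZ' hZ.2)
  obtain ⟨C, hC⟩ := exists_norm_gaussKer_le hs (Or.inl rfl)
  rw [kerX_eq]
  have hn1 : (1 : ℝ) ≤ n := by exact_mod_cast hn
  exact ⟨fun Z hZ => (hreg Z hZ).1, isAutForm_poincare hZ' (isOpen_regX hZ') (fun Z hZ => hZ.1)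
    ((HH_subset_closure_regF3 hn Z').trans (closure_mono (regF3_subset_regX Z')))
    (fun γ Z hZ => act_mem_regX hZ' γ hZ) (hn1.trans_lt hs) hC hreg⟩

/-- For z ≠ 0 the term 4v'β takes over the role of 4v' Im w in `exists_coefSize_le`, with the loss
of a factor β/Im w ≤ 1; the bound then also holds on the orbit of z'_{n+1}. -/
lemma exists_coefSize_le_of_mem_regXY {Z Z' : Pt n} (hZ' : Z' ∈ HH n) (hZ : Z ∈ regXY Z') :
    ∃ κ > 0, ∀ γ : GZ n, κ * coefSize Z' γ ≤
      ‖coefP Z' γ * Z.2 + coefQ Z' γ‖ ^ 2 + 4 * Z'.2.im * 1 * beta Z := by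
  have hv := im_pos hZ.1
  have hv' := im_pos hZ'
  have hb := beta_nonneg Z
  rcases hZ.2 with h | h
  · obtain ⟨κ, κ0, hκ⟩ := exists_coefSize_le hZ' hv
    have hb := beta_pos h
    have hle : beta Z / Z.2.im ≤ 1 := by rw [div_le_one hv, im_eq]; linarith [rho_pos hZ.1]
    refine ⟨beta Z / Z.2.im * κ, by positivity, fun γ => ?_⟩
    calc beta Z / Z.2.im * κ * coefSize Z' γ ≤ beta Z / Z.2.im *
          (‖coefP Z' γ * Z.2 + coefQ Z' γ‖ ^ 2 + 4 * Z.2.im * Z'.2.im) := by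
          rw [mul_assoc]; gcongr; exact hκ γ
      _ = beta Z / Z.2.im * ‖coefP Z' γ * Z.2 + coefQ Z' γ‖ ^ 2 + 4 * Z'.2.im * 1 * beta Z := by
          field_simp
      _ ≤ _ := by
          gcongr
          exact mul_le_of_le_one_left (by positivity) hle
  · obtain ⟨κ, κ0, hκ⟩ := exists_coefSize_le_of_not_sameOrbit hZ.1 hZ' h
    exact ⟨κ, κ0, fun γ => (hκ γ).trans (by have : 0 ≤ 4 * Z'.2.im * 1 * beta Z := by positivity
                                            linarith)⟩

theorem isAutForm_poincare_kerXY (hn : 1 ≤ n) (hs : (n : ℝ) < s.re) {Z' : Pt n} (hZ' : Z' ∈ HH n) :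
    (∀ Z ∈ regXY Z', Summable (poincareTerm (kerXY n s) Z Z')) ∧
      IsAutForm n (regXY Z') (s * (s - n - 1)) (fun Z => poincare (kerXY n s) Z Z') := by
  have hreg := fun Z (hZ : Z ∈ regXY Z') => poincare_gaussKer_regular hn hs (Or.inr rfl) hZ.1 hZ'
    (exists_coefSize_le_of_mem_regXY hZ' hZ)
  obtain ⟨C, hC⟩ := exists_norm_gaussKer_le hs (Or.inr rfl)
  rw [kerXY_eq]
  have hn1 : (1 : ℝ) ≤ n := by exact_mod_cast hn
  refine ⟨fun Z hZ => (hreg Z hZ).1, isAutForm_poincare hZ' (isOpen_regXY hZ') (fun Z hZ => hZ.1)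
    ((HH_subset_closure_regF3 hn Z').trans (closure_mono
      ((regF3_subset_regX Z').trans (regX_subset_regXY Z'))))
    (fun γ Z hZ => ?_) (hn1.trans_lt hs) hC hreg⟩
  rw [regXY_eq] at hZ ⊢
  exact hZ.imp (act_mem_offAxis γ) (act_mem_regX hZ' γ)

end Degenerate
end UnitaryForms
end

noncomputable section
namespace UnitaryForms

open Filter Topology MeasureTheory Set

/-! #### The nondegenerate kernel -/

section Nondegenerate
variable {n : ℕ} {a b : ℂ}

/-- Positivity conditions for the iterated Euler integral with b' = b−n+1 and d = a+2b−n; note that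
d − b' = a+b−1. -/
lemma kerF3_param (ha : 1 < a.re) (hb : (n : ℝ) - 1 < b.re) (hn : 1 ≤ n) :
    0 < a.re ∧ 0 < b.re ∧ 0 < (b - n + 1).re ∧ 0 < (a + 2 * b - n - (b - n + 1)).re ∧
      0 < (a + 2 * b - n).re := by
  have hn1 : (1 : ℝ) ≤ n := by exact_mod_cast hn
  simp
  refine ⟨by linarith, by linarith, by linarith, by linarith, by linarith⟩

lemma appellF3_kerF3 (ha : 1 < a.re) (hb : (n : ℝ) - 1 < b.re) (hn : 1 ≤ n)
    {p : ℂ × ℂ} (hp : p ∈ cutPlane ×ˢ cutPlane) :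
    appellF3 a b a (b - n + 1) (2 * (a + b) - n) p =
      appellIntegral a b (b - n + 1) (a + 2 * b - n) p := by
  obtain ⟨h1, h2, h3, h4, h5⟩ := kerF3_param ha hb hn
  rw [← appellF3_eq h1 h3 h4 hp]
  congr 1; ring

lemma kerF3_eq_betaKernel (ha : 1 < a.re) (hb : (n : ℝ) - 1 < b.re)
    (hn : 1 ≤ n) {x y : ℝ} (hx : 0 < x) (hy : 0 < y) :
    kerF3 n a b x y = betaKernel a b (betaWeight a (a + 2 * b - n)) (fun z => (1 - z) ^ (-a))
      (gaussF b (b - n + 1) (a + 2 * b - n)) ((x : ℂ), (y : ℂ)) := by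
  have hm : ((x : ℂ), (y : ℂ)) ∈ posQuadrant := ⟨by simpa using hx, by simpa using hy⟩
  rw [kerF3, betaKernel, appellF3_kerF3 ha hb hn (neg_inv_mem hm)]
  rfl

lemma continuousAt_xinv {Z Z' : Pt n} (hZ : Z ∈ HH n) (hZ' : Z' ∈ HH n) :
    ContinuousAt (fun W => xinv W Z') Z := by
  have hcr : Continuous (rho : Pt n → ℝ) := (contDiff_rho (m := 0)).continuous
  have hr := (rho_pos hZ).ne'
  have hv := (im_pos hZ').ne'
  simp only [xinv_eq]
  exact ContinuousAt.div (Complex.continuous_normSq.comp (by fun_prop)).continuousAt (by fun_prop)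
    (by positivity)

lemma continuousAt_yinv {Z : Pt n} (hZ : Z ∈ HH n) : ContinuousAt (yinv : Pt n → ℝ) Z :=
  (contDiff_beta (m := 0)).continuous.continuousAt.div (contDiff_rho (m := 0)).continuous.continuousAt
    (rho_pos hZ).ne'

lemma yinv_pos {Z : Pt n} (hZ : Z ∈ offAxis n) : 0 < yinv Z := div_pos (beta_pos hZ.2) (rho_pos hZ.1)

/-- The terms of the nondegenerate Poincaré series are eigenfunctions. -/
lemma lap_kerF3 (ha : 1 < a.re) (hb : (n : ℝ) - 1 < b.re)
    (hn : 1 ≤ n) {Z Z' : Pt n} (hZ : Z ∈ offAxis n) (hZ' : Z' ∈ HH n) (h0 : 0 < xinv Z Z') :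
    lap (fun Z => kerF3 n a b (xinv Z Z') (yinv Z)) Z =
      (a + b) * (a + b - n - 1) * kerF3 n a b (xinv Z Z') (yinv Z) := by
  obtain ⟨h1, h2, h3, h4, h5⟩ := kerF3_param ha hb hn
  have hw := integrableOn_betaWeight h1 h5
  have d1 := differentiableOn_one_sub_cpow a
  have d2 := (gaussF_spec (a := b) h3 h4).1
  have hy := yinv_pos hZ
  have hq : ((xinv Z Z' : ℂ), (yinv Z : ℂ)) ∈ posQuadrant :=
    ⟨by rw [Complex.ofReal_re]; exact h0, by rw [Complex.ofReal_re]; exact hy⟩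
  have hf : (fun Z => kerF3 n a b (xinv Z Z') (yinv Z)) =ᶠ[𝓝 Z] fun Z =>
      betaKernel a b (betaWeight a (a + 2 * b - n)) (fun z => (1 - z) ^ (-a))
      (gaussF b (b - n + 1) (a + 2 * b - n)) ((xinv Z Z' : ℂ), (yinv Z : ℂ)) := by
    filter_upwards [(continuousAt_xinv hZ.1 hZ').eventually (isOpen_Ioi.mem_nhds h0),
      (continuousAt_yinv hZ.1).eventually (isOpen_Ioi.mem_nhds hy)] with W hW hW'
    exact kerF3_eq_betaKernel ha hb hn hW hW'
  rw [lap_xy hZ.1 hZ' hf (contDiffAt_betaKernel hw d1 d2 a b hq)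
    (thetaSystem_betaKernel hw d1 d2 a b hq) h0.ne' hy.ne', kerF3_eq_betaKernel ha hb hn h0 hy]
  -- The exponents e₁ = 1 and e₂ = n are read off from L in the variables x, y; they give the lower
  -- pair a−e₁+1 = a and b−e₂+1 = b−n+1 of parameters of F₃.
  refine betaKernel_pde hw d1 d2 (hasCoeffs_one_sub_cpow a) (gaussF_spec h3 h4).2 a b n 1 n
    (fun m k => poch a m * poch b k * poch a m * poch (b - n + 1) k /
      (poch (2 * (a + b) - n) (m + k) * m.factorial * k.factorial))
    (fun m k => ?_) (fun m k => ?_) (fun m k => ?_) hq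
  · rw [betaWeight_moment h1 h5, show a + (a + 2 * b - n) = 2 * (a + b) - n by ring]
    have := poch_ne_zero h5 k
    generalize poch (a + 2 * b - n) k = A at *
    field_simp
  all_goals
    have hc0 : 0 < (2 * (a + b) - n).re := by simp at h1 h5 ⊢; linarith
    have n1 := add_natCast_ne_zero hc0 (m + k)
    have n2 := poch_ne_zero hc0 (m + k)
    have n3 : (m.factorial : ℂ) ≠ 0 := by exact_mod_cast m.factorial_ne_zero
    have n4 : (k.factorial : ℂ) ≠ 0 := by exact_mod_cast k.factorial_ne_zero
    have n5 : (m : ℂ) + 1 ≠ 0 := by exact_mod_cast m.succ_ne_zero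
    have n6 : (k : ℂ) + 1 ≠ 0 := by exact_mod_cast k.succ_ne_zero
    push_cast at n1
  · rw [show m + 1 + k = m + k + 1 by ring, poch_succ, poch_succ, Nat.factorial_succ]
    push_cast
    rw [show (2 * (a + b) - n + m + k : ℂ) = 2 * (a + b) - n + (m + k) by ring]
    generalize (2 * (a + b) - n + (m + k) : ℂ) = A at *
    field_simp
    ring
  · rw [show m + (k + 1) = m + k + 1 by ring, poch_succ b, poch_succ (b - n + 1), poch_succ (2 * (a + b) - n),
      Nat.factorial_succ]
    push_cast
    rw [show (2 * (a + b) - n + m + k : ℂ) = 2 * (a + b) - n + (m + k) by ring]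
    generalize (2 * (a + b) - n + (m + k) : ℂ) = A at *
    field_simp
    ring

lemma exists_norm_kerF3_le (ha : 1 < a.re) (hb : (n : ℝ) - 1 < b.re)
    (hn : 1 ≤ n) :
    ∃ C : ℝ, ∀ x > 0, ∀ y ≥ 0, ‖kerF3 n a b x y‖ ≤ C * (x ^ (-a.re) * y ^ (-b.re)) := by
  obtain ⟨h1, h2, h3, h4, h5⟩ := kerF3_param ha hb hn
  obtain ⟨M, M0, hM⟩ := exists_norm_gaussF_le h2.le h3 h4
  have hI : 0 ≤ ∫ τ in Ioc (0 : ℝ) 1, ‖betaWeight a (a + 2 * b - n) τ‖ :=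
    integral_nonneg fun _ => norm_nonneg _
  refine ⟨(∫ τ in Ioc (0 : ℝ) 1, ‖betaWeight a (a + 2 * b - n) τ‖) * (1 * M), fun x hx y hy => ?_⟩
  rcases hy.lt_or_eq with hy | hy
  · rw [kerF3, norm_mul, norm_mul, Complex.norm_cpow_eq_rpow_re_of_pos hx,
      Complex.norm_cpow_eq_rpow_re_of_pos hy, mul_comm, Complex.neg_re, Complex.neg_re]
    gcongr
    have hm : ((-(x : ℂ)⁻¹, -(y : ℂ)⁻¹) : ℂ × ℂ) ∈ cutPlane ×ˢ cutPlane :=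
      neg_inv_mem (q := ((x : ℂ), (y : ℂ))) ⟨by simpa using hx, by simpa using hy⟩
    rw [appellF3_kerF3 ha hb hn hm, ← Complex.ofReal_inv, ← Complex.ofReal_inv]
    exact norm_betaTransform_le (integrableOn_betaWeight h1 h5) (norm_one_sub_cpow_le h1.le) hM
      (inv_nonneg.2 hx.le) (inv_nonneg.2 hy.le)
  -- At y = 0 the kernel has the default value 0, because 0^{-b} = 0 for b ≠ 0.
  · have hb0 : b ≠ 0 := fun h => by simp [h] at h2
    rw [kerF3, ← hy, Complex.ofReal_zero, Complex.zero_cpow (neg_ne_zero.2 hb0)]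
    simp only [mul_zero, zero_mul, norm_zero]
    positivity

/-- Termwise differentiation of the nondegenerate Poincaré series. -/
lemma poincare_kerF3_regular (ha : 1 < a.re) (hb : (n : ℝ) - 1 < b.re)
    (hn : 1 ≤ n) {Z Z' : Pt n} (hZ : Z ∈ offAxis n) (hZ' : Z' ∈ HH n) {ι : Type*} (i : ι → GZ n)
    (hi : Function.Injective i) (hκ : ∃ κ > 0, ∀ j, κ * coefSize Z' (i j) ≤
      ‖coefP Z' (i j) * Z.2 + coefQ Z' (i j)‖ ^ 2) :
    let f := fun Z j => poincareTerm (kerF3 n a b) Z Z' (i j)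
    Summable (f Z) ∧ ContDiffAt ℝ 2 (fun Z => ∑' j, f Z j) Z ∧
      lap (fun Z => ∑' j, f Z j) Z = (a + b) * (a + b - n - 1) * ∑' j, f Z j := by
  intro f
  obtain ⟨κ, κ0, hκ⟩ := hκ
  obtain ⟨h1, h2, h3, h4, h5⟩ := kerF3_param ha hb hn
  obtain ⟨N₀, N0, hN⟩ := exists_coefSize_lower hZ'
  have hv := im_pos hZ'
  have hcr : ContDiff ℝ 2 (rho : Pt n → ℝ) := contDiff_rho
  have hcb : ContDiff ℝ 2 (beta : Pt n → ℝ) := contDiff_beta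
  have hcF : ContDiffOn ℂ 2 (appellF3 a b a (b - n + 1) (2 * (a + b) - n)) (cutPlane ×ˢ cutPlane) :=
    (contDiffOn_betaTransform 2 (integrableOn_betaWeight h1 h5) (differentiableOn_one_sub_cpow a)
      (gaussF_spec h3 h4).1).congr fun p hp => appellF3_kerF3 ha hb hn hp
  have key : ∀ γ : GZ n, ∀ W ∈ HH n, xinv W (act γ Z') =
      (‖coefP Z' γ * W.2 + coefQ Z' γ‖ ^ 2 + 0) / (4 * rho W * Z'.2.im) := fun γ W hW => by
    rw [xinv_act_eq hZ', add_zero]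
  set v := Z'.2.im
  have hco : Continuous fun q : ℝ × Pt n => 4 * rho q.2 * v * q.1 :=
    ((continuous_const.mul (hcr.continuous.comp continuous_snd)).mul continuous_const).mul continuous_fst
  -- The sum runs over an injective family in the group, so that the same argument covers the full
  -- series and the series with the stabilising terms removed.
  refine tsum_pair_lap (f := fun j W => poincareTerm (kerF3 n a b) W Z' (i j))
    (P := fun j => coefP Z' (i j)) (Q := fun j => coefQ Z' (i j)) (a := a)
    (e := fun W => 0) (U := offAxis n)
    (H := fun q => ((4 * rho q.2 * v : ℝ) : ℂ) ^ a * (((yinv q.2)⁻¹ : ℝ) : ℂ) ^ b *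
      appellF3 a b a (b - n + 1) (2 * (a + b) - n)
        (-((4 * rho q.2 * v * q.1 : ℝ) : ℂ), -(((yinv q.2)⁻¹ : ℝ) : ℂ)))
    (V := {q | q.2 ∈ offAxis n} ∩ {q | -1 < 4 * rho q.2 * v * q.1})
    N0 (fun j => hN (i j)) ((summable_coefSize hZ' ha).comp_injective hi) contDiff_const ?_ ?_ ?_ κ0
    (fun j => (hκ j).trans (by simp)) ((isOpen_offAxis n).mem_nhds hZ) ?_ ?_
  · exact ((isOpen_offAxis n).preimage continuous_snd).inter (isOpen_lt continuous_const hco)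
  · rintro q ⟨q1, q2⟩
    have q1 : q.2 ∈ offAxis n := q1
    have hr := rho_pos q1.1
    have hy := yinv_pos q1
    have hrr : ContDiffAt ℝ 2 (fun q : ℝ × Pt n => rho q.2) q := (hcr.comp contDiff_snd).contDiffAt
    have hbb : ContDiffAt ℝ 2 (fun q : ℝ × Pt n => beta q.2) q := (hcb.comp contDiff_snd).contDiffAt
    have hyy : ContDiffAt ℝ 2 (fun q : ℝ × Pt n => (yinv q.2)⁻¹) q := (hbb.div hrr hr.ne').inv hy.ne'
    have c1 : ContDiffAt ℝ 2 (fun q : ℝ × Pt n => ((4 * rho q.2 * v : ℝ) : ℂ) ^ a) q :=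
      contDiffAt_ofReal_cpow (by fun_prop) (by positivity) a
    have c1' : ContDiffAt ℝ 2 (fun q : ℝ × Pt n => (((yinv q.2)⁻¹ : ℝ) : ℂ) ^ b) q :=
      contDiffAt_ofReal_cpow hyy (inv_pos.2 hy) b
    have c2 : ContDiffAt ℝ 2 (fun q : ℝ × Pt n => -((4 * rho q.2 * v * q.1 : ℝ) : ℂ)) q :=
      (Complex.ofRealCLM.contDiff.contDiffAt.comp q
        (f := fun q : ℝ × Pt n => 4 * rho q.2 * v * q.1) (by fun_prop)).neg
    have c2' : ContDiffAt ℝ 2 (fun q : ℝ × Pt n => -(((yinv q.2)⁻¹ : ℝ) : ℂ)) q :=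
      (Complex.ofRealCLM.contDiff.contDiffAt.comp q
        (f := fun q : ℝ × Pt n => (yinv q.2)⁻¹) hyy).neg
    have c3 : ContDiffAt ℝ 2 (appellF3 a b a (b - n + 1) (2 * (a + b) - n))
        (-((4 * rho q.2 * v * q.1 : ℝ) : ℂ), -(((yinv q.2)⁻¹ : ℝ) : ℂ)) :=
      (hcF.contDiffAt ((isOpen_cutPlane.prod isOpen_cutPlane).mem_nhds
        ⟨neg_ofReal_mem_cutPlane q2, neg_ofReal_mem_cutPlane (by linarith [inv_pos.2 hy])⟩)).restrict_scalars ℝ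
    exact ((c1.mul c1').mul (ContDiffAt.comp (g := appellF3 a b a (b - n + 1) (2 * (a + b) - n)) q c3
      (c2.prodMk c2'))).contDiffWithinAt
  · intro X hX
    have hr := rho_pos hZ.1
    refine ⟨hZ, ?_⟩
    change -1 < 4 * rho Z * v * X
    have : 0 ≤ 4 * rho Z * v * X := by positivity
    linarith
  · intro W hW j
    have hr := rho_pos hW.1
    have hy := yinv_pos hW
    simp only [poincareTerm, kerF3]
    rw [key (i j) W hW.1, ← Complex.ofReal_inv, ← Complex.ofReal_inv, ofReal_cpow_neg (by positivity),
      ofReal_cpow_neg hy.le]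
    set D := ‖coefP Z' (i j) * W.2 + coefQ Z' (i j)‖ ^ 2 + 0 with hD
    have D0 : 0 ≤ D := by positivity
    rw [inv_div, div_eq_mul_inv, mul_comm _ D⁻¹, Complex.ofReal_mul D⁻¹,
      Complex.mul_cpow_ofReal_nonneg (by positivity) (by positivity),
      ← Complex.ofReal_mul, mul_comm D⁻¹]
    simp only [mul_assoc]
  · intro j
    have hr := rho_pos hZ.1
    have hNγ := N0.trans_le (hN (i j))
    refine lap_kerF3 ha hb hn hZ (act_mem_HH _ hZ') ?_
    rw [key (i j) Z hZ.1, add_zero]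
    exact div_pos (lt_of_lt_of_le (by positivity) (hκ j)) (by positivity)

theorem isAutForm_poincare_kerF3 (ha : 1 < a.re)
    (hb : (n : ℝ) - 1 < b.re) (hn : 1 ≤ n) {Z' : Pt n} (hZ' : Z' ∈ HH n) :
    (∀ Z ∈ regF3 Z', Summable (poincareTerm (kerF3 n a b) Z Z')) ∧
      IsAutForm n (regF3 Z') ((a + b) * (a + b - n - 1))
        (fun Z => poincare (kerF3 n a b) Z Z') := by
  have hreg := fun Z (hZ : Z ∈ regF3 Z') => poincare_kerF3_regular ha hb hn
    (regF3_subset_offAxis Z' hZ) hZ' id Function.injective_id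
    (exists_coefSize_le_of_not_sameOrbit hZ.1 hZ' hZ.2.2)
  obtain ⟨C, hC⟩ := exists_norm_kerF3_le ha hb hn
  refine ⟨fun Z hZ => (hreg Z hZ).1, isAutForm_poincare hZ' (isOpen_regF3 hZ') (fun Z hZ => hZ.1)
    (HH_subset_closure_regF3 hn Z') (fun γ Z hZ => ?_) ha hC hreg⟩
  rw [regF3_eq] at hZ ⊢
  exact ⟨act_mem_offAxis γ hZ.1, act_mem_regX hZ' γ hZ.2⟩

end Nondegenerate
end UnitaryForms
end

noncomputable section
namespace UnitaryForms

open Filter Topology MeasureTheory Set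

/-! ### Sums over cosets -/

section CosetSums
variable {n : ℕ}

/-- Right multiplication on the set of cosets. -/
def cosetMul (δ : GZ n) : Cosets n ≃ Cosets n where
  toFun := Quotient.map' (· * δ) fun a b h => by
    rw [QuotientGroup.rightRel_apply] at h ⊢
    simpa [mul_assoc] using h
  invFun := Quotient.map' (· * δ⁻¹) fun a b h => by
    rw [QuotientGroup.rightRel_apply] at h ⊢
    simpa [mul_assoc] using h
  left_inv q := by
    induction q using Quotient.inductionOn' with | h γ => simp [Quotient.map'_mk'']
  right_inv q := by
    induction q using Quotient.inductionOn' with | h γ => simp [Quotient.map'_mk'']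

lemma exists_cosetMul_out (δ : GZ n) (q : Cosets n) :
    ∃ h ∈ GZinf n, (cosetMul δ q).out = h * (q.out * δ) := by
  have e : cosetMul δ q = Quotient.mk'' (q.out * δ) := by
    conv_lhs => rw [← Quotient.out_eq' q]
    rfl
  have h1 : QuotientGroup.rightRel (GZinf n) (q.out * δ) (cosetMul δ q).out := by
    apply Quotient.eq''.1
    rw [Quotient.out_eq', e]
  rw [QuotientGroup.rightRel_apply] at h1
  exact ⟨_, h1, by group⟩

/-- Reindexing a sum over cosets. -/
lemma tsum_cosets_mul {E : Type*} [AddCommMonoid E] [TopologicalSpace E] {T : GZ n → E}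
    (hT : ∀ h ∈ GZinf n, ∀ γ, T (h * γ) = T γ) (δ : GZ n) :
    ∑' q : Cosets n, T (q.out * δ) = ∑' q : Cosets n, T q.out := by
  rw [← (cosetMul δ).tsum_eq fun q => T q.out]
  refine tsum_congr fun q => ?_
  obtain ⟨h, hh, e⟩ := exists_cosetMul_out δ q
  rw [e, hT h hh]

/-- The determinant of the two lower rows is, up to sign, the lower left entry of r q⁻¹, whose
vanishing defines the parabolic subgroup. -/
lemma eq_of_row_parallel {q r : Cosets n}
    (h : r.out.2 1 0 * q.out.2 1 1 = r.out.2 1 1 * q.out.2 1 0) : q = r := by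
  rw [← Quotient.out_eq' q, ← Quotient.out_eq' r]
  refine Quotient.eq''.2 ?_
  rw [QuotientGroup.rightRel_apply]
  change (r.out * q.out⁻¹).2 1 0 = 0
  rw [Prod.snd_mul, mul_apply_row, Prod.snd_inv, Matrix.SpecialLinearGroup.SL2_inv_expl]
  simp only [Matrix.cons_val', Matrix.cons_val_zero, Matrix.cons_val_one]
  linear_combination h

lemma injective_coset_row :
    Function.Injective fun q : Cosets n => (q.out.2 1 0, q.out.2 1 1) := by
  intro q r h
  simp only [Prod.mk.injEq] at h
  exact eq_of_row_parallel (by rw [h.1, h.2]; ring)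

/-- The size `c² + d²` of the lower row of a coset. -/
def rowSq (q : Cosets n) : ℝ := (q.out.2 1 0 : ℝ) ^ 2 + (q.out.2 1 1 : ℝ) ^ 2

lemma one_le_rowSq (q : Cosets n) : 1 ≤ rowSq q := by
  have := row_sq_pos q.out.2
  unfold rowSq; exact_mod_cast this

lemma summable_rowSq {σ : ℝ} (hσ : 1 < σ) : Summable fun q : Cosets n => rowSq q ^ (-σ) := by
  have := (summable_int_sq_rpow hσ).comp_injective (injective_coset_row (n := n))
  simpa only [Function.comp_def, rowSq] using this

lemma exists_rowSq_le {Z : Pt n} (hZ : Z ∈ HH n) :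
    ∃ δ > 0, ∀ q : Cosets n, δ * rowSq q ≤ ‖den q.out.2 Z‖ ^ 2 := by
  obtain ⟨δ, δ0, h⟩ := exists_le_normSq_linear (im_pos hZ)
  refine ⟨δ, δ0, fun q => ?_⟩
  have := h (q.out.2 1 0) (q.out.2 1 1)
  push_cast at this
  exact this

/-- With w = u+iv one has |cw+d|² = (cu+d)² + c²v² and d² ≤ 2(cu+d)² + 2u²c²; for u² ≤ 1/4 and v ≥ 1
this gives c²+d² ≤ 2(cu+d)² + (3/2)c². -/
lemma rowSq_le_strip {Z : Pt n} (h1 : 1 ≤ Z.2.im) (h2 : |Z.2.re| ≤ 1 / 2) (q : Cosets n) :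
    rowSq q ≤ 2 * ‖den q.out.2 Z‖ ^ 2 := by
  rw [Complex.sq_norm, Complex.normSq_apply]
  simp only [den, rowSq, Complex.add_re, Complex.add_im, Complex.mul_re, Complex.mul_im,
    Complex.intCast_re, Complex.intCast_im, zero_mul, sub_zero, add_zero]
  set c := (q.out.2 1 0 : ℝ); set d := (q.out.2 1 1 : ℝ); set u := Z.2.re; set v := Z.2.im
  have hu : u ^ 2 ≤ 1 / 4 := by rw [← sq_abs]; nlinarith [abs_nonneg u]
  have hv1 : 1 ≤ v ^ 2 := one_le_pow₀ h1
  have hv : c ^ 2 ≤ c ^ 2 * v ^ 2 := le_mul_of_one_le_right (sq_nonneg c) hv1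
  nlinarith [sq_nonneg (2 * c * u + d), sq_nonneg c]

lemma normSq_den_of_mem_GZinf {h : GZ n} (hh : h ∈ GZinf n) (Z : Pt n) : Complex.normSq (den h.2 Z) = 1 := by
  have hc : h.2 1 0 = 0 := hh
  have := det_eq h.2
  rw [hc, mul_zero, sub_zero] at this
  have hd : h.2 1 1 * h.2 1 1 = 1 := Int.isUnit_iff_abs_eq.1 (IsUnit.of_mul_eq_one _ (by rw [mul_comm]; exact this)) |> fun e => by
    rw [← abs_mul_abs_self, e, one_mul]
  have : (h.2 1 1 : ℝ) * h.2 1 1 = 1 := by exact_mod_cast hd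
  simp [den, hc, Complex.normSq_apply, this]

end CosetSums

/-! ### Nonholomorphic Eisenstein series -/

section Eisenstein
variable {n : ℕ} {lam mu : ℂ}

lemma eisTerm_eq {Z : Pt n} (hZ : Z ∈ HH n) (q : Cosets n) :
    eisTerm lam mu Z q = (((‖den q.out.2 Z‖ ^ 2)⁻¹ : ℝ) : ℂ) ^ (lam + mu) *
      ((rho Z : ℂ) ^ lam * (beta Z : ℂ) ^ mu) := by
  have hr := rho_pos hZ
  have hD : 0 < ‖den q.out.2 Z‖ ^ 2 := by have := norm_pos_iff.2 (den_ne_zero q.out.2 hZ); positivity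
  have hne : (((‖den q.out.2 Z‖ ^ 2)⁻¹ : ℝ) : ℂ) ≠ 0 := by exact_mod_cast (inv_pos.2 hD).ne'
  rw [eisTerm, rho_act _ hZ, beta_act, Complex.normSq_eq_norm_sq, div_eq_mul_inv, div_eq_mul_inv,
    Complex.ofReal_mul, Complex.ofReal_mul, Complex.mul_cpow_ofReal_nonneg hr.le (inv_pos.2 hD).le,
    Complex.mul_cpow_ofReal_nonneg (beta_nonneg Z) (inv_pos.2 hD).le, Complex.cpow_add _ _ hne]
  ring

lemma eisTerm_eq_slashDen {Z : Pt n} (hZ : Z ∈ HH n) (q : Cosets n) :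
    eisTerm lam mu Z q =
      ((rho Z / slashDen (q.out.2 1 0) (q.out.2 1 1) (coords Z) : ℝ) : ℂ) ^ lam *
      ((beta Z / slashDen (q.out.2 1 0) (q.out.2 1 1) (coords Z) : ℝ) : ℂ) ^ mu := by
  have e : Complex.normSq (den q.out.2 Z) = slashDen (q.out.2 1 0) (q.out.2 1 1) (coords Z) := by
    rw [Complex.normSq_apply, slashDen, coords_fst, coords_snd_fst, coords_snd_snd, ← im_eq]
    simp [den, tt]
    ring
  rw [eisTerm, rho_act _ hZ, beta_act, e]

lemma contDiffAt_cpow_mul_cpow (a b : ℂ) {q : ℂ × ℂ} (hq : q ∈ posQuadrant) :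
    ContDiffAt ℂ 2 (fun q : ℂ × ℂ => q.1 ^ a * q.2 ^ b) q := by
  have h : ∀ (a : ℂ) {z : ℂ}, 0 < z.re → ContDiffAt ℂ 2 (fun z => z ^ a) z := fun a z hz => by
    have hd : DifferentiableOn ℂ (fun z : ℂ => z ^ a) Complex.slitPlane := fun z hz =>
      (differentiableAt_id.cpow_const hz).differentiableWithinAt
    exact (hd.contDiffOn Complex.isOpen_slitPlane).contDiffAt
      (Complex.isOpen_slitPlane.mem_nhds (Or.inl hz))
  exact ((h a hq.1).comp q contDiffAt_fst).mul ((h b hq.2).comp q contDiffAt_snd)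

/-- The second variable contributes (ρ/β)·μ(μ+n−1), which vanishes exactly for μ = 0 and μ = 1−n.
The first contributes the eigenvalue λ² − (n+1)λ. -/
lemma lap_eisTerm {Z : Pt n} (hZ : Z ∈ HH n) (hμ : mu = 0 ∨ (mu = 1 - n ∧ Z ∈ offAxis n))
    (q : Cosets n) :
    lap (fun Z => eisTerm lam mu Z q) Z = lam * (lam - n - 1) * eisTerm lam mu Z q := by
  have hD : 0 < slashDen (q.out.2 1 0) (q.out.2 1 1) (coords Z) := by
    have e : Complex.normSq (den q.out.2 Z) = slashDen (q.out.2 1 0) (q.out.2 1 1) (coords Z) := by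
      rw [Complex.normSq_apply, slashDen, coords_fst, coords_snd_fst, coords_snd_snd, ← im_eq]
      simp [den, tt]
      ring
    rw [← e]; exact normSq_den_pos _ hZ
  have hr := rho_pos hZ
  set D := slashDen (q.out.2 1 0) (q.out.2 1 1) (coords Z) with hDdef
  have hn : ∀ᶠ W in 𝓝 Z, W ∈ HH n := (isOpen_HH n).mem_nhds hZ
  rcases hμ with rfl | ⟨hμ, hZ'⟩
  · have hq : (((rho Z / D : ℝ) : ℂ), (1 : ℂ)) ∈ posQuadrant :=
      ⟨by rw [Complex.ofReal_re]; positivity, by simp⟩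
    rw [lap_slash_rho hZ hD.ne' (K := fun q => q.1 ^ lam * q.2 ^ (0 : ℂ)) ?_
      (contDiffAt_cpow_mul_cpow lam 0 hq) (thetaSystem_cpow lam 0 hq), eisTerm_eq_slashDen hZ]
    · simp only [Complex.cpow_zero]
      ring
    · filter_upwards [hn] with W hW
      rw [eisTerm_eq_slashDen hW]
      simp
  · have hb := beta_pos hZ'.2
    have hb' : (beta Z : ℂ) ≠ 0 := by exact_mod_cast hb.ne'
    have hq : (((rho Z / D : ℝ) : ℂ), ((beta Z / D : ℝ) : ℂ)) ∈ posQuadrant :=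
      ⟨by rw [Complex.ofReal_re]; positivity, by rw [Complex.ofReal_re]; positivity⟩
    rw [lap_slash hZ hD.ne' (K := fun q => q.1 ^ lam * q.2 ^ mu) ?_
      (contDiffAt_cpow_mul_cpow lam mu hq) (thetaSystem_cpow lam mu hq) hb.ne', eisTerm_eq_slashDen hZ]
    · simp only [← hDdef]
      rw [hμ]
      field_simp
      ring
    · filter_upwards [hn] with W hW
      rw [eisTerm_eq_slashDen hW]

lemma eisTerm_rep (h : GZ n) (hh : h ∈ GZinf n) (γ : GZ n) {Z : Pt n} (hZ : Z ∈ HH n) :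
    rho (act (h * γ) Z) = rho (act γ Z) ∧ beta (act (h * γ) Z) = beta (act γ Z) := by
  rw [act_mul _ _ hZ, rho_act _ (act_mem_HH γ hZ), beta_act, normSq_den_of_mem_GZinf hh, div_one, div_one]
  exact ⟨rfl, rfl⟩

lemma eis_act (δ : GZ n) {Z : Pt n} (hZ : Z ∈ HH n) : eis lam mu (act δ Z) = eis lam mu Z := by
  have := tsum_cosets_mul (T := fun γ : GZ n => (rho (act γ Z) : ℂ) ^ lam * (beta (act γ Z) : ℂ) ^ mu)
    (fun h hh γ => by rw [(eisTerm_rep h hh γ hZ).1, (eisTerm_rep h hh γ hZ).2]) δ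
  simp only [act_mul _ _ hZ] at this
  exact this

/-- A term carries the factor |cw+d|^{-2(λ+μ)}, so convergence requires Re(λ+μ) > 1; for μ = 1−n
this is the condition Re s > n. -/
lemma eis_regular {U : Set (Pt n)} (hU : IsOpen U) (hUH : U ⊆ HH n) (hσ : 1 < (lam + mu).re)
    (hμ : mu = 0 ∨ (mu = 1 - n ∧ U ⊆ offAxis n)) {Z : Pt n} (hZ : Z ∈ U) :
    Summable (eisTerm lam mu Z) ∧ ContDiffAt ℝ 2 (eis lam mu) Z ∧
      lap (eis lam mu) Z = lam * (lam - n - 1) * eis lam mu Z := by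
  obtain ⟨δ, δ0, hδ⟩ := exists_rowSq_le (hUH hZ)
  have hcr : ContDiff ℝ 2 (rho : Pt n → ℝ) := contDiff_rho
  have hcb : ContDiff ℝ 2 (beta : Pt n → ℝ) := contDiff_beta
  have eN : ∀ q : Cosets n, ‖(q.out.2 1 0 : ℂ)‖ ^ 2 + ‖(q.out.2 1 1 : ℂ)‖ ^ 2 = rowSq q := fun q => by
    rw [Complex.norm_intCast, Complex.norm_intCast, sq_abs, sq_abs, rowSq]
  refine tsum_pair_lap (f := fun q W => eisTerm lam mu W q) (P := fun q => (q.out.2 1 0 : ℂ))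
    (Q := fun q => (q.out.2 1 1 : ℂ)) (a := lam + mu) (e := fun _ => 0) (U := U) (V := {q | q.2 ∈ U})
    (H := fun q => (rho q.2 : ℂ) ^ lam * (beta q.2 : ℂ) ^ mu) one_pos
    (fun q => by rw [eN]; exact one_le_rowSq q) (by simpa only [eN] using summable_rowSq hσ)
    contDiff_const (hU.preimage continuous_snd) ?_ (fun _ _ => hZ) δ0 (fun q => ?_) (hU.mem_nhds hZ)
    (fun W hW q => ?_) (fun q => lap_eisTerm (hUH hZ) (hμ.imp_right fun h => ⟨h.1, h.2 hZ⟩) q)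
  · rintro q hq
    have hq : q.2 ∈ U := hq
    have hrr : ContDiffAt ℝ 2 (fun q : ℝ × Pt n => rho q.2) q := (hcr.comp contDiff_snd).contDiffAt
    have hbb : ContDiffAt ℝ 2 (fun q : ℝ × Pt n => beta q.2) q := (hcb.comp contDiff_snd).contDiffAt
    refine (ContDiffAt.mul (contDiffAt_ofReal_cpow hrr (rho_pos (hUH hq)) lam) ?_).contDiffWithinAt
    rcases hμ with rfl | ⟨-, h⟩
    · simpa using contDiffAt_const
    · exact contDiffAt_ofReal_cpow hbb (beta_pos (h hq).2) mu
  · rw [eN, add_zero]; exact hδ q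
  · rw [eisTerm_eq (hUH hW), add_zero]; rfl

theorem isAutForm_eis {U : Set (Pt n)} (hU : IsOpen U) (hUH : U ⊆ HH n) (hd : HH n ⊆ closure U)
    (hi : ∀ γ : GZ n, ∀ Z ∈ U, act γ Z ∈ U) (hσ : 1 < (lam + mu).re)
    (hμ : mu = 0 ∨ (mu = 1 - n ∧ U ⊆ offAxis n)) :
    IsAutForm n U (lam * (lam - n - 1)) (eis lam mu) where
  isOpen := hU
  subset := hUH
  dense := hd
  act_mem := hi
  contDiffOn := fun Z hZ => (eis_regular hU hUH hσ hμ hZ).2.1.contDiffWithinAt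
  eigen := fun Z hZ => (eis_regular hU hUH hσ hμ hZ).2.2
  invariant := fun γ Z hZ => eis_act γ (hUH hZ)
  growth := by
    set σ := (lam + mu).re with hσdef
    set S := ∑' q : Cosets n, rowSq q ^ (-σ)
    have S0 : 0 ≤ S := tsum_nonneg fun q => Real.rpow_nonneg (by linarith [one_le_rowSq q]) _
    -- The factor β₀^μ, on which neither constant nor exponent may depend, is absorbed into one
    -- extra power of ρ by the choice of the radius.
    refine ⟨2 ^ σ * S + 1, by positivity, lam.re + 1, fun β₀ =>
      ⟨max 1 ‖(β₀ : ℂ) ^ mu‖, lt_of_lt_of_le one_pos (le_max_left _ _), fun Z hZ hβ hρ => ?_⟩⟩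
    obtain ⟨γ₀, e1, e2, e3⟩ := exists_translation_strip Z
    rw [← eis_act γ₀ (hUH hZ)]
    have hW : act γ₀ Z ∈ U := hi γ₀ Z hZ
    rw [← e2] at hρ ⊢
    rw [← e1] at hβ
    set W := act γ₀ Z
    have r1 : 1 ≤ rho W := (le_max_left _ _).trans hρ
    have r2 : ‖(β₀ : ℂ) ^ mu‖ ≤ rho W := (le_max_right _ _).trans hρ
    have r0 : 0 < rho W := by linarith
    have him : 1 ≤ W.2.im := by rw [im_eq]; linarith [beta_nonneg W]
    have hterm : ∀ q : Cosets n, ‖eisTerm lam mu W q‖ ≤ 2 ^ σ * rho W ^ (lam.re + 1) * rowSq q ^ (-σ) :=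
      fun q => by
      have hN : 0 < rowSq q := by linarith [one_le_rowSq q]
      have hD := rowSq_le_strip him e3 q
      have hD0 : 0 < ‖den q.out.2 W‖ ^ 2 := by linarith
      rw [eisTerm_eq (hUH hW), norm_mul, norm_mul,
        Complex.norm_cpow_eq_rpow_re_of_pos (inv_pos.2 hD0), Complex.norm_cpow_eq_rpow_re_of_pos r0, hβ,
        ← hσdef, Real.rpow_add_one r0.ne']
      have h1 : (‖den q.out.2 W‖ ^ 2)⁻¹ ^ σ ≤ 2 ^ σ * rowSq q ^ (-σ) := by
        have h2 : (‖den q.out.2 W‖ ^ 2)⁻¹ ≤ 2 * (rowSq q)⁻¹ := by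
          rw [inv_le_comm₀ hD0 (by positivity), mul_inv, inv_inv]; linarith
        calc _ ≤ (2 * (rowSq q)⁻¹) ^ σ := by gcongr
          _ = _ := by rw [Real.mul_rpow (by norm_num) (inv_pos.2 hN).le, Real.rpow_neg hN.le,
            Real.inv_rpow hN.le]
      calc _ ≤ 2 ^ σ * rowSq q ^ (-σ) * (rho W ^ lam.re * rho W) := by gcongr
        _ = _ := by ring
    have := tsum_of_norm_bounded ((summable_rowSq hσ).hasSum.mul_left _) hterm
    refine this.trans ?_
    have : 0 ≤ rho W ^ (lam.re + 1) := by positivity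
    calc _ = 2 ^ σ * S * rho W ^ (lam.re + 1) := by ring
      _ ≤ _ := by gcongr; linarith

lemma fderiv_const_mul_complex (t : ℂ) (f : Pt n → ℂ) (Z : Pt n) :
    fderiv ℝ (fun Z => t * f Z) Z = t • fderiv ℝ f Z :=
  congrFun (fderiv_const_smul_field (𝕜 := ℝ) (f := f) t) Z

lemma dW_const_mul (t : ℂ) (f : Pt n → ℂ) (v : Pt n) : dW v (fun Z => t * f Z) = fun Z => t * dW v f Z := by
  funext Z
  simp only [dW, fderiv_const_mul_complex, smul_apply, smul_eq_mul]
  ring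

lemma dWbar_const_mul (t : ℂ) (f : Pt n → ℂ) (v : Pt n) :
    dWbar v (fun Z => t * f Z) = fun Z => t * dWbar v f Z := by
  funext Z
  simp only [dWbar, fderiv_const_mul_complex, smul_apply, smul_eq_mul]
  ring

lemma lap_const_mul (t : ℂ) (f : Pt n → ℂ) (Z : Pt n) : lap (fun Z => t * f Z) Z = t * lap f Z := by
  simp only [lap, dW_const_mul, dWbar_const_mul]
  have e1 : ∀ j : Fin n, 2 * Complex.I * (conj (Z.1 j) * (t * dW ew (dWbar (ez j) f) Z) -
      Z.1 j * (t * dWbar ew (dW (ez j) f) Z)) = t * (2 * Complex.I *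
      (conj (Z.1 j) * dW ew (dWbar (ez j) f) Z - Z.1 j * dWbar ew (dW (ez j) f) Z)) := fun j => by ring
  simp only [e1, ← Finset.mul_sum]
  ring

lemma IsAutForm.const_mul {Ω : Set (Pt n)} {F : Pt n → ℂ} (h : IsAutForm n Ω lam F) (t : ℂ) :
    IsAutForm n Ω lam (fun Z => t * F Z) where
  isOpen := h.isOpen
  subset := h.subset
  dense := h.dense
  act_mem := h.act_mem
  contDiffOn := contDiffOn_const.mul h.contDiffOn
  eigen := fun Z hZ => by rw [lap_const_mul, h.eigen Z hZ]; ring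
  invariant := fun γ Z hZ => by rw [h.invariant γ Z hZ]
  growth := by
    obtain ⟨C, C0, k, hk⟩ := h.growth
    refine ⟨(‖t‖ + 1) * C, by positivity, k, fun β₀ => ?_⟩
    obtain ⟨R, R0, hR⟩ := hk β₀
    refine ⟨R, R0, fun Z hZ h1 h2 => ?_⟩
    have hr := rho_pos (h.subset hZ)
    rw [norm_mul, mul_assoc]
    have := hR Z hZ h1 h2
    gcongr
    linarith

open Classical in
-- At the points (0, iv) the series is v^s ∑|civ+d|^{-2s}. As v → ∞ every term with c ≠ 0 tends to
-- 0, dominated by (c²+d²)^{-Re s}, and the single coset with c = 0 contributes 1.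
lemma eis_ne_zero {s : ℂ} (hs : 1 < s.re) : ∃ Z ∈ HH n, eis s 0 Z ≠ 0 := by
  let pt : ℝ → Pt n := fun v => (0, v * Complex.I)
  have hpt : ∀ v > 0, pt v ∈ HH n := fun v hv => by simp [HH, pt, hv]
  have hr : ∀ v, rho (pt v) = v := fun v => by simp [rho, beta, pt]
  have hden : ∀ v (q : Cosets n), ‖den q.out.2 (pt v)‖ ^ 2 =
      (q.out.2 1 0 : ℝ) ^ 2 * v ^ 2 + (q.out.2 1 1 : ℝ) ^ 2 := fun v q => by
    rw [Complex.sq_norm, Complex.normSq_apply]; simp [den, pt]; ring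
  let φ : ℝ → Cosets n → ℂ := fun v q => (((‖den q.out.2 (pt v)‖ ^ 2)⁻¹ : ℝ) : ℂ) ^ s
  let q₀ : Cosets n := Quotient.mk'' 1
  have hq₀ : ∀ q : Cosets n, q.out.2 1 0 = 0 ↔ q = q₀ := fun q => by
    have : q = q₀ ↔ QuotientGroup.rightRel (GZinf n) 1 q.out := by
      rw [← Quotient.eq'' (s₁ := QuotientGroup.rightRel (GZinf n)), Quotient.out_eq']
      exact eq_comm
    rw [this, QuotientGroup.rightRel_apply, inv_one, mul_one]
    rfl
  have hlim : Tendsto (fun v => ∑' q, φ v q) atTop (𝓝 (∑' q, if q = q₀ then (1 : ℂ) else 0)) := by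
    refine tendsto_tsum_of_dominated_convergence (summable_rowSq hs) (fun q => ?_) ?_
    · split_ifs with hq
      · have hc := (hq₀ q).2 hq
        have hd := det_eq q.out.2
        have hd2 : (q.out.2 1 1 : ℝ) ^ 2 = 1 := by
          have h := normSq_den_of_mem_GZinf (n := n) (h := q.out) hc (pt 1)
          rw [Complex.normSq_eq_norm_sq, hden, hc] at h
          simpa using h
        simp only [φ, hden, hc, hd2]
        simp
      · have hc : q.out.2 1 0 ≠ 0 := fun h => hq ((hq₀ q).1 h)
        have hc' : 0 < (q.out.2 1 0 : ℝ) ^ 2 := by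
          have : (q.out.2 1 0 : ℝ) ≠ 0 := by exact_mod_cast hc
          positivity
        rw [tendsto_zero_iff_norm_tendsto_zero]
        have hX : Tendsto (fun v : ℝ => ((q.out.2 1 0 : ℝ) ^ 2 * v ^ 2 + (q.out.2 1 1 : ℝ) ^ 2)) atTop atTop :=
          tendsto_atTop_add_const_right _ _ ((tendsto_pow_atTop two_ne_zero).const_mul_atTop hc')
        have h3 := (tendsto_rpow_neg_atTop (y := s.re) (by linarith)).comp hX
        refine h3.congr' ?_
        filter_upwards [eventually_gt_atTop 0] with v hv
        have h4 : 0 < (q.out.2 1 0 : ℝ) ^ 2 * v ^ 2 + (q.out.2 1 1 : ℝ) ^ 2 := by positivity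
        simp only [φ, hden, Function.comp_apply]
        rw [Complex.norm_cpow_eq_rpow_re_of_pos (inv_pos.2 h4), Real.inv_rpow h4.le, Real.rpow_neg h4.le]
    · filter_upwards [eventually_ge_atTop 1] with v hv q
      have hN := one_le_rowSq q
      have h5 : rowSq q ≤ (q.out.2 1 0 : ℝ) ^ 2 * v ^ 2 + (q.out.2 1 1 : ℝ) ^ 2 := by
        unfold rowSq
        have : 1 ≤ v ^ 2 := by nlinarith
        nlinarith [sq_nonneg (q.out.2 1 0 : ℝ)]
      have h4 : 0 < (q.out.2 1 0 : ℝ) ^ 2 * v ^ 2 + (q.out.2 1 1 : ℝ) ^ 2 := by linarith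
      simp only [φ, hden]
      rw [Complex.norm_cpow_eq_rpow_re_of_pos (inv_pos.2 h4), Real.inv_rpow h4.le, ← Real.rpow_neg h4.le]
      exact Real.rpow_le_rpow_of_nonpos (by linarith) h5 (by linarith)
  rw [tsum_ite_eq] at hlim
  obtain ⟨v, hv, hv0⟩ := ((hlim.eventually_ne one_ne_zero).and (eventually_gt_atTop 0)).exists
  refine ⟨pt v, hpt v hv0, ?_⟩
  rw [eis]
  simp only [eisTerm_eq (hpt v hv0), add_zero, tsum_mul_right]
  refine mul_ne_zero hv ?_
  rw [hr, Complex.cpow_zero, mul_one]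
  exact (Complex.cpow_ne_zero_iff_of_exponent_ne_zero (fun h => by simp [h] at hs; linarith)).2
    (by exact_mod_cast hv0.ne')

/-- The complex multiples of one nonzero form, E(Z;s,0), are already infinitely many. -/
theorem autForms_infinite (hn : 1 ≤ n) {s : ℂ} (hs : (n : ℝ) < s.re) :
    (autForms n (HH n) (s * (s - n - 1))).Infinite := by
  have hn1 : (1 : ℝ) ≤ n := by exact_mod_cast hn
  have hE : IsAutForm n (HH n) (s * (s - n - 1)) (eis s 0) :=
    isAutForm_eis (isOpen_HH n) subset_rfl subset_closure (fun γ Z hZ => act_mem_HH γ hZ)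
      (by simpa using hn1.trans_lt hs) (Or.inl rfl)
  obtain ⟨Z, hZ, h0⟩ := eis_ne_zero (n := n) (hn1.trans_lt hs)
  refine Set.infinite_of_injective_forall_mem (f := fun t : ℂ => (HH n).domRestrict fun Z => t * eis s 0 Z)
    (fun t t' h => ?_) (fun t => ⟨_, hE.const_mul t, rfl⟩)
  exact mul_right_cancel₀ h0 (congrFun h ⟨Z, hZ⟩)

lemma HH_subset_closure_offAxis (hn : 1 ≤ n) : HH n ⊆ closure (offAxis n) := by
  have : Nonempty (Fin n) := ⟨⟨0, hn⟩⟩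
  have hd : Dense (({0}ᶜ : Set (Fin n → ℂ)) ×ˢ (univ : Set ℂ)) := (dense_compl_singleton 0).prod dense_univ
  refine (hd.open_subset_closure_inter (isOpen_HH n)).trans (closure_mono ?_)
  rintro Z ⟨h1, h2, -⟩
  exact ⟨h1, h2⟩

end Eisenstein
end UnitaryForms
end

noncomputable section
namespace UnitaryForms

open Filter Topology Set

/-! ### Holomorphic Eisenstein series -/

lemma hasFDerivAt_slice_complex {P E : Type*} [NormedAddCommGroup P] [NormedSpace ℂ P]
    [NormedAddCommGroup E] [NormedSpace ℂ E] {G : P × E → ℂ} {p : P} {Z : E}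
    (h : DifferentiableAt ℂ G (p, Z)) :
    HasFDerivAt (fun Z => G (p, Z)) ((fderiv ℂ G (p, Z)).comp (ContinuousLinearMap.inr ℂ P E)) Z :=
  h.hasFDerivAt.comp Z (hasFDerivAt_prodMk_right p Z)

/-- A series `∑ cᵢ Ψ(pᵢ, Z)` with `cᵢ` summable and `pᵢ` in a compact set is holomorphic. -/
lemma differentiableAt_tsum_family {P E : Type*} [NormedAddCommGroup P] [NormedSpace ℂ P]
    [NormedAddCommGroup E] [NormedSpace ℂ E] {Ψ : P × E → ℂ} {W : Set (P × E)} {K : Set P} {Z₀ : E}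
    {ι : Type*} {c : ι → ℝ} {p : ι → P} (hW : IsOpen W) (hΨ : ContDiffOn ℂ 1 Ψ W)
    (hK : IsCompact K) (hKW : ∀ p ∈ K, (p, Z₀) ∈ W) (hc : Summable fun i => |c i|)
    (hp : ∀ i, p i ∈ K) : DifferentiableAt ℂ (fun Z => ∑' i, (c i : ℂ) * Ψ (p i, Z)) Z₀ := by
  have c1 : ContinuousOn (fun q => (fderiv ℂ Ψ q).comp (ContinuousLinearMap.inr ℂ P E)) W :=
    (hΨ.continuousOn_fderiv_of_isOpen hW le_rfl).clm_comp continuousOn_const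
  obtain ⟨ε, ε0, M, M0, hM⟩ := exists_uniform_bound hW c1 hK hKW
  obtain ⟨ε', ε0', M', M0', hM'⟩ := exists_uniform_bound hW hΨ.continuousOn hK hKW
  have hZB := Metric.mem_ball_self (x := Z₀) ε0
  have h0 : Summable fun i => (c i : ℂ) * Ψ (p i, Z₀) := by
    refine Summable.of_norm_bounded (hc.mul_right M') fun i => ?_
    rw [norm_mul, Complex.norm_real, Real.norm_eq_abs]
    exact mul_le_mul_of_nonneg_left (hM' _ (hp i) _ (Metric.mem_ball_self ε0')).2 (abs_nonneg _)
  have h1 : ∀ i, ∀ Z ∈ Metric.ball Z₀ ε, HasFDerivAt (fun Z => (c i : ℂ) * Ψ (p i, Z))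
      ((c i : ℂ) • (fderiv ℂ Ψ (p i, Z)).comp (ContinuousLinearMap.inr ℂ P E)) Z := fun i Z hZ => by
    have hd : DifferentiableAt ℂ Ψ (p i, Z) :=
      (hΨ.contDiffAt (hW.mem_nhds (hM _ (hp i) Z hZ).1)).differentiableAt (by norm_num)
    exact (hasFDerivAt_slice_complex hd).const_mul (c i : ℂ)
  have h2 : ∀ i, ∀ Z ∈ Metric.ball Z₀ ε, ‖(c i : ℂ) • (fderiv ℂ Ψ (p i, Z)).comp
      (ContinuousLinearMap.inr ℂ P E)‖ ≤ |c i| * M := fun i Z hZ => by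
    rw [norm_smul, Complex.norm_real, Real.norm_eq_abs]
    exact mul_le_mul_of_nonneg_left (hM _ (hp i) Z hZ).2 (abs_nonneg _)
  exact (hasFDerivAt_tsum_of_isPreconnected (hc.mul_right M) Metric.isOpen_ball
    (convex_ball Z₀ ε).isPreconnected h1 h2 hZB h0 hZB).differentiableAt

section Jacobi
variable {n : ℕ}

/-- The automorphy factor `(c z_{n+1} + d)^{-k} exp(-2πi m c (z_1² + ⋯ + z_n²) / (c z_{n+1} + d))`. -/
def jacFactor (k : ℕ) (m : ℝ) (A : SL(2, ℤ)) (Z : Pt n) : ℂ :=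
  den A Z ^ (-(k : ℤ)) *
    Complex.exp (2 * Real.pi * Complex.I * m * (-(A 1 0 : ℂ) * sq Z / den A Z))

lemma jacFactor_ne_zero (k : ℕ) (m : ℝ) (A : SL(2, ℤ)) {Z : Pt n} (hZ : Z ∈ HH n) :
    jacFactor k m A Z ≠ 0 :=
  mul_ne_zero (zpow_ne_zero _ (den_ne_zero A hZ)) (Complex.exp_ne_zero _)

lemma sq_act (γ : GZ n) (Z : Pt n) : sq (act γ Z) = sq Z / den γ.2 Z ^ 2 := by
  simp only [sq, act, div_pow]
  rw [← Finset.sum_div, Equiv.sum_comp γ.1⁻¹ (fun j => Z.1 j ^ 2)]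

/-- The cocycle relation. In the exponent c·q(z)/(cw+d) is additive along products, because q(δZ) is
q(Z) divided by the square of the denominator of δ and det δ = 1. -/
lemma jacFactor_mul (k : ℕ) (m : ℝ) (γ δ : GZ n) {Z : Pt n} (hZ : Z ∈ HH n) :
    jacFactor k m (γ * δ).2 Z = jacFactor k m γ.2 (act δ Z) * jacFactor k m δ.2 Z := by
  have h1 := den_ne_zero δ.2 hZ
  have h2 := den_ne_zero γ.2 (act_mem_HH δ hZ)
  have h3 : den (γ * δ).2 Z = den γ.2 (act δ Z) * den δ.2 Z := den_mul γ.2 δ.2 δ.1 hZ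
  have hd := detC δ.2
  have hden : den γ.2 (act δ Z) * den δ.2 Z =
      (γ.2 1 0 : ℂ) * (δ.2 0 0 * Z.2 + δ.2 0 1) + γ.2 1 1 * den δ.2 Z := by
    rw [← h3]; simp only [den, Prod.snd_mul, mul_apply_row]; push_cast; ring
  have e : -((γ * δ).2 1 0 : ℂ) * sq Z / den (γ * δ).2 Z =
      -(γ.2 1 0 : ℂ) * sq (act δ Z) / den γ.2 (act δ Z) + -(δ.2 1 0 : ℂ) * sq Z / den δ.2 Z := by
    rw [sq_act, h3, Prod.snd_mul, mul_apply_row]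
    push_cast
    have hδ : den δ.2 Z = (δ.2 1 0 : ℂ) * Z.2 + δ.2 1 1 := rfl
    generalize den γ.2 (act δ Z) = D at *
    field_simp
    rw [hδ] at hden ⊢
    linear_combination (sq Z * (δ.2 1 0 : ℂ)) * hden - (sq Z * (γ.2 1 0 : ℂ)) * hd
  simp only [jacFactor]
  rw [e, h3, mul_zpow, mul_add, Complex.exp_add]
  ring

lemma jacFactor_of_mem_GZinf {k : ℕ} (hk : Even k) (m : ℝ) {h : GZ n} (hh : h ∈ GZinf n) (Z : Pt n) :
    jacFactor k m h.2 Z = 1 := by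
  have hc : h.2 1 0 = 0 := hh
  have hd := det_eq h.2
  rw [hc, mul_zero, sub_zero] at hd
  have hd' : h.2 1 1 = 1 ∨ h.2 1 1 = -1 := Int.isUnit_iff.1 (IsUnit.of_mul_eq_one _ (by rw [mul_comm]; exact hd))
  have hk' : Even (-(k : ℤ)) := by simpa using hk
  rcases hd' with h1 | h1 <;> simp [jacFactor, den, hc, h1, hk'.neg_one_zpow]

lemma jacEis_act {k : ℕ} (hk : Even k) (m : ℝ) (δ : GZ n) {Z : Pt n} (hZ : Z ∈ HH n) :
    jacEis k m (act δ Z) * jacFactor k m δ.2 Z = jacEis k m Z := by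
  have := tsum_cosets_mul (T := fun γ : GZ n => jacFactor k m γ.2 Z)
    (fun h hh γ => by rw [jacFactor_mul _ _ _ _ hZ, jacFactor_of_mem_GZinf hk _ hh, one_mul]) δ
  simp only [jacFactor_mul _ _ _ _ hZ, tsum_mul_right] at this
  exact this

lemma sq_perm (w : Equiv.Perm (Fin n)) (Z : Pt n) : sq ((fun j => Z.1 (w j), Z.2) : Pt n) = sq Z :=
  Equiv.sum_comp w fun j => Z.1 j ^ 2

lemma jacEis_perm (k : ℕ) (m : ℝ) (w : Equiv.Perm (Fin n)) (Z : Pt n) :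
    jacEis k m ((fun j => Z.1 (w j), Z.2) : Pt n) = jacEis k m Z := by
  simp only [jacEis, jacTerm, sq_perm]
  rfl

lemma norm_zpow_den_le {k : ℕ} {C : ℝ} (hC : 0 < C) {q : Cosets n} {Z : Pt n}
    (h : rowSq q ≤ C * ‖den q.out.2 Z‖ ^ 2) :
    ‖den q.out.2 Z ^ (-(k : ℤ))‖ ≤ C ^ ((k : ℝ) / 2) * rowSq q ^ (-((k : ℝ) / 2)) := by
  have hN : 0 < rowSq q := by linarith [one_le_rowSq q]
  have hD : 0 < ‖den q.out.2 Z‖ ^ 2 := by by_contra h0; nlinarith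
  have hD' : 0 < ‖den q.out.2 Z‖ := by
    rcases (norm_nonneg (den q.out.2 Z)).eq_or_lt with h0 | h0
    · rw [← h0] at hD; norm_num at hD
    · exact h0
  have e : ‖den q.out.2 Z ^ (-(k : ℤ))‖ = (‖den q.out.2 Z‖ ^ 2) ^ (-((k : ℝ) / 2)) := by
    rw [norm_zpow, ← Real.rpow_natCast, ← Real.rpow_mul hD'.le, ← Real.rpow_intCast]
    congr 1; push_cast; ring
  rw [e]
  calc (‖den q.out.2 Z‖ ^ 2) ^ (-((k : ℝ) / 2)) ≤ (rowSq q / C) ^ (-((k : ℝ) / 2)) :=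
        Real.rpow_le_rpow_of_nonpos (by positivity) ((div_le_iff₀' hC).2 h)
          (by have : (0 : ℝ) ≤ k := k.cast_nonneg
              linarith)
    _ = _ := by
      rw [Real.div_rpow hN.le hC.le, Real.rpow_neg hC.le, div_inv_eq_mul, mul_comm]

/-- The imaginary part of cw+d is c Im w, so |c|/|cw+d| ≤ 1/Im w. The exponential factor is
therefore bounded uniformly over the cosets and does not affect convergence. -/
lemma norm_jacTerm_le {k : ℕ} {m C : ℝ} (hC : 0 < C) {q : Cosets n} {Z : Pt n} (hZ : Z ∈ HH n)
    (h : rowSq q ≤ C * ‖den q.out.2 Z‖ ^ 2) :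
    ‖jacTerm k m Z q‖ ≤ C ^ ((k : ℝ) / 2) * Real.exp (2 * Real.pi * |m| * (‖sq Z‖ / Z.2.im)) *
      rowSq q ^ (-((k : ℝ) / 2)) := by
  have hv := im_pos hZ
  have hD : 0 < ‖den q.out.2 Z‖ := norm_pos_iff.2 (den_ne_zero _ hZ)
  have hc : |(q.out.2 1 0 : ℝ)| * Z.2.im ≤ ‖den q.out.2 Z‖ := by
    refine le_trans (le_of_eq ?_) (Complex.abs_im_le_norm _)
    simp [den, abs_mul, abs_of_pos hv]
  have h2 : ‖Complex.exp (2 * Real.pi * Complex.I * m * (-(q.out.2 1 0 : ℂ) * sq Z / den q.out.2 Z))‖ ≤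
      Real.exp (2 * Real.pi * |m| * (‖sq Z‖ / Z.2.im)) := by
    refine (Complex.norm_exp_le_exp_norm _).trans (Real.exp_le_exp.2 ?_)
    have e : ‖(2 * Real.pi * Complex.I * m * (-(q.out.2 1 0 : ℂ) * sq Z / den q.out.2 Z) : ℂ)‖ =
        2 * Real.pi * |m| * (|(q.out.2 1 0 : ℝ)| * ‖sq Z‖ / ‖den q.out.2 Z‖) := by
      simp [abs_of_pos Real.pi_pos]
    rw [e]
    gcongr 2 * Real.pi * |m| * ?_
    rw [div_le_div_iff₀ hD hv]
    nlinarith [norm_nonneg (sq Z)]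
  rw [jacTerm, norm_mul]
  calc _ ≤ C ^ ((k : ℝ) / 2) * rowSq q ^ (-((k : ℝ) / 2)) *
        Real.exp (2 * Real.pi * |m| * (‖sq Z‖ / Z.2.im)) :=
        mul_le_mul (norm_zpow_den_le hC h) h2 (norm_nonneg _)
          (mul_nonneg (by positivity) (Real.rpow_nonneg (by linarith [one_le_rowSq q]) _))
    _ = _ := by ring

lemma one_lt_half {k : ℕ} (hk : 3 ≤ k) : 1 < (k : ℝ) / 2 := by
  have : (3 : ℝ) ≤ k := by exact_mod_cast hk
  linarith

lemma summable_jacTerm {k : ℕ} (hk : 3 ≤ k) (m : ℝ) {Z : Pt n} (hZ : Z ∈ HH n) :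
    Summable (jacTerm k m Z) := by
  obtain ⟨δ, δ0, hδ⟩ := exists_rowSq_le hZ
  refine Summable.of_norm_bounded ((summable_rowSq (one_lt_half hk)).mul_left _) fun q =>
    norm_jacTerm_le (C := δ⁻¹) (inv_pos.2 δ0) hZ ?_
  rw [inv_mul_eq_div, le_div_iff₀' δ0]; exact hδ q

theorem isModForm_jacEis {k : ℕ} (hk : Even k) (hk3 : 3 ≤ k) (m : ℝ) :
    IsModForm n k m (jacEis k m) where
  transform := fun A Z hZ => by
    have h := jacEis_act hk m ((1, A) : GZ n) hZ
    have h0 := jacFactor_ne_zero k m A hZ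
    rw [← h]
    simp only [jacFactor, zpow_neg]
    have h1 := zpow_ne_zero (k : ℤ) (den_ne_zero A hZ)
    have e : (2 * Real.pi * Complex.I * m * (-(A 1 0 : ℂ) * sq Z / den A Z) : ℂ) =
        -(2 * Real.pi * Complex.I * m * (A 1 0 : ℂ) * sq Z / den A Z) := by ring
    rw [e, Complex.exp_neg]
    have h2 := Complex.exp_ne_zero (2 * Real.pi * Complex.I * m * (A 1 0 : ℂ) * sq Z / den A Z)
    field_simp
  perm := fun w Z _ => jacEis_perm k m w Z
  bounded := fun K hK => by
    have hcont : Continuous fun z : Fin n → ℂ => ‖∑ j, z j ^ 2‖ := by fun_prop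
    obtain ⟨B, hB⟩ := (hK.image hcont).bddAbove
    refine ⟨2 ^ ((k : ℝ) / 2) * Real.exp (2 * Real.pi * |m| * B) *
      ∑' q : Cosets n, rowSq q ^ (-((k : ℝ) / 2)), 1, fun Z hZ hZK hR => ?_⟩
    -- Integral translations lie in the parabolic subgroup, have factor 1 and fix z, so Z may be
    -- moved into the strip |Re z_{n+1}| ≤ 1/2, where the bound on the terms is uniform.
    have hm := translation_act (-round Z.2.re) Z
    have hW := act_mem_HH (translation n (-round Z.2.re)) hZ
    have hT := jacEis_act hk m (translation n (-round Z.2.re)) hZ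
    have hG : translation n (-round Z.2.re) ∈ GZinf n := by
      change (ModularGroup.T ^ (-round Z.2.re) : SL(2, ℤ)) 1 0 = 0
      simp [ModularGroup.coe_T_zpow]
    rw [jacFactor_of_mem_GZinf hk m hG, mul_one] at hT
    rw [← hT, hm]
    rw [hm] at hW
    set W : Pt n := (Z.1, Z.2 + ((-round Z.2.re : ℤ) : ℂ)) with hWdef
    have i1 : 1 ≤ W.2.im := by simpa [hWdef] using hR
    have i2 : |W.2.re| ≤ 1 / 2 := by
      have := abs_sub_round Z.2.re
      simpa [hWdef, sub_eq_add_neg] using this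
    have hsq : ‖sq W‖ ≤ B := hB (Set.mem_image_of_mem _ hZK)
    have hsq' : ‖sq W‖ / W.2.im ≤ B := (div_le_self (norm_nonneg _) i1).trans hsq
    refine tsum_of_norm_bounded ((summable_rowSq (one_lt_half hk3)).hasSum.mul_left _) fun q => ?_
    refine (norm_jacTerm_le two_pos hW (rowSq_le_strip i1 i2 q)).trans ?_
    have := one_le_rowSq q
    gcongr

/-- Scaling (c, d) by r = (c²+d²)^{-1/2} leaves c·q/(cw+d) unchanged and takes r^k out of
(cw+d)^{-k}. The terms are thus summable multiples of a holomorphic family over a compact parameter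
set. -/
lemma differentiableOn_jacEis {k : ℕ} (hk : 3 ≤ k) (m : ℝ) :
    DifferentiableOn ℂ (jacEis k m) (HH n) := fun Z₀ hZ₀ => by
  obtain ⟨δ, δ0, hδ⟩ := exists_rowSq_le hZ₀
  let Ψ : (ℂ × ℂ) × Pt n → ℂ := fun q => ((q.1.1 * q.2.2 + q.1.2) ^ k)⁻¹ *
    Complex.exp (2 * Real.pi * Complex.I * m * (-q.1.1 * sq q.2 / (q.1.1 * q.2.2 + q.1.2)))
  let W : Set ((ℂ × ℂ) × Pt n) := {q | q.1.1 * q.2.2 + q.1.2 ≠ 0}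
  have hWo : IsOpen W := isOpen_ne_fun (by fun_prop) continuous_const
  have hsq : ContDiff ℂ 1 (sq : Pt n → ℂ) := by unfold sq; fun_prop
  have hΨ : ContDiffOn ℂ 1 Ψ W := fun q hq => by
    have hq : q.1.1 * q.2.2 + q.1.2 ≠ 0 := hq
    have h1 : ContDiffAt ℂ 1 (fun q : (ℂ × ℂ) × Pt n => q.1.1 * q.2.2 + q.1.2) q := by fun_prop
    have h2 : ContDiffAt ℂ 1 (fun q : (ℂ × ℂ) × Pt n => sq q.2) q := (hsq.comp contDiff_snd).contDiffAt
    have h3 : ContDiffAt ℂ 1 (fun q : (ℂ × ℂ) × Pt n => -q.1.1 * sq q.2) q :=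
      ContDiffAt.mul (by fun_prop) h2
    exact ((((h1.pow k).inv (pow_ne_zero k hq))).mul
      (contDiffAt_const.mul (h3.div h1 hq)).cexp).contDiffWithinAt
  let r : Cosets n → ℝ := fun q => (Real.sqrt (rowSq q))⁻¹
  have hN : ∀ q : Cosets n, 0 < rowSq q := fun q => by linarith [one_le_rowSq q]
  have hr2 : ∀ q, r q ^ 2 = (rowSq q)⁻¹ := fun q => by
    simp only [r, inv_pow, Real.sq_sqrt (hN q).le]
  have hr0 : ∀ q, 0 < r q := fun q => inv_pos.2 (Real.sqrt_pos.2 (hN q))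
  let p : Cosets n → ℂ × ℂ := fun q => (r q * (q.out.2 1 0 : ℂ), r q * (q.out.2 1 1 : ℂ))
  have hden : ∀ q (Z : Pt n), (p q).1 * Z.2 + (p q).2 = r q * den q.out.2 Z := fun q Z => by
    simp only [p, den]; ring
  let K : Set (ℂ × ℂ) := (Metric.closedBall 0 1 ×ˢ Metric.closedBall 0 1) ∩
    {ω | δ ≤ ‖ω.1 * Z₀.2 + ω.2‖ ^ 2}
  have hK : IsCompact K := ((isCompact_closedBall _ _).prod (isCompact_closedBall _ _)).inter_right
    (isClosed_le continuous_const (by fun_prop))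
  have hle : ∀ q : Cosets n, ∀ j : ℤ, (j : ℝ) ^ 2 ≤ rowSq q → ‖(r q : ℂ) * (j : ℂ)‖ ≤ 1 := fun q j hj => by
    rw [← sq_le_one_iff₀ (norm_nonneg _), norm_mul, mul_pow, Complex.norm_real, Real.norm_eq_abs,
      sq_abs, hr2, Complex.norm_intCast, sq_abs, inv_mul_le_iff₀ (hN q), mul_one]
    exact hj
  have hp : ∀ q, p q ∈ K := fun q => by
    refine ⟨⟨mem_closedBall_zero_iff.2 (hle q _ ?_), mem_closedBall_zero_iff.2 (hle q _ ?_)⟩, ?_⟩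
    · unfold rowSq; nlinarith [sq_nonneg (q.out.2 1 1 : ℝ)]
    · unfold rowSq; nlinarith [sq_nonneg (q.out.2 1 0 : ℝ)]
    · change δ ≤ ‖(p q).1 * Z₀.2 + (p q).2‖ ^ 2
      rw [hden, norm_mul, mul_pow, Complex.norm_real, Real.norm_eq_abs, sq_abs, hr2,
        le_inv_mul_iff₀ (hN q), mul_comm]
      exact hδ q
  have hKW : ∀ ω ∈ K, (ω, Z₀) ∈ W := fun ω hω h0 => by
    have h1 : δ ≤ ‖ω.1 * Z₀.2 + ω.2‖ ^ 2 := hω.2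
    have h0 : ω.1 * Z₀.2 + ω.2 = 0 := h0
    rw [h0, norm_zero] at h1
    norm_num at h1
    linarith
  have hsum : Summable fun q : Cosets n => |r q ^ k| := by
    refine (summable_rowSq (n := n) (one_lt_half hk)).congr fun q => ?_
    rw [abs_of_pos (pow_pos (hr0 q) k)]
    simp only [r]
    rw [← Real.rpow_natCast, ← Real.sqrt_inv, Real.sqrt_eq_rpow,
      ← Real.rpow_mul (inv_pos.2 (hN q)).le, Real.inv_rpow (hN q).le, Real.rpow_neg (hN q).le]
    congr 2; ring
  have hd := differentiableAt_tsum_family hWo hΨ hK hKW hsum hp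
  refine DifferentiableAt.differentiableWithinAt ?_
  refine hd.congr_of_eventuallyEq ?_
  filter_upwards [(isOpen_HH n).mem_nhds hZ₀] with Z hZ
  refine tsum_congr fun q => ?_
  have hrc : (r q : ℂ) ≠ 0 := by exact_mod_cast (hr0 q).ne'
  have hD := den_ne_zero q.out.2 hZ
  simp only [Ψ, hden, jacTerm]
  have e : -(p q).1 * sq Z / (r q * den q.out.2 Z) = -(q.out.2 1 0 : ℂ) * sq Z / den q.out.2 Z := by
    simp only [p]; field_simp
  rw [e, mul_pow, mul_inv, ← mul_assoc, ← mul_assoc, zpow_neg, zpow_natCast]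
  congr 1
  push_cast
  rw [mul_inv_cancel₀ (pow_ne_zero k hrc), one_mul]

lemma IsModForm.const_mul {k : ℤ} {m : ℝ} {φ : Pt n → ℂ} (h : IsModForm n k m φ) (t : ℂ) :
    IsModForm n k m (fun Z => t * φ Z) where
  transform := fun A Z hZ => by rw [h.transform A Z hZ]; ring
  perm := fun w Z hZ => by rw [h.perm w Z hZ]
  bounded := fun K hK => by
    obtain ⟨C, R, hC⟩ := h.bounded K hK
    refine ⟨‖t‖ * C, R, fun Z hZ h1 h2 => ?_⟩
    rw [norm_mul]; gcongr; exact hC Z hZ h1 h2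

lemma IsModForm.pow {k : ℤ} {m : ℝ} {φ : Pt n → ℂ} (h : IsModForm n k m φ) (N : ℕ) :
    IsModForm n (N * k) (N * m) (fun Z => φ Z ^ N) where
  transform := fun A Z hZ => by
    rw [h.transform A Z hZ, mul_pow, mul_pow, ← Complex.exp_nat_mul, mul_comm (N : ℤ) k, zpow_mul,
      zpow_natCast]
    congr 3
    push_cast; ring
  perm := fun w Z hZ => by rw [h.perm w Z hZ]
  bounded := fun K hK => by
    obtain ⟨C, R, hC⟩ := h.bounded K hK
    refine ⟨C ^ N, R, fun Z hZ h1 h2 => ?_⟩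
    rw [norm_pow]; gcongr; exact hC Z hZ h1 h2

lemma IsModForm.sub {k : ℤ} {m : ℝ} {φ ψ : Pt n → ℂ} (h : IsModForm n k m φ) (h' : IsModForm n k m ψ) :
    IsModForm n k m (fun Z => φ Z - ψ Z) where
  transform := fun A Z hZ => by rw [h.transform A Z hZ, h'.transform A Z hZ]; ring
  perm := fun w Z hZ => by rw [h.perm w Z hZ, h'.perm w Z hZ]
  bounded := fun K hK => by
    obtain ⟨C, R, hC⟩ := h.bounded K hK
    obtain ⟨C', R', hC'⟩ := h'.bounded K hK
    refine ⟨C + C', max R R', fun Z hZ h1 h2 => (norm_sub_le _ _).trans (add_le_add ?_ ?_)⟩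
    · exact hC Z hZ h1 ((le_max_left _ _).trans h2)
    · exact hC' Z hZ h1 ((le_max_right _ _).trans h2)

lemma isModForm_g2_cube (m : ℝ) : IsModForm n 12 (3 * m) (fun Z => g2 m Z ^ 3) := by
  have := ((isModForm_jacEis (n := n) (k := 4) (by decide) (by norm_num) m).const_mul
    (4 / 3 * (Real.pi : ℂ) ^ 4)).pow 3
  norm_num at this
  exact this

/-- The index 3m/2 of the second series is chosen so that its square has index 3m, like the cube of
the first. -/
lemma isModForm_disc (m : ℝ) : IsModForm n 12 (3 * m) (disc m) := by
  have := (((isModForm_jacEis (n := n) (k := 6) (by decide) (by norm_num) (3 / 2 * m)).const_mul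
    (8 / 27 * (Real.pi : ℂ) ^ 6)).pow 2).const_mul 27
  have e : ((2 : ℕ) : ℝ) * (3 / 2 * m) = 3 * m := by push_cast; ring
  rw [e] at this
  norm_num at this
  exact (isModForm_g2_cube m).sub this

lemma differentiableOn_g2_cube (m : ℝ) : DifferentiableOn ℂ (fun Z => g2 m Z ^ 3) (HH n) :=
  ((differentiableOn_jacEis (by norm_num) m).const_mul _).pow 3

lemma differentiableOn_disc (m : ℝ) : DifferentiableOn ℂ (disc m) (HH n) :=
  (differentiableOn_g2_cube m).sub
    ((((differentiableOn_jacEis (by norm_num) (3 / 2 * m)).const_mul _).pow 2).const_mul 27)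

lemma IsModForm.act {k : ℤ} {m : ℝ} {φ : Pt n → ℂ} (h : IsModForm n k m φ) (γ : GZ n) {Z : Pt n}
    (hZ : Z ∈ HH n) : φ (act γ Z) = den γ.2 Z ^ k *
      Complex.exp (2 * Real.pi * Complex.I * m * (γ.2 1 0 : ℂ) * sq Z / den γ.2 Z) * φ Z := by
  rw [← h.transform γ.2 Z hZ]
  exact h.perm γ.1⁻¹ _ (act_mem_HH (1, γ.2) hZ)

/-- The numerator and the denominator have the same weight and index, so the same nonzero factor
cancels. -/
lemma jm_act (m : ℝ) (γ : GZ n) {Z : Pt n} (hZ : Z ∈ HH n) (h : disc m Z ≠ 0) :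
    disc m (act γ Z) ≠ 0 ∧ jm m (act γ Z) = jm m Z := by
  have h1 := (isModForm_disc m).act γ hZ
  have h2 := (isModForm_g2_cube m).act γ hZ
  have h0 : den γ.2 Z ^ (12 : ℤ) * Complex.exp (2 * Real.pi * Complex.I * (3 * m : ℝ) *
      (γ.2 1 0 : ℂ) * sq Z / den γ.2 Z) ≠ 0 :=
    mul_ne_zero (zpow_ne_zero _ (den_ne_zero _ hZ)) (Complex.exp_ne_zero _)
  refine ⟨by rw [h1]; exact mul_ne_zero h0 h, ?_⟩
  rw [jm, jm, h1, h2, mul_left_comm, mul_div_mul_left _ _ h0]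

/-! #### Restriction to the axis -/

/-- Cosets and signs parametrize the coprime pairs. -/
def cosetRow (p : Cosets n × ℤˣ) : EisensteinSeries.gammaSet 1 1 0 :=
  ⟨![p.2 * p.1.out.2 1 0, p.2 * p.1.out.2 1 1], by
    rw [EisensteinSeries.mem_gammaSet_one]
    have h := det_eq p.1.out.2
    have hu : (p.2 : ℤ) * p.2 = 1 := by rw [← Units.val_mul, Int.units_mul_self, Units.val_one]
    refine ⟨-(p.2 * p.1.out.2 0 1), p.2 * p.1.out.2 0 0, ?_⟩
    simp only [Matrix.cons_val_zero, Matrix.cons_val_one]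
    linear_combination ((p.2 : ℤ) * p.2) * h + hu⟩

/-- A coset fixes its lower row up to sign and the unit chooses the sign; every coprime pair is the
lower row of some matrix, and the chosen representative differs from it by d = ±1 of a parabolic
element. -/
lemma bijective_cosetRow : Function.Bijective (cosetRow (n := n)) := by
  refine ⟨fun ⟨q, u⟩ ⟨r, v⟩ h => ?_, fun ⟨w, hw⟩ => ?_⟩
  · have h0 : (u : ℤ) * q.out.2 1 0 = v * r.out.2 1 0 := congrFun (congrArg Subtype.val h) 0
    have h1 : (u : ℤ) * q.out.2 1 1 = v * r.out.2 1 1 := congrFun (congrArg Subtype.val h) 1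
    have hqr : q = r := eq_of_row_parallel <| by
      have e : (u : ℤ) * v * (r.out.2 1 0 * q.out.2 1 1 - r.out.2 1 1 * q.out.2 1 0) = 0 := by
        linear_combination (v * r.out.2 1 0 : ℤ) * h1 - (v * r.out.2 1 1 : ℤ) * h0
      rcases mul_eq_zero.1 e with e | e
      · exact absurd e (mul_ne_zero u.ne_zero v.ne_zero)
      · linarith
    subst hqr
    have huv : (u : ℤ) = v := by
      by_contra hne
      have hp := row_sq_pos q.out.2
      have e0 : q.out.2 1 0 = 0 := by
        by_contra h; exact hne (mul_right_cancel₀ h h0)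
      have e1 : q.out.2 1 1 = 0 := by
        by_contra h; exact hne (mul_right_cancel₀ h h1)
      simp [e0, e1] at hp
    rw [Units.ext huv]
  · rw [EisensteinSeries.mem_gammaSet_one] at hw
    obtain ⟨A, -, hA⟩ := ModularGroup.bottom_row_surj (R := ℤ) (show w ∈ {cd | IsCoprime (cd 0) (cd 1)} from hw)
    have hA0 : A 1 0 = w 0 := congrFun hA 0
    have hA1 : A 1 1 = w 1 := congrFun hA 1
    let q : Cosets n := Quotient.mk'' (1, A)
    have hq : QuotientGroup.rightRel (GZinf n) (1, A) q.out := by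
      apply Quotient.eq''.1
      rw [Quotient.out_eq']
    rw [QuotientGroup.rightRel_apply] at hq
    set h := q.out * (1, A)⁻¹ with hh
    have hqo : q.out = h * (1, A) := by rw [hh]; group
    have hc : h.2 1 0 = 0 := hq
    have hd := det_eq h.2
    rw [hc, mul_zero, sub_zero] at hd
    have hu : IsUnit (h.2 1 1) := IsUnit.of_mul_eq_one _ (by rw [mul_comm]; exact hd)
    have hu1 : h.2 1 1 * h.2 1 1 = 1 := Int.isUnit_mul_self hu
    refine ⟨(q, hu.unit), Subtype.ext (funext fun j => ?_)⟩
    have e0 : q.out.2 1 0 = h.2 1 1 * w 0 := by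
      rw [hqo, Prod.snd_mul, mul_apply_row, hc, ← hA0]; ring
    have e1 : q.out.2 1 1 = h.2 1 1 * w 1 := by
      rw [hqo, Prod.snd_mul, mul_apply_row, hc, ← hA1]; ring
    fin_cases j
    · change (hu.unit : ℤ) * q.out.2 1 0 = w 0
      rw [e0, IsUnit.unit_spec, ← mul_assoc, hu1, one_mul]
    · change (hu.unit : ℤ) * q.out.2 1 1 = w 1
      rw [e1, IsUnit.unit_spec, ← mul_assoc, hu1, one_mul]

/-- For z = 0 the exponentials are 1. The classical series is half the sum over coprime pairs, and
for even k the two signs belonging to a coset contribute equally. -/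
lemma jacEis_axis {k : ℕ} (hk : Even k) (hk3 : 3 ≤ k) (m : ℝ) (w : UpperHalfPlane) :
    jacEis k m ((0, (w : ℂ)) : Pt n) = ModularForm.E hk3 w := by
  have hZ : ((0, (w : ℂ)) : Pt n) ∈ HH n := by
    change ∑ j : Fin n, ‖(0 : Fin n → ℂ) j‖ ^ 2 < (w : ℂ).im
    simpa using w.im_pos
  have hk' : Even (-(k : ℤ)) := by simpa using hk
  have ht : ∀ p : Cosets n × ℤˣ, EisensteinSeries.eisSummand k (cosetRow p).1 w =
      jacTerm k m ((0, (w : ℂ)) : Pt n) p.1 := fun p => by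
    have hs : sq ((0, (w : ℂ)) : Pt n) = 0 := by simp [sq]
    have hu : (((p.2 : ℤ) : ℂ)) ^ (-(k : ℤ)) = 1 := by
      rcases Int.units_eq_one_or p.2 with h | h <;> simp [h, hk'.neg_one_zpow]
    have hd : den p.1.out.2 ((0, (w : ℂ)) : Pt n) = (p.1.out.2 1 0 : ℂ) * w + p.1.out.2 1 1 := rfl
    simp only [EisensteinSeries.eisSummand, cosetRow, Matrix.cons_val_zero, Matrix.cons_val_one,
      jacTerm, hs, hd]
    push_cast
    rw [mul_assoc, ← mul_add, mul_zpow, hu]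
    simp
  have hsum : Summable (jacTerm k m ((0, (w : ℂ)) : Pt n)) := summable_jacTerm hk3 m hZ
  have hE : ModularForm.E hk3 w = 1 / 2 * ∑' v : EisensteinSeries.gammaSet 1 1 0,
      EisensteinSeries.eisSummand k v.1 w := rfl
  rw [hE, ← (Equiv.ofBijective _ (bijective_cosetRow (n := n))).tsum_eq]
  simp only [Equiv.ofBijective_apply, ht]
  have h2 : HasSum (fun p : Cosets n × ℤˣ => jacTerm k m ((0, (w : ℂ)) : Pt n) p.1)
      (∑' q : Cosets n, (2 : ℂ) * jacTerm k m ((0, (w : ℂ)) : Pt n) q) := by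
    have hs2 : Summable (fun p : Cosets n × ℤˣ => jacTerm k m ((0, (w : ℂ)) : Pt n) p.1) := by
      have := (hsum.norm.mul_norm (g := fun _ : ℤˣ => (1 : ℂ)) Summable.of_finite).of_norm
      simpa only [mul_one] using this
    rw [hs2.hasSum_iff, hs2.tsum_prod]
    refine tsum_congr fun q => ?_
    rw [tsum_fintype]
    simp
  rw [h2.tsum_eq, tsum_mul_left, ← mul_assoc]
  simp only [jacEis]
  norm_num

/-- On the axis Δ_m is (64/27)π¹²(E₄³ − E₆²) for every m. As E₄³ − E₆² is 1728 times the
discriminant, this is 4096π¹² times a function without zeros. -/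
lemma exists_disc_ne_zero (m : ℝ) : ∃ Z ∈ HH n, disc m Z ≠ 0 := by
  refine ⟨(0, (UpperHalfPlane.I : ℂ)), ?_, ?_⟩
  · change ∑ j : Fin n, ‖(0 : Fin n → ℂ) j‖ ^ 2 < (UpperHalfPlane.I : ℂ).im
    simp
  · have h := ModularForm.discriminant_eq_E₄_cube_sub_E₆_sq UpperHalfPlane.I
    have h0 := ModularForm.discriminant_ne_zero UpperHalfPlane.I
    rw [disc, g2, g3, jacEis_axis (by decide) (by norm_num), jacEis_axis (by decide) (by norm_num)]
    have hpi : (Real.pi : ℂ) ≠ 0 := by exact_mod_cast Real.pi_ne_zero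
    have e : (4 / 3 * (Real.pi : ℂ) ^ 4 * ModularForm.E (k := 4) (by norm_num) UpperHalfPlane.I) ^ 3 -
        27 * (8 / 27 * (Real.pi : ℂ) ^ 6 * ModularForm.E (k := 6) (by norm_num) UpperHalfPlane.I) ^ 2 =
        4096 * (Real.pi : ℂ) ^ 12 * ModularForm.discriminant UpperHalfPlane.I := by
      rw [h]; ring
    rw [e]
    exact mul_ne_zero (mul_ne_zero (by norm_num) (pow_ne_zero _ hpi)) h0

end Jacobi
end UnitaryForms
end

noncomputable section
namespace UnitaryForms

open Filter Topology MeasureTheory Set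

/-! ### The logarithmic singularity of the nondegenerate kernel -/

/-- The mean value inequality for t ↦ (t+τ)^{-a} on [0, x], whose derivative is at most |a|τ^{-Re
a−1}: for τ large against x the integrand is 1/τ up to O(x/τ²). -/
lemma norm_cpow_add_sub_le {a : ℂ} (ha : 0 ≤ a.re) {x τ : ℝ} (hx : 0 ≤ x) (hτ : 0 < τ) :
    ‖(τ : ℂ) ^ (a - 1) * ((x : ℂ) + τ) ^ (-a) - (τ : ℂ)⁻¹‖ ≤ ‖a‖ * (x * (τ ^ 2)⁻¹) := by
  have t0 : (τ : ℂ) ≠ 0 := by exact_mod_cast hτ.ne'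
  have hd : ∀ t ∈ Icc (0 : ℝ) x, HasDerivWithinAt (fun t : ℝ => ((t : ℂ) + τ) ^ (-a))
      (-a * ((t : ℂ) + τ) ^ (-a - 1) * 1) (Icc 0 x) t := fun t ht => by
    have hs : (t : ℂ) + τ ∈ Complex.slitPlane := by
      refine Or.inl ?_
      simp only [Complex.add_re, Complex.ofReal_re]; linarith [ht.1]
    exact ((((hasDerivAt_id (t : ℂ)).add_const (τ : ℂ)).cpow_const hs).comp_ofReal).hasDerivWithinAt
  have hb : ∀ t ∈ Ico (0 : ℝ) x, ‖-a * ((t : ℂ) + τ) ^ (-a - 1) * 1‖ ≤ ‖a‖ * τ ^ (-a.re - 1) :=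
    fun t ht => by
    rw [mul_one, norm_mul, norm_neg, ← Complex.ofReal_add,
      Complex.norm_cpow_eq_rpow_re_of_pos (by linarith [ht.1])]
    refine mul_le_mul_of_nonneg_left ?_ (norm_nonneg _)
    simp only [Complex.sub_re, Complex.neg_re, Complex.one_re]
    exact Real.rpow_le_rpow_of_nonpos hτ (by linarith [ht.1]) (by linarith)
  have h := norm_image_sub_le_of_norm_deriv_le_segment' hd hb x (right_mem_Icc.2 hx)
  simp only [Complex.ofReal_zero, zero_add, sub_zero] at h
  have e : (τ : ℂ) ^ (a - 1) * ((x : ℂ) + τ) ^ (-a) - (τ : ℂ)⁻¹ =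
      (τ : ℂ) ^ (a - 1) * (((x : ℂ) + τ) ^ (-a) - (τ : ℂ) ^ (-a)) := by
    rw [mul_sub, ← Complex.cpow_add _ _ t0, show a - 1 + -a = -1 by ring, Complex.cpow_neg_one]
  rw [e, norm_mul, Complex.norm_cpow_eq_rpow_re_of_pos hτ]
  calc τ ^ (a - 1).re * ‖((x : ℂ) + τ) ^ (-a) - (τ : ℂ) ^ (-a)‖ ≤
        τ ^ (a.re - 1) * (‖a‖ * τ ^ (-a.re - 1) * x) := by
        simp only [Complex.sub_re, Complex.one_re]; gcongr
    _ = ‖a‖ * (x * (τ ^ (a.re - 1) * τ ^ (-a.re - 1))) := by ring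
    _ = _ := by
      rw [← Real.rpow_add hτ, show a.re - 1 + (-a.re - 1) = -(2 : ℕ) by push_cast; ring,
        Real.rpow_neg hτ.le, Real.rpow_natCast]

/-- This is used for 0 < τ ≤ x, an interval of length x, whose contribution to the integral thus
stays bounded. -/
lemma norm_cpow_mul_cpow_add_le {a : ℂ} (ha : 1 < a.re) {x τ : ℝ} (hx : 0 < x) (hτ : 0 < τ)
    (h : τ ≤ x) : ‖(τ : ℂ) ^ (a - 1) * ((x : ℂ) + τ) ^ (-a)‖ ≤ x⁻¹ := by
  rw [norm_mul, ← Complex.ofReal_add, Complex.norm_cpow_eq_rpow_re_of_pos hτ,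
    Complex.norm_cpow_eq_rpow_re_of_pos (by linarith)]
  simp only [Complex.sub_re, Complex.one_re, Complex.neg_re]
  calc τ ^ (a.re - 1) * (x + τ) ^ (-a.re) ≤ x ^ (a.re - 1) * x ^ (-a.re) :=
        mul_le_mul (Real.rpow_le_rpow hτ.le h (by linarith))
          (Real.rpow_le_rpow_of_nonpos hx (by linarith) (by linarith)) (by positivity) (by positivity)
    _ = x⁻¹ := by
      rw [← Real.rpow_add hx, show a.re - 1 + -a.re = -1 by ring, Real.rpow_neg_one]

/-- `∫₀¹ τ^{a-1} (x + τ)^{-a} k(τ) dτ` grows like `-k(0) log x` as `x → 0`. -/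
lemma tendsto_norm_integral_atTop {a : ℂ} (ha : 1 < a.re) {k : ℝ → ℂ}
    (hk : IntegrableOn (fun τ : ℝ => (τ : ℂ) ^ (a - 1) * k τ) (Ioc 0 1))
    (hk0 : ContinuousAt k 0) (hc : k 0 ≠ 0) :
    Tendsto (fun x : ℝ => ‖∫ τ in Ioc (0 : ℝ) 1, (τ : ℂ) ^ (a - 1) * k τ * ((x : ℂ) + τ) ^ (-a)‖)
      (𝓝[>] 0) atTop := by
  set c := k 0
  have c0 : 0 < ‖c‖ := norm_pos_iff.2 hc
  obtain ⟨δ', δ0', hδ'⟩ := Metric.continuousAt_iff.1 hk0 (‖c‖ / 2) (by positivity)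
  set δ := min (δ' / 2) 1
  have δ0 : 0 < δ := by positivity
  have δ1 : δ ≤ 1 := min_le_right _ _
  have hδ : ∀ τ, 0 < τ → τ ≤ δ → ‖k τ - c‖ ≤ ‖c‖ / 2 := fun τ h0 h1 => by
    have : dist τ 0 < δ' := by
      rw [Real.dist_eq, sub_zero, abs_of_pos h0]
      linarith [h1.trans (min_le_left (δ' / 2) 1)]
    have := (hδ' this).le
    rwa [dist_eq_norm] at this
  have hδk : ∀ τ, 0 < τ → τ ≤ δ → ‖k τ‖ ≤ 3 / 2 * ‖c‖ := fun τ h0 h1 => by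
    have := norm_add_le (k τ - c) c
    rw [sub_add_cancel] at this
    linarith [hδ τ h0 h1]
  set I₀ := ∫ τ in Ioc (0 : ℝ) 1, ‖(τ : ℂ) ^ (a - 1) * k τ‖
  -- The three summands bound the contributions of [0,x], of the error x/τ² on [x,δ], and of [δ,1].
  -- The main term on [x,δ] is c(log δ − log x); replacing k by c there costs at most half of it, as
  -- |k − c| ≤ |c|/2.
  set K := 3 / 2 * ‖c‖ + ‖a‖ * (3 / 2 * ‖c‖) + δ ^ (-a.re) * I₀
  have main : ∀ x ∈ Ioo (0 : ℝ) δ, ‖c‖ / 2 * (Real.log δ - Real.log x) - K ≤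
      ‖∫ τ in Ioc (0 : ℝ) 1, (τ : ℂ) ^ (a - 1) * k τ * ((x : ℂ) + τ) ^ (-a)‖ := by
    rintro x ⟨x0, x1⟩
    set F : ℝ → ℂ := fun τ => (τ : ℂ) ^ (a - 1) * k τ * ((x : ℂ) + τ) ^ (-a) with hF
    have hFi : IntegrableOn F (Ioc 0 1) := integrable_mul_continuousOn hk fun τ hτ => by
      have hs : (x : ℂ) + τ ∈ Complex.slitPlane := by
        refine Or.inl ?_
        simp only [Complex.add_re, Complex.ofReal_re]; linarith [hτ.1]
      have hc : ContinuousAt (fun τ : ℝ => (x : ℂ) + τ) τ := by fun_prop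
      exact (hc.cpow continuousAt_const hs).continuousWithinAt
    have hI : IntervalIntegrable F volume 0 1 :=
      (intervalIntegrable_iff_integrableOn_Ioc_of_le zero_le_one).2 hFi
    have i1 : IntervalIntegrable F volume 0 x := hI.mono_set (by
      rw [uIcc_of_le x0.le, uIcc_of_le zero_le_one]; exact Icc_subset_Icc le_rfl (by linarith))
    have i2 : IntervalIntegrable F volume x δ := hI.mono_set (by
      rw [uIcc_of_le x1.le, uIcc_of_le zero_le_one]; exact Icc_subset_Icc x0.le δ1)
    have i3 : IntervalIntegrable F volume δ 1 := hI.mono_set (by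
      rw [uIcc_of_le δ1, uIcc_of_le zero_le_one]; exact Icc_subset_Icc δ0.le le_rfl)
    have hsplit : ∫ τ in Ioc (0 : ℝ) 1, F τ =
        (∫ τ in (0 : ℝ)..x, F τ) + (∫ τ in x..δ, F τ) + ∫ τ in δ..1, F τ := by
      rw [← intervalIntegral.integral_of_le zero_le_one,
        intervalIntegral.integral_add_adjacent_intervals i1 i2,
        intervalIntegral.integral_add_adjacent_intervals (i1.trans i2) i3]
    have b1 : ‖∫ τ in (0 : ℝ)..x, F τ‖ ≤ 3 / 2 * ‖c‖ := by
      have := intervalIntegral.norm_integral_le_of_norm_le_const (a := 0) (b := x) (f := F)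
        (C := x⁻¹ * (3 / 2 * ‖c‖)) fun τ hτ => by
          rw [uIoc_of_le x0.le] at hτ
          simp only [hF]
          rw [mul_right_comm, norm_mul]
          exact mul_le_mul (norm_cpow_mul_cpow_add_le ha x0 hτ.1 hτ.2)
            (hδk τ hτ.1 (hτ.2.trans x1.le)) (norm_nonneg _) (by positivity)
      rw [sub_zero, abs_of_pos x0] at this
      refine this.trans (le_of_eq ?_)
      field_simp
    have b3 : ‖∫ τ in δ..1, F τ‖ ≤ δ ^ (-a.re) * I₀ := by
      rw [intervalIntegral.integral_of_le δ1]
      calc ‖∫ τ in Ioc δ 1, F τ‖ ≤ ∫ τ in Ioc δ 1, δ ^ (-a.re) * ‖(τ : ℂ) ^ (a - 1) * k τ‖ := by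
            refine norm_integral_le_of_norm_le ((IntegrableOn.mono_set (t := Ioc 0 1) hk.norm
              (Ioc_subset_Ioc_left δ0.le)).const_mul _) ?_
            filter_upwards [ae_restrict_mem measurableSet_Ioc] with τ hτ
            simp only [hF]
            rw [norm_mul, mul_comm]
            refine mul_le_mul_of_nonneg_right ?_ (norm_nonneg _)
            rw [← Complex.ofReal_add, Complex.norm_cpow_eq_rpow_re_of_pos (by linarith [hτ.1]),
              Complex.neg_re]
            exact Real.rpow_le_rpow_of_nonpos δ0 (by linarith [hτ.1]) (by linarith)
        _ = δ ^ (-a.re) * ∫ τ in Ioc δ 1, ‖(τ : ℂ) ^ (a - 1) * k τ‖ := integral_const_mul _ _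
        _ ≤ _ := by
          refine mul_le_mul_of_nonneg_left ?_ (by positivity)
          exact setIntegral_mono_set hk.norm (Eventually.of_forall fun _ => norm_nonneg _)
            (LE.le.eventuallyLE (Ioc_subset_Ioc_left δ0.le))
    have hu : ∀ τ ∈ uIcc x δ, τ ≠ 0 := fun τ hτ => by
      rw [uIcc_of_le x1.le] at hτ; linarith [hτ.1]
    have ilog : IntervalIntegrable (fun τ : ℝ => c * (τ : ℂ)⁻¹) volume x δ := by
      refine ContinuousOn.intervalIntegrable fun τ hτ => ?_
      exact (continuousAt_const.mul (ContinuousAt.inv₀ (by fun_prop)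
        (by exact_mod_cast hu τ hτ))).continuousWithinAt
    have hlog : ∫ τ in x..δ, c * (τ : ℂ)⁻¹ = c * ((Real.log δ - Real.log x : ℝ) : ℂ) := by
      rw [intervalIntegral.integral_const_mul]
      congr 1
      rw [← Real.log_div δ0.ne' x0.ne', ← integral_inv_of_pos x0 δ0, ← intervalIntegral.integral_ofReal]
      simp only [Complex.ofReal_inv]
    have b2 : ‖(∫ τ in x..δ, F τ) - c * ((Real.log δ - Real.log x : ℝ) : ℂ)‖ ≤
        ‖a‖ * (3 / 2 * ‖c‖) + ‖c‖ / 2 * (Real.log δ - Real.log x) := by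
      rw [← hlog, ← intervalIntegral.integral_sub i2 ilog]
      have hg : ∀ τ ∈ uIcc x δ, HasDerivAt
          (fun τ : ℝ => -(‖a‖ * (3 / 2 * ‖c‖) * (x * τ⁻¹)) + ‖c‖ / 2 * Real.log τ)
          (‖a‖ * (3 / 2 * ‖c‖) * (x * (τ ^ 2)⁻¹) + ‖c‖ / 2 * τ⁻¹) τ := fun τ hτ => by
        have h1 := (((hasDerivAt_inv (hu τ hτ)).const_mul x).const_mul (‖a‖ * (3 / 2 * ‖c‖))).neg
        have h2 := (Real.hasDerivAt_log (hu τ hτ)).const_mul (‖c‖ / 2)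
        refine (h1.add h2).congr_deriv ?_
        ring
      have hgi : IntervalIntegrable
          (fun τ : ℝ => ‖a‖ * (3 / 2 * ‖c‖) * (x * (τ ^ 2)⁻¹) + ‖c‖ / 2 * τ⁻¹) volume x δ := by
        refine ContinuousOn.intervalIntegrable fun τ hτ => ?_
        have := hu τ hτ
        have : ContinuousAt (fun τ : ℝ => ‖a‖ * (3 / 2 * ‖c‖) * (x * (τ ^ 2)⁻¹) + ‖c‖ / 2 * τ⁻¹) τ := by
          fun_prop (disch := positivity)
        exact this.continuousWithinAt
      refine (intervalIntegral.norm_integral_le_of_norm_le x1.le (Eventually.of_forall fun τ hτ => ?_)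
        hgi).trans ?_
      · have t0 : 0 < τ := x0.trans hτ.1
        have e : F τ - c * (τ : ℂ)⁻¹ = ((τ : ℂ) ^ (a - 1) * ((x : ℂ) + τ) ^ (-a) - (τ : ℂ)⁻¹) * k τ +
            (k τ - c) * (τ : ℂ)⁻¹ := by simp only [hF]; ring
        rw [e]
        refine (norm_add_le _ _).trans (add_le_add ?_ ?_)
        · rw [norm_mul]
          calc _ ≤ ‖a‖ * (x * (τ ^ 2)⁻¹) * (3 / 2 * ‖c‖) :=
                mul_le_mul (norm_cpow_add_sub_le (by linarith) x0.le t0) (hδk τ t0 hτ.2)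
                  (norm_nonneg _) (by positivity)
            _ = _ := by ring
        · rw [norm_mul, norm_inv, Complex.norm_real, Real.norm_eq_abs, abs_of_pos t0]
          exact mul_le_mul_of_nonneg_right (hδ τ t0 hτ.2) (by positivity)
      · rw [intervalIntegral.integral_eq_sub_of_hasDerivAt hg hgi, mul_inv_cancel₀ x0.ne']
        have : 0 ≤ ‖a‖ * (3 / 2 * ‖c‖) * (x * δ⁻¹) := by positivity
        linarith
    have h := norm_sub_le_norm_add (c * ((Real.log δ - Real.log x : ℝ) : ℂ))
      ((∫ τ in (0 : ℝ)..x, F τ) + ((∫ τ in x..δ, F τ) - c * ((Real.log δ - Real.log x : ℝ) : ℂ)) +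
        ∫ τ in δ..1, F τ)
    have h3 := (norm_add₃_le (a := ∫ τ in (0 : ℝ)..x, F τ)
      (b := (∫ τ in x..δ, F τ) - c * ((Real.log δ - Real.log x : ℝ) : ℂ)) (c := ∫ τ in δ..1, F τ))
    have e : c * ((Real.log δ - Real.log x : ℝ) : ℂ) + ((∫ τ in (0 : ℝ)..x, F τ) +
        ((∫ τ in x..δ, F τ) - c * ((Real.log δ - Real.log x : ℝ) : ℂ)) + ∫ τ in δ..1, F τ) =
        ∫ τ in Ioc (0 : ℝ) 1, F τ := by rw [hsplit]; ring
    rw [e] at h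
    have hl : 0 ≤ Real.log δ - Real.log x := sub_nonneg.2 (Real.log_le_log x0 x1.le)
    rw [norm_mul, Complex.norm_real, Real.norm_eq_abs, abs_of_nonneg hl] at h
    have hK : K = 3 / 2 * ‖c‖ + ‖a‖ * (3 / 2 * ‖c‖) + δ ^ (-a.re) * I₀ := rfl
    linarith
  have ht : Tendsto (fun x : ℝ => ‖c‖ / 2 * (Real.log δ - Real.log x) - K) (𝓝[>] 0) atTop := by
    have h1 : Tendsto (fun x : ℝ => Real.log δ + -Real.log x) (𝓝[>] 0) atTop :=
      tendsto_atTop_add_const_left _ _ (tendsto_neg_atBot_atTop.comp Real.tendsto_log_nhdsGT_zero)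
    have h2 := tendsto_atTop_add_const_right _ (-K) (h1.const_mul_atTop (show 0 < ‖c‖ / 2 by positivity))
    simpa only [sub_eq_add_neg] using h2
  exact tendsto_atTop_mono' _ (by
    filter_upwards [Ioo_mem_nhdsGT δ0] with x hx using main x hx) ht

/-! ### Separation of the series attached to inequivalent points -/

section Inequivalent
variable {n : ℕ} {a b : ℂ}

lemma zero_mem_cutPlane : (0 : ℂ) ∈ cutPlane := by
  simpa using neg_ofReal_mem_cutPlane (r := 0) (by norm_num : (-1 : ℝ) < 0)

/-- The nondegenerate kernel is unbounded as `x → 0`. -/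
lemma tendsto_norm_kerF3_atTop (ha : 1 < a.re) (hb : (n : ℝ) - 1 < b.re) (hn : 1 ≤ n) {y : ℝ}
    (hy : 0 < y) (hg : gaussF b (b - n + 1) (a + 2 * b - n) (-(y : ℂ)⁻¹) ≠ 0) :
    Tendsto (fun x : ℝ => ‖kerF3 n a b x y‖) (𝓝[>] 0) atTop := by
  obtain ⟨h1, h2, h3, h4, h5⟩ := kerF3_param ha hb hn
  set G := gaussF b (b - n + 1) (a + 2 * b - n)
  set d := a + 2 * b - n
  have hG : ContinuousOn G cutPlane := (gaussF_spec h3 h4).1.continuousOn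
  have hyc : -(y : ℂ)⁻¹ ∈ cutPlane := neg_inv_mem_cutPlane (by simpa using hy)
  let h : ℝ → ℂ := fun τ => G ((1 - τ) * -(y : ℂ)⁻¹)
  let k : ℝ → ℂ := fun τ => (1 - τ : ℂ) ^ (d - 1) * h τ
  have hk : IntegrableOn (fun τ : ℝ => (τ : ℂ) ^ (a - 1) * k τ) (Ioc 0 1) := by
    have := (integrable_mul_continuousOn (integrableOn_betaWeight h1 h5)
      (continuousOn_right hG hyc)).const_mul (Complex.betaIntegral a d)
    refine this.congr (Eventually.of_forall fun τ => ?_)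
    have hB := betaIntegral_ne_zero h1 h5
    simp only [betaWeight, k, h]
    field_simp
  have hk0 : ContinuousAt k 0 := by
    have c1 : ContinuousAt (fun τ : ℝ => (1 - τ : ℂ)) 0 := by fun_prop
    have c2 : ContinuousAt (fun τ : ℝ => (1 - τ : ℂ) * -(y : ℂ)⁻¹) 0 := by fun_prop
    have c3 : ContinuousAt G ((1 - (0 : ℝ) : ℂ) * -(y : ℂ)⁻¹) :=
      hG.continuousAt (isOpen_cutPlane.mem_nhds (by simpa using hyc))
    exact (c1.cpow continuousAt_const (by simp)).mul (ContinuousAt.comp (g := G) c3 c2)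
  have hc : k 0 ≠ 0 := by simpa [k, h] using hg
  have hB := betaIntegral_ne_zero h1 h5
  have hy0 : (y : ℂ) ^ (-b) ≠ 0 := by
    exact Complex.cpow_ne_zero_iff.2 (Or.inl (by exact_mod_cast hy.ne'))
  have ht := (tendsto_norm_integral_atTop ha hk hk0 hc).const_mul_atTop
    (norm_pos_iff.2 (mul_ne_zero hy0 (inv_ne_zero hB)))
  refine ht.congr' ?_
  filter_upwards [self_mem_nhdsWithin (a := (0 : ℝ)) (s := Ioi 0)] with x hx
  have hx : 0 < x := hx
  -- The power of x is moved inside: x^{-a}(1+τ/x)^{-a} = (x+τ)^{-a}, which brings the kernel into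
  -- the form of the singular integral.
  have key : (Complex.betaIntegral a d)⁻¹ *
      ∫ τ in Ioc (0 : ℝ) 1, (τ : ℂ) ^ (a - 1) * k τ * ((x : ℂ) + τ) ^ (-a) =
      (x : ℂ) ^ (-a) * betaTransform (betaWeight a d) (fun z => (1 - z) ^ (-a)) G
        (-(x : ℂ)⁻¹, -(y : ℂ)⁻¹) := by
    rw [betaTransform, ← integral_const_mul, ← integral_const_mul]
    refine setIntegral_congr_fun measurableSet_Ioc fun τ hτ => ?_
    have e1 : ((x : ℂ) + τ) ^ (-a) = (x : ℂ) ^ (-a) * (1 - τ * -(x : ℂ)⁻¹) ^ (-a) := by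
      have e : (1 - τ * -(x : ℂ)⁻¹ : ℂ) = ((1 + τ / x : ℝ) : ℂ) := by push_cast; ring
      have := hτ.1
      rw [e, ← Complex.mul_cpow_ofReal_nonneg hx.le (by positivity), ← Complex.ofReal_mul]
      congr 1
      have hx0 : (x : ℂ) ≠ 0 := by exact_mod_cast hx.ne'
      push_cast
      field_simp
    simp only [e1, betaWeight, k, h]
    ring
  rw [← norm_mul, kerF3_eq_betaKernel ha hb hn hx hy, betaKernel, mul_assoc, key]
  congr 1
  ring

/-- As y → ∞ the argument tends to 0, where the function has the value 1. -/
lemma exists_gaussF_ne_zero {a b c : ℂ} (hb : 0 < b.re) (hc : 0 < (c - b).re) :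
    ∃ y : ℝ, 0 < y ∧ gaussF a b c (-(y : ℂ)⁻¹) ≠ 0 := by
  have h1 : gaussF a b c 0 = 1 := by
    have h := (gaussF_spec (a := a) hb hc).2 0 (by simp)
    refine h.unique (hasSum_of_eq (hasSum_single 0 fun m hm => by simp [hm]) (fun _ => rfl) ?_)
    simp [poch]
  have hcont : ContinuousAt (gaussF a b c) 0 :=
    (gaussF_spec hb hc).1.continuousOn.continuousAt (isOpen_cutPlane.mem_nhds zero_mem_cutPlane)
  have ht : Tendsto (fun y : ℝ => -(y : ℂ)⁻¹) atTop (𝓝 0) := by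
    have := ((Complex.continuous_ofReal.tendsto 0).comp tendsto_inv_atTop_zero).neg
    simpa [Function.comp_def] using this
  have := (hcont.tendsto.comp ht).eventually_ne (by rw [h1]; exact one_ne_zero)
  obtain ⟨y, hy, hy'⟩ := (this.and (eventually_gt_atTop 0)).exists
  exact ⟨y, hy', hy⟩

/-- Poincaré series of inequivalent points are different. -/
theorem exists_poincare_kerF3_ne (ha : 1 < a.re) (hb : (n : ℝ) - 1 < b.re) (hn : 1 ≤ n)
    {Z' Z'' : Pt n} (hZ' : Z' ∈ HH n) (hZ'' : Z'' ∈ HH n) (hne : ¬ SameOrbit Z' Z'') :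
    ∃ Z ∈ regF3 Z' ∩ regF3 Z'',
      poincare (kerF3 n a b) Z Z' ≠ poincare (kerF3 n a b) Z Z'' := by
  by_contra! hall
  obtain ⟨h1, h2, h3, h4, h5⟩ := kerF3_param ha hb hn
  obtain ⟨y, y0, hg⟩ := exists_gaussF_ne_zero (a := b) h3 h4
  have hv := im_pos hZ'
  set v := Z'.2.im with hvdef
  -- The last coordinate approaches z'_{n+1} horizontally while ρ+β = v and β/ρ = y stay fixed. So
  -- y(W ε) is constant, and for stabilising γ one gets x = ε²/(4ρv), which tends to 0.
  let W : ℝ → Pt n := fun ε => (Pi.single ⟨0, hn⟩ ((√(v * y / (1 + y)) : ℝ) : ℂ), Z'.2 + (ε : ℂ))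
  have hβ : ∀ ε, beta (W ε) = v * y / (1 + y) := fun ε => by
    rw [beta, Finset.sum_eq_single ⟨0, hn⟩]
    · simp only [W, Pi.single_eq_same, Complex.norm_real, Real.norm_eq_abs, sq_abs]
      exact Real.sq_sqrt (by positivity)
    · intro j _ hj; simp [W, hj]
    · simp
  have hρ : ∀ ε, rho (W ε) = v / (1 + y) := fun ε => by
    rw [rho, hβ]
    simp only [W, Complex.add_im, Complex.ofReal_im, add_zero]
    rw [← hvdef]; field_simp; ring
  have hρ0 : 0 < v / (1 + y) := by positivity
  have hy : ∀ ε, yinv (W ε) = y := fun ε => by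
    rw [yinv, hβ, hρ]; field_simp
  have hH : ∀ ε, W ε ∈ HH n := fun ε => by
    have := hρ ε ▸ hρ0
    exact sub_pos.1 this
  have hz : ∀ ε, (W ε).1 ≠ 0 := fun ε h0 => by
    have : beta (W ε) = 0 := by simp [beta, h0]
    rw [hβ] at this
    have : 0 < v * y / (1 + y) := by positivity
    linarith
  have hoff : ∀ ε, W ε ∈ offAxis n := fun ε => ⟨hH ε, hz ε⟩
  have hW : Continuous W := by fun_prop
  have hW2 : ∀ ε, (W ε).2 = Z'.2 + ε := fun ε => rfl
  have hW0 : (W 0).2 = Z'.2 := by simp [W]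
  -- the terms of the stabilizer
  have hfin := finite_snd_eq (hH 0) hZ'
  set S := hfin.toFinset
  have hS : ∀ γ, γ ∈ S ↔ (W 0).2 = (act γ Z').2 := fun γ => by simp [S]
  have hS0 : S.card ≠ 0 := by
    refine Finset.card_ne_zero_of_mem (a := 1) ((hS 1).2 ?_)
    rw [hW0]; simp [act, den]
  obtain ⟨κ, κ0, hκ⟩ := exists_coefSize_le_of_ne (hH 0) hZ'
  -- Without the finitely many terms with γw' = w', the series of Z' is continuous at the singular
  -- point W 0 itself.
  have hR := (poincare_kerF3_regular ha hb hn (hoff 0) hZ'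
    (Subtype.val : ((S : Set (GZ n))ᶜ : Set (GZ n)) → GZ n) Subtype.val_injective
    ⟨κ, κ0, fun j => hκ j fun h => j.2 ((hS j).2 h)⟩).2.1.continuousAt
  have h0'' : W 0 ∈ regF3 Z'' := ⟨hH 0, hz 0, fun ⟨γ, hγ⟩ => hne ⟨γ, hW0 ▸ hγ⟩⟩
  have hR'' : ContinuousAt (fun Z => poincare (kerF3 n a b) Z Z'') (W 0) :=
    ((isAutForm_poincare_kerF3 ha hb hn hZ'').2.contDiffOn.continuousOn).continuousAt
      ((isOpen_regF3 hZ'').mem_nhds h0'')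
  have hlim := ((hR''.sub hR).norm.comp hW.continuousAt).tendsto.mono_left
    (nhdsWithin_le_nhds (s := Ioi (0 : ℝ)))
  -- the points near `W 0` are regular
  have hreg' : ∀ᶠ ε in 𝓝[>] (0 : ℝ), W ε ∈ regF3 Z' := by
    filter_upwards [Ioo_mem_nhdsGT (show 0 < √κ by positivity)] with ε hε
    refine ⟨hH ε, hz ε, ?_⟩
    rintro ⟨γ, hγ⟩
    have hp : 0 < ‖coefP Z' γ‖ ^ 2 := by have := coefP_ne_zero hZ' γ; positivity
    by_cases hst : (W 0).2 = (act γ Z').2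
    · rw [← hst, hW2, hW2, add_left_cancel_iff] at hγ
      exact hε.1.ne' (by exact_mod_cast hγ)
    · have h := hκ γ hst
      rw [coef_sub hZ', ← hγ, hW2, hW2, norm_mul, mul_pow] at h
      have e : ‖Z'.2 + ((0 : ℝ) : ℂ) - (Z'.2 + (ε : ℂ))‖ ^ 2 = ε ^ 2 := by
        rw [show Z'.2 + ((0 : ℝ) : ℂ) - (Z'.2 + (ε : ℂ)) = -(ε : ℂ) by push_cast; ring, norm_neg,
          Complex.norm_real, Real.norm_eq_abs, sq_abs]
      rw [e] at h
      have hq : ‖coefP Z' γ‖ ^ 2 ≤ coefSize Z' γ := by unfold coefSize; nlinarith [sq_nonneg ‖coefQ Z' γ‖]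
      have hε2 : ε ^ 2 < κ := by
        have := hε.1
        calc ε ^ 2 < √κ ^ 2 := by gcongr; exact hε.2
          _ = κ := Real.sq_sqrt κ0.le
      nlinarith
  have hreg'' : ∀ᶠ ε in 𝓝[>] (0 : ℝ), W ε ∈ regF3 Z'' :=
    (hW.continuousAt.eventually ((isOpen_regF3 hZ'').mem_nhds h0'')).filter_mono nhdsWithin_le_nhds
  -- comparison
  have hX : Tendsto (fun ε : ℝ => ε ^ 2 / (4 * (v / (1 + y)) * v)) (𝓝[>] 0) (𝓝[>] 0) := by
    refine tendsto_nhdsWithin_iff.2 ⟨?_, ?_⟩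
    · have : ContinuousAt (fun ε : ℝ => ε ^ 2 / (4 * (v / (1 + y)) * v)) 0 := by fun_prop
      have := this.tendsto.mono_left (nhdsWithin_le_nhds (s := Ioi (0 : ℝ)))
      simpa using this
    · filter_upwards [self_mem_nhdsWithin] with ε hε
      have hε : 0 < ε := hε
      change 0 < ε ^ 2 / (4 * (v / (1 + y)) * v)
      positivity
  have hT := ((tendsto_norm_kerF3_atTop ha hb hn y0 hg).comp hX).const_mul_atTop
    (show (0 : ℝ) < S.card by exact_mod_cast Nat.pos_of_ne_zero hS0)
  -- The stabilising terms all equal the same kernel value, so they cannot cancel. If the two series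
  -- agreed, the number of these terms times the kernel would have a finite limit, although it tends
  -- to infinity in norm.
  refine not_tendsto_nhds_of_tendsto_atTop hT _ (hlim.congr' ?_)
  filter_upwards [hreg', hreg''] with ε hε hε'
  have hs := (isAutForm_poincare_kerF3 ha hb hn hZ').1 _ hε
  have hsum := hs.sum_add_tsum_compl (s := S)
  have hterm : ∀ γ ∈ S, poincareTerm (kerF3 n a b) (W ε) Z' γ =
      kerF3 n a b (ε ^ 2 / (4 * (v / (1 + y)) * v)) y := fun γ hγ => by
    have hγ := (hS γ).1 hγ
    have e : Complex.normSq ((W ε).2 - Z'.2) = ε ^ 2 := by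
      rw [hW2, add_sub_cancel_left, Complex.normSq_ofReal, pow_two]
    rw [poincareTerm, hy, xinv_eq, ← hγ, hW0, hρ, e]
  rw [Finset.sum_congr rfl hterm, Finset.sum_const, nsmul_eq_mul] at hsum
  have hcmp := hall (W ε) ⟨hε, hε'⟩
  simp only [Function.comp_apply, Pi.sub_apply]
  rw [← hcmp, poincare, ← hsum, add_sub_cancel_right, norm_mul, Complex.norm_natCast]

end Inequivalent
end UnitaryForms
end

/-! ### Assembly of the theorem -/

open UnitaryForms

theorem mainTheorem1 (n : ℕ) (hn : 1 ≤ n) :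
    -- `x` and `y` are invariants of the action of `G(ℤ)` on the Siegel domain
    (∀ γ : GZ n, ∀ Z ∈ HH n, ∀ Z' ∈ HH n, act γ Z ∈ HH n ∧
      xinv (act γ Z) (act γ Z') = xinv Z Z' ∧ yinv (act γ Z) = yinv Z) ∧
    -- nondegenerate Poincaré series
    (∀ a b s : ℂ, a + b = s → (n : ℝ) < s.re → 1 < a.re → (n : ℝ) - 1 < b.re →
      (∀ Z' ∈ HH n,
        (∀ Z ∈ regF3 Z', Summable (poincareTerm (kerF3 n a b) Z Z')) ∧
        (regF3 Z').domRestrict (fun Z => poincare (kerF3 n a b) Z Z') ∈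
          autForms n (regF3 Z') (s * (s - n - 1))) ∧
      -- inequivalent points give different series
      (∀ Z' ∈ HH n, ∀ Z'' ∈ HH n, ¬ SameOrbit Z' Z'' →
        ∃ Z ∈ regF3 Z' ∩ regF3 Z'',
          poincare (kerF3 n a b) Z Z' ≠ poincare (kerF3 n a b) Z Z'')) ∧
    (∀ s : ℂ, (n : ℝ) < s.re →
      -- degenerate Poincaré series
      (∀ Z' ∈ HH n,
        (∀ Z ∈ regX Z', Summable (poincareTerm (kerX n s) Z Z')) ∧
        (regX Z').domRestrict (fun Z => poincare (kerX n s) Z Z') ∈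
          autForms n (regX Z') (s * (s - n - 1))) ∧
      (∀ Z' ∈ HH n,
        (∀ Z ∈ regXY Z', Summable (poincareTerm (kerXY n s) Z Z')) ∧
        (regXY Z').domRestrict (fun Z => poincare (kerXY n s) Z Z') ∈
          autForms n (regXY Z') (s * (s - n - 1))) ∧
      -- infinitely many forms that are regular everywhere
      (autForms n (HH n) (s * (s - n - 1))).Infinite ∧
      -- Eisenstein series
      (∀ Z ∈ HH n, Summable (eisTerm s 0 Z)) ∧
      (HH n).domRestrict (eis s 0) ∈ autForms n (HH n) (s * (s - n - 1)) ∧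
      (∀ Z ∈ offAxis n, Summable (eisTerm s (1 - n) Z)) ∧
      (offAxis n).domRestrict (eis s (1 - n)) ∈ autForms n (offAxis n) (s * (s - n - 1))) ∧
    -- the modular functions `j_m`
    (∀ m : ℕ,
      (∀ Z ∈ HH n, Summable (jacTerm 4 m Z) ∧ Summable (jacTerm 6 (3 / 2 * m) Z)) ∧
      IsModForm n 4 m (jacEis 4 m) ∧ IsModForm n 6 (3 / 2 * m) (jacEis 6 (3 / 2 * m)) ∧
      IsModForm n 12 (3 * m) (fun Z => g2 m Z ^ 3) ∧ IsModForm n 12 (3 * m) (disc m) ∧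
      DifferentiableOn ℂ (fun Z => g2 m Z ^ 3) (HH n) ∧ DifferentiableOn ℂ (disc m) (HH n) ∧
      (∃ Z ∈ HH n, disc m Z ≠ 0) ∧
      (∀ γ : GZ n, ∀ Z ∈ HH n, disc m Z ≠ 0 →
        disc m (act γ Z) ≠ 0 ∧ jm m (act γ Z) = jm m Z)) := by
  refine ⟨fun γ Z hZ Z' hZ' => ⟨act_mem_HH γ hZ, xinv_act γ hZ hZ', yinv_act γ hZ⟩, ?_, ?_, ?_⟩
  · rintro a b s rfl - ha hb
    refine ⟨fun Z' hZ' => ?_, fun Z' hZ' Z'' hZ'' h => exists_poincare_kerF3_ne ha hb hn hZ' hZ'' h⟩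
    obtain ⟨h1, h2⟩ := isAutForm_poincare_kerF3 ha hb hn hZ'
    exact ⟨h1, _, h2, rfl⟩
  · intro s hs
    have hn1 : (1 : ℝ) ≤ n := by exact_mod_cast hn
    have he := isAutForm_eis (n := n) (lam := s) (mu := 0) (isOpen_HH n) subset_rfl
      subset_closure (fun γ Z hZ => act_mem_HH γ hZ) (by simpa using hn1.trans_lt hs) (Or.inl rfl)
    have hf := isAutForm_eis (n := n) (lam := s) (mu := 1 - n) (isOpen_offAxis n)
      (fun Z hZ => hZ.1) (HH_subset_closure_offAxis hn) (fun γ Z hZ => act_mem_offAxis γ hZ)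
      (by simp; linarith) (Or.inr ⟨rfl, subset_rfl⟩)
    refine ⟨fun Z' hZ' => ?_, fun Z' hZ' => ?_, autForms_infinite hn hs, ?_, ⟨_, he, rfl⟩,
      ?_, ⟨_, hf, rfl⟩⟩
    · obtain ⟨h1, h2⟩ := isAutForm_poincare_kerX hn hs hZ'
      exact ⟨h1, _, h2, rfl⟩
    · obtain ⟨h1, h2⟩ := isAutForm_poincare_kerXY hn hs hZ'
      exact ⟨h1, _, h2, rfl⟩
    · exact fun Z hZ => (eis_regular (isOpen_HH n) subset_rfl
        (by simpa using hn1.trans_lt hs) (Or.inl rfl) hZ).1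
    · exact fun Z hZ => (eis_regular (isOpen_offAxis n) (fun Z hZ => hZ.1)
        (by simp; linarith) (Or.inr ⟨rfl, subset_rfl⟩) hZ).1
  · intro m
    exact ⟨fun Z hZ => ⟨summable_jacTerm (by norm_num) _ hZ, summable_jacTerm (by norm_num) _ hZ⟩,
      isModForm_jacEis (by decide) (by norm_num) _, isModForm_jacEis (by decide) (by norm_num) _,
      isModForm_g2_cube _, isModForm_disc _, differentiableOn_g2_cube _, differentiableOn_disc _,
      exists_disc_ne_zero _, fun γ Z hZ h => jm_act _ γ hZ h⟩
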